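/- Let $G$ be a finite graph (loops and multiple edges allowed) embedded in a Klein bottle $\widehat P$, with $p\ge 3$ vertices and no trivial loops, i.e. no loop of $G$ bounds a disk in $\widehat P$ with no vertex in its interior. Fix an orientation of a small disk neighbourhood of each vertex. An edge is called positive if the orientations at its two ends agree along it and negative otherwise; thus a loop is positive if its regular neighbourhood is an annulus and negative if it is a Möbius band. Two edges of $G$ are parallel if they are related by a chain of edges in which consecutive ones cobound a disk face of $G$ with two sides. The reduced graph $\overline G$ is obtained by amalgamating each family of parallel edges into a single edge, and $\overline G^+$ is its subgraph consisting of all vertices and all positive edges (degrees count loops twice). A vertex is interior if no negative edge of $G$ is incident to it, and good if all positive edge endpoints around it are successive in $G$. Suppose that $G$ has no interior vertex. Then at least one of the following holds: 1. $\overline G^+$ has a good vertex of degree $4$ which is not incident to a negative loop in $G$; 2. $\overline G^+$ has a vertex of degree at most $3$ which is not incident to a negative loop in $G$; 3. $\overline G^+$ has a vertex of degree at most $2$ which is incident to exactly one negative loop in $\overline G$; 4. up to a homeomorphism of surfaces carrying positive edges to positive edges, $\overline G$ is one of the following two graphs, which triangulate a Klein bottle obtained from an annulus $A$ by attaching a Möbius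 band to each of its two boundary circles: * (first graph) four vertices $x,y,z,w$. One boundary circle of $A$ is a cycle of two positive edges between $x$ and $y$, the other one a cycle of two positive edges between $z$ and $w$. Inside $A$ there are four further positive edges, joining $y$ to $z$, $y$ to $w$, $y$ to $z$, $x$ to $z$ in this cyclic order around $A$. The Möbius band attached along the $x,y$-circle contains one negative loop at $x$ and one negative edge from $x$ to $y$; the other Möbius band contains one negative loop at $w$ and one negative edge from $w$ to $z$. * (second graph) three vertices $x,y,z$, where $A$ is pinched at $z$: it is a quadrilateral disk with corners $z,x,z,y$ whose two opposite corners $z$ are identified, so that its boundary consists of a cycle of two positive edges between $z$ and $x$ and a cycle of two positive edges between $z$ and $y$; one further positive edge is the diagonal from $x$ to $y$. The Möbius band attached along the $z,x$-circle contains one negative loop at $x$ and one negative edge from $z$ to $x$; the one attached along the $z,y$-circle contains one negative loop at $y$ and one negative edge from $z$ to $y$. -/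

import Mathlib

/-- A finite graph with vertex set `V`, cellularly embedded in a closed surface, with a local
orientation chosen at every vertex, encoded by its rotation system with signs.  `D` is the set of
edge endpoints ("darts").  The dart `d` lies at the vertex `vert d`, the other endpoint of the same
edge is `opp d`, and `rot` runs through the darts around each vertex in cyclic order, anticlockwise
for the orientation chosen at that vertex.  The edge of `d` is positive (`pos d = true`) if the
orientations chosen at its two ends agree along it and negative otherwise; in particular a loop is
positive iff a neighbourhood of it is an annulus, negative iff it is a Moebius band. -/
structure SignedMap (V D : Type*) where
  vert : D → V
  opp : D → D
  rot : Equiv.Perm D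
  pos : D → Bool
  opp_opp : ∀ d, opp (opp d) = d
  opp_ne : ∀ d, opp d ≠ d
  pos_opp : ∀ d, pos (opp d) = pos d
  vert_rot : ∀ d, vert (rot d) = vert d
  rot_trans : ∀ d d', vert d = vert d' → ∃ n : ℕ, (rot ^ n) d = d'

namespace SignedMap

variable {V D : Type*} (M : SignedMap V D)

/-- The (unoriented) edge that contains a dart. -/
def edge (d : D) : Sym2 D := s(d, M.opp d)

/-- A flag `(d, b)` is the dart `d` together with one of the two sides of its edge:
`b = true` is the anticlockwise (left) side seen from `vert d`, `b = false` the other one.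
`along` passes to the other end of the edge, staying on the same side of it. -/
def along (x : D × Bool) : D × Bool := (M.opp x.1, xor x.2 (M.pos x.1))

/-- Passing through the corner of a face at a vertex, to the next edge. -/
def turn (x : D × Bool) : D × Bool := if x.2 then (M.rot x.1, false) else (M.rot.symm x.1, true)

/-- Two flags that follow each other on the boundary of a face of the cellular embedding. -/
def FaceStep (x y : D × Bool) : Prop := y = M.along x ∨ y = M.turn x

/-- The faces of the cellular embedding. -/
def Face : Type _ := Quot M.FaceStep

/-- The face that contains a flag. -/
def face (x : D × Bool) : M.Face := Quot.mk _ x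

/-- The surface is connected. -/
def Connected : Prop :=
  ∀ u v : V, Relation.ReflTransGen (fun a b => ∃ d, M.vert d = a ∧ M.vert (M.opp d) = b) u v

/-- The surface is orientable: local orientations at the vertices can be chosen coherently. -/
def Orientable : Prop :=
  ∃ s : V → Bool, ∀ d, M.pos d = true ↔ s (M.vert d) = s (M.vert (M.opp d))

/-- The surface is a Klein bottle: the closed connected non-orientable surface of Euler
characteristic `|V| - |D| / 2 + |F| = 0`. -/
def IsKleinBottle : Prop :=
  M.Connected ∧ ¬ M.Orientable ∧ 2 * Nat.card V + 2 * Nat.card M.Face = Nat.card D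

/-! ### Arbitrary graphs on the surface

A graph on the surface, not necessarily cellularly embedded and not necessarily connected, is given
by all the vertices and some of the edges of a cellular embedding `M`; the set of edges is recorded
as the set `G` of their darts.  (Every finite graph on a closed connected surface which has at least
one vertex arises like this: add edges that cut its faces into disks.) -/

/-- `G` is the set of darts of a set of edges. -/
def IsEdgeSet (G : Set D) : Prop := ∀ d ∈ G, M.opp d ∈ G

/-- Two flags are adjacent in the complement of the graph `G`: the edges of `M` that are not in `G`
may be crossed. -/
def RegionStep (G : Set D) (x y : D × Bool) : Prop :=
  M.FaceStep x y ∨ (x.1 ∉ G ∧ y = (x.1, !x.2))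

/-- The face of the graph `G` (component of the complement of the graph in the surface) that
contains the flag `x`, as a set of flags. -/
def region (G : Set D) (x : D × Bool) : Set (D × Bool) :=
  {y | Relation.EqvGen (M.RegionStep G) x y}

/-- The face of `G` at `x` is an open disk with exactly `k` sides (counted with multiplicity).
It is glued from open disks, the faces of `M` that it contains, along the edges of `M` that it
contains, so it is a disk iff its Euler characteristic, faces minus edges, is `1`.
Each of its sides on `G` consists of two flags. -/
def IsDiskFace (G : Set D) (x : D × Bool) (k : ℕ) : Prop :=
  (M.face '' M.region G x).ncard =
      ((fun y : D × Bool => M.edge y.1) '' {y ∈ M.region G x | y.1 ∉ G}).ncard + 1 ∧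
    {y ∈ M.region G x | y.1 ∈ G}.ncard = 2 * k

/-- No edge of `G` is a trivial loop, that is, no loop of `G` bounds a disk without vertices in its
interior.  (An innermost such loop bounds a disk face with one side.) -/
def NoTrivialLoops (G : Set D) : Prop := ∀ x, ¬ M.IsDiskFace G x 1

/-- The edges of `d` and `d'` bound a disk face of `G` with two sides. -/
def CoboundBigon (G : Set D) (d d' : D) : Prop :=
  d ∈ G ∧ d' ∈ G ∧
    ∃ b b' : Bool, M.IsDiskFace G (d, b) 2 ∧ (d', b') ∈ M.region G (d, b)

/-- The edges of `d` and `d'` are parallel in `G`. -/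
def Parallel (G : Set D) (d d' : D) : Prop := Relation.EqvGen (M.CoboundBigon G) d d'

/-- `H` is a reduced graph of `G`: each family of parallel edges of `G` is replaced by a single one
of its edges. -/
def IsReducedGraph (G H : Set D) : Prop :=
  H ⊆ G ∧ M.IsEdgeSet H ∧
    (∀ d ∈ G, ∃ h ∈ H, M.Parallel G d h) ∧
    (∀ h ∈ H, ∀ h' ∈ H, M.Parallel G h h' → h' = h ∨ h' = M.opp h)

/-- An interior vertex of `G`: no negative edge of `G` is incident to it. -/
def IsInterior (G : Set D) (v : V) : Prop := ∀ d ∈ G, M.vert d = v → M.pos d = true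

/-- Number of all darts at a vertex. -/
noncomputable def degree (v : V) : ℕ := {d | M.vert d = v}.ncard

/-- A good vertex of `G`: going once around it from a suitable start, one meets first all positive
edge endpoints of `G` and then all negative ones. -/
def IsGood (G : Set D) (v : V) : Prop :=
  ∃ d, M.vert d = v ∧ ∃ k : ℕ, ∀ i < M.degree v,
    (M.rot ^ i) d ∈ G → (M.pos ((M.rot ^ i) d) = true ↔ i < k)

/-- The degree of `v` in the subgraph of the positive edges of `H` (loops count twice). -/
noncomputable def posDegree (H : Set D) (v : V) : ℕ :=
  {d ∈ H | M.vert d = v ∧ M.pos d = true}.ncard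

/-- The set of negative loops of `G` at `v`. -/
def negLoops (G : Set D) (v : V) : Set (Sym2 D) :=
  M.edge '' {d ∈ G | M.vert d = v ∧ M.vert (M.opp d) = v ∧ M.pos d = false}

/-- `d'` is the first dart of `H` that comes after `d` when turning according to `ρ`. -/
def IsNext (H : Set D) (ρ : Equiv.Perm D) (d d' : D) : Prop :=
  d' ∈ H ∧ ∃ n : ℕ, 0 < n ∧ (ρ ^ n) d = d' ∧ ∀ i, 0 < i → i < n → (ρ ^ i) d ∉ H

/-- There is a homeomorphism from the surface of the connected map `N` to the surface of `M` which
carries the graph `N` to the graph `H` and positive edges to positive edges.  In terms of the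
rotation systems: a bijection of the darts that respects edges, signs and the cyclic orders around
the vertices, up to a simultaneous reversal of all the cyclic orders. -/
def IsCopy {V' D' : Type*} (N : SignedMap V' D') (H : Set D) : Prop :=
  ∃ f : D' → D, Function.Injective f ∧ Set.range f = H ∧
    (∀ v, ∃ d, M.vert (f d) = v) ∧
    (∀ d, f (N.opp d) = M.opp (f d)) ∧
    (∀ d, M.pos (f d) = N.pos d) ∧
    ((∀ d, IsNext H M.rot (f d) (f (N.rot d))) ∨
      (∀ d, IsNext H M.rot⁻¹ (f d) (f (N.rot d))))

/-- The vertices at which the darts of the first exceptional graph lie. -/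
def exceptionalVert₁ (d : Fin 12 × Bool) : Fin 4 :=
  if d.2 then ![1, 1, 3, 3, 2, 3, 2, 2, 1, 0, 2, 3] d.1
    else ![0, 0, 2, 2, 1, 1, 1, 0, 0, 0, 3, 3] d.1

/-- The cyclic orders of the darts around the vertices of the first exceptional graph. -/
def exceptionalRot₁ : Equiv.Perm (Fin 12 × Bool) :=
    List.formPerm [(7, false), (0, false), (9, false), (8, false), (9, true), (1, false)] *
    List.formPerm [(8, true), (0, true), (4, false), (5, false), (6, false), (1, true)] *
    List.formPerm [(10, true), (2, false), (4, true), (7, true), (6, true), (3, false)] *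
    List.formPerm [(5, true), (2, true), (11, false), (10, false), (11, true), (3, true)]

/-- The first exceptional graph, with vertices `x = 0`, `y = 1`, `z = 2`, `w = 3`.
Positive edges: `0`, `1` from `x` to `y`; `2`, `3` from `z` to `w`; `4`, `6` from `y` to `z`;
`5` from `y` to `w`; `7` from `x` to `z`.
Negative edges: `8` from `x` to `y`; loop `9` at `x`; `10` from `w` to `z`; loop `11` at `w`.
The edge `e` has the darts `(e, false)` at its first and `(e, true)` at its second endpoint. -/
def exceptional₁ : SignedMap (Fin 4) (Fin 12 × Bool) where
  vert := exceptionalVert₁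
  opp d := (d.1, !d.2)
  pos d := decide (d.1 < 8)
  rot := exceptionalRot₁
  opp_opp := by decide
  opp_ne := by decide
  pos_opp := by decide
  vert_rot := by decide +kernel
  rot_trans := by
    have h : ∀ d d', exceptionalVert₁ d = exceptionalVert₁ d' →
        ∃ n : Fin 6, (exceptionalRot₁ ^ (n : ℕ)) d = d' := by decide +kernel
    intro d d' hd
    obtain ⟨n, hn⟩ := h d d' hd
    exact ⟨n, hn⟩

/-- The vertices at which the darts of the second exceptional graph lie. -/
def exceptionalVert₂ (d : Fin 9 × Bool) : Fin 3 :=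
  if d.2 then ![0, 0, 1, 1, 1, 0, 0, 1, 1] d.1
    else ![2, 2, 2, 2, 0, 2, 0, 2, 1] d.1

/-- The cyclic orders of the darts around the vertices of the second exceptional graph. -/
def exceptionalRot₂ : Equiv.Perm (Fin 9 × Bool) :=
    List.formPerm [(0, true), (4, false), (1, true), (6, false), (5, true), (6, true)] *
    List.formPerm [(4, true), (2, true), (8, false), (7, true), (8, true), (3, true)] *
    List.formPerm [(7, false), (2, false), (0, false), (5, false), (1, false), (3, false)]

/-- The second exceptional graph, with vertices `x = 0`, `y = 1`, `z = 2`.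
Positive edges: `0`, `1` from `z` to `x`; `2`, `3` from `z` to `y`; `4` from `x` to `y`.
Negative edges: `5` from `z` to `x`; loop `6` at `x`; `7` from `z` to `y`; loop `8` at `y`. -/
def exceptional₂ : SignedMap (Fin 3) (Fin 9 × Bool) where
  vert := exceptionalVert₂
  opp d := (d.1, !d.2)
  pos d := decide (d.1 < 5)
  rot := exceptionalRot₂
  opp_opp := by decide
  opp_ne := by decide
  pos_opp := by decide
  vert_rot := by decide +kernel
  rot_trans := by
    have h : ∀ d d', exceptionalVert₂ d = exceptionalVert₂ d' →
        ∃ n : Fin 6, (exceptionalRot₂ ^ (n : ℕ)) d = d' := by decide +kernel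
    intro d d' hd
    obtain ⟨n, hn⟩ := h d d' hd
    exact ⟨n, hn⟩

end SignedMap

/-! Parallel edges are first removed. Deleting from `G`, one at a time, an edge of a two-sided disk
face until the reduced graph `H` is left (`IsPartialReduction.reduce`) keeps the ends and signs of
edges represented, creates no one-sided disk and reflects goodness of vertices. As there are at
least three vertices, every disk face of `H` then has at least three sides (`NoSmallDisks`). Assume
that the first three conclusions fail; the facts about `H` that remain are collected in
`IsExtremal`.

Let `P` be the set of positive edges of `H`. A negative edge never lies in a disk face of `P`,
because it would cut off a disk with a single negative side and so reverse the orientation along the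
boundary of a disk (`pos_of_disk`). Every vertex has a negative edge, so every vertex with positive
edges has a corner in a face of `P` that is not a disk. Call these faces and corners wild, let `W`
be the union of the wild faces, `d(v)` the positive degree of `v` and `n(v)` its number of wild
corners. Euler's formula, with at least three sides for every disk face, gives
(`NoSmallDisks.card_le`) `∑ (d(v) + 2 n(v)) ≤ 6 |V| + 6 χ(W)`, where `χ(W) ≤ 0`.

A vertex without negative loops has `d ≥ 5`, or `d = 4` and `n ≥ 2`, since for `n = 1` it would be
good; it contributes at least 7. A vertex with exactly one negative loop has `d ≥ 3` and contributes
at least 5. Two negative loops at a vertex either force `n ≥ 2`, with a contribution of at least 6,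
or make `χ(W)` negative, which is even more expensive (`IsExtremal.of_two_le_negLoops`). A spanning
tree together with negative loops at distinct vertices does not separate the surface, so at most two
vertices have negative loops (`card_le_two`). Hence there are exactly two of them, `χ(W) = 0`, there
are three or four vertices, the estimate is sharp, and five lists of pairs `(d, n)` remain
(`IsExtremal.numeric`).

Sharpness means that all disk faces of `P` are triangles and that wild faces have Euler
characteristic 0 (`IsTight`). The permutation `a ↦ opp (next a)`, which follows the boundaries of
the faces of `P`, is then determined by finitely many combinatorial constraints. Three of the lists
have no solution, and the other two have exactly one each (`IsTight.solution_three`,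
`IsTight.solution_four`). There the wild faces are two, each with two sides, one end of which
carries a negative loop. The same Euler count inside such a face leaves room for exactly two
negative edges and forces their position (`IsTight.exists_core`). This gives the two exceptional
graphs.

Faces of arbitrary edge sets are handled through flags. Euler characteristics are sums of rational
weights of flags, so that they are additive, and topological facts about disks are derived from the
inequality `χ ≤ 1` for every face. -/

namespace SignedMap

variable {V D : Type*} (M : SignedMap V D)

/-! ### Flags and regions -/

/-- Passing to the other side of the edge of a flag. -/
def cross (x : D × Bool) : D × Bool := (x.1, !x.2)

@[simp] lemma cross_fst (x : D × Bool) : (cross x).1 = x.1 := rfl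

@[simp] lemma cross_cross (x : D × Bool) : cross (cross x) = x := by
  simp [cross]

lemma cross_ne (x : D × Bool) : cross x ≠ x := by
  intro h
  have := congrArg Prod.snd h
  simp [cross] at this

@[simp] lemma along_fst (x : D × Bool) : (M.along x).1 = M.opp x.1 := rfl

@[simp] lemma along_along (x : D × Bool) : M.along (M.along x) = x := by
  obtain ⟨d, b⟩ := x
  simp [along, M.opp_opp, M.pos_opp]

lemma along_ne (x : D × Bool) : M.along x ≠ x := fun h => M.opp_ne x.1 (congrArg Prod.fst h)

@[simp] lemma turn_turn (x : D × Bool) : M.turn (M.turn x) = x := by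
  obtain ⟨d, b⟩ := x
  cases b <;> simp [turn]

lemma turn_snd (x : D × Bool) : (M.turn x).2 = !x.2 := by
  obtain ⟨d, b⟩ := x
  cases b <;> simp [turn]

lemma turn_ne (x : D × Bool) : M.turn x ≠ x := by
  intro h
  have := M.turn_snd x
  rw [h] at this
  simp at this

lemma vert_rot_symm (d : D) : M.vert (M.rot.symm d) = M.vert d := by
  conv_rhs => rw [← M.rot.apply_symm_apply d, M.vert_rot]

lemma vert_turn (x : D × Bool) : M.vert (M.turn x).1 = M.vert x.1 := by
  obtain ⟨d, b⟩ := x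
  cases b <;> simp [turn, M.vert_rot, M.vert_rot_symm]

lemma IsEdgeSet.opp_mem_iff {M : SignedMap V D} {Q : Set D} (hQ : M.IsEdgeSet Q) {d : D} :
    M.opp d ∈ Q ↔ d ∈ Q :=
  ⟨fun h => by simpa [M.opp_opp] using hQ _ h, hQ d⟩

lemma mem_region_self (Q : Set D) (x : D × Bool) : x ∈ M.region Q x := Relation.EqvGen.refl x

variable {M} in
lemma mem_region_trans {Q : Set D} {x y z : D × Bool} (h : y ∈ M.region Q x)
    (h' : z ∈ M.region Q y) : z ∈ M.region Q x := Relation.EqvGen.trans _ _ _ h h'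

variable {M} in
lemma mem_region_symm {Q : Set D} {x y : D × Bool} (h : y ∈ M.region Q x) :
    x ∈ M.region Q y := Relation.EqvGen.symm _ _ h

variable {M} in
lemma region_eq {Q : Set D} {x y : D × Bool} (h : y ∈ M.region Q x) :
    M.region Q y = M.region Q x :=
  Set.ext fun _ => ⟨mem_region_trans h, mem_region_trans (mem_region_symm h)⟩

variable {M} in
lemma along_mem_region {Q : Set D} {x y : D × Bool} (h : y ∈ M.region Q x) :
    M.along y ∈ M.region Q x :=
  mem_region_trans h (Relation.EqvGen.rel _ _ (Or.inl (Or.inl rfl)))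

variable {M} in
lemma turn_mem_region {Q : Set D} {x y : D × Bool} (h : y ∈ M.region Q x) :
    M.turn y ∈ M.region Q x :=
  mem_region_trans h (Relation.EqvGen.rel _ _ (Or.inl (Or.inr rfl)))

variable {M} in
lemma cross_mem_region {Q : Set D} {x y : D × Bool} (h : y ∈ M.region Q x) (hy : y.1 ∉ Q) :
    cross y ∈ M.region Q x :=
  mem_region_trans h (Relation.EqvGen.rel _ _ (Or.inr ⟨hy, rfl⟩))

/-- `S` is a union of faces of the graph `Q`. -/
structure IsClosed (Q : Set D) (S : Set (D × Bool)) : Prop where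
  along : ∀ y ∈ S, M.along y ∈ S
  turn : ∀ y ∈ S, M.turn y ∈ S
  cross : ∀ y ∈ S, y.1 ∉ Q → SignedMap.cross y ∈ S

lemma isClosed_region (Q : Set D) (x : D × Bool) : M.IsClosed Q (M.region Q x) :=
  ⟨fun _ => along_mem_region, fun _ => turn_mem_region, fun _ => cross_mem_region⟩

lemma isClosed_univ (Q : Set D) : M.IsClosed Q Set.univ :=
  ⟨fun _ _ => trivial, fun _ _ => trivial, fun _ _ _ => trivial⟩

namespace IsClosed
variable {M} {Q Q' : Set D} {S T : Set (D × Bool)}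

lemma along_iff (h : M.IsClosed Q S) {y : D × Bool} : M.along y ∈ S ↔ y ∈ S :=
  ⟨fun hy => by simpa using h.along _ hy, h.along y⟩

lemma turn_iff (h : M.IsClosed Q S) {y : D × Bool} : M.turn y ∈ S ↔ y ∈ S :=
  ⟨fun hy => by simpa using h.turn _ hy, h.turn y⟩

lemma cross_iff (h : M.IsClosed Q S) {y : D × Bool} (hy : y.1 ∉ Q) :
    SignedMap.cross y ∈ S ↔ y ∈ S :=
  ⟨fun h' => by simpa using h.cross _ h' (by simpa using hy), fun h' => h.cross y h' hy⟩

lemma iff_of_mem_region (h : M.IsClosed Q S) {x y : D × Bool} (hy : y ∈ M.region Q x) :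
    y ∈ S ↔ x ∈ S := by
  change Relation.EqvGen _ x y at hy
  induction hy with
  | rel a b hab =>
    rcases hab with (rfl | rfl) | ⟨ha, rfl⟩
    · exact h.along_iff
    · exact h.turn_iff
    · exact h.cross_iff ha
  | refl a => rfl
  | symm a b _ ih => exact ih.symm
  | trans a b c _ _ ih1 ih2 => exact ih2.trans ih1

lemma region_subset (h : M.IsClosed Q S) {x : D × Bool} (hx : x ∈ S) : M.region Q x ⊆ S :=
  fun _ hy => (h.iff_of_mem_region hy).2 hx

lemma mono (h : M.IsClosed Q S) (hQ : Q ⊆ Q') : M.IsClosed Q' S :=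
  ⟨h.along, h.turn, fun y hy hn => h.cross y hy fun hq => hn (hQ hq)⟩

lemma compl (h : M.IsClosed Q S) : M.IsClosed Q Sᶜ :=
  ⟨fun _ hy hy' => hy (h.along_iff.1 hy'), fun _ hy hy' => hy (h.turn_iff.1 hy'),
    fun _ hy hn hy' => hy ((h.cross_iff hn).1 hy')⟩

lemma inter (h : M.IsClosed Q S) (h' : M.IsClosed Q T) : M.IsClosed Q (S ∩ T) :=
  ⟨fun y hy => ⟨h.along y hy.1, h'.along y hy.2⟩, fun y hy => ⟨h.turn y hy.1, h'.turn y hy.2⟩,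
    fun y hy hn => ⟨h.cross y hy.1 hn, h'.cross y hy.2 hn⟩⟩

lemma union (h : M.IsClosed Q S) (h' : M.IsClosed Q T) : M.IsClosed Q (S ∪ T) :=
  ⟨fun y hy => hy.imp (h.along y) (h'.along y), fun y hy => hy.imp (h.turn y) (h'.turn y),
    fun y hy hn => hy.imp (h.cross y · hn) (h'.cross y · hn)⟩

end IsClosed

lemma region_anti {Q Q' : Set D} (h : Q ⊆ Q') (x : D × Bool) :
    M.region Q' x ⊆ M.region Q x :=
  ((M.isClosed_region Q x).mono h).region_subset (M.mem_region_self Q x)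

lemma region_disjoint {Q : Set D} {x y : D × Bool} (h : y ∉ M.region Q x) :
    Disjoint (M.region Q x) (M.region Q y) :=
  Set.disjoint_left.2 fun _ hz hz' => h (mem_region_trans hz (mem_region_symm hz'))

lemma face_eq_iff {x y : D × Bool} : M.face x = M.face y ↔ y ∈ M.region Set.univ x := by
  have : M.RegionStep Set.univ = M.FaceStep := by
    funext x y
    simp [RegionStep]
  unfold face region
  rw [Set.mem_ofPred_eq, this]
  exact ⟨fun h => Quot.eqvGen_exact h, fun h => Quot.eqvGen_sound h⟩

/-! ### Adding an edge -/

/-- The edge set `Q` together with the edge of `d`. -/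
def addEdge (Q : Set D) (d : D) : Set D := insert d (insert (M.opp d) Q)

lemma mem_addEdge {Q : Set D} {d y : D} :
    y ∈ M.addEdge Q d ↔ y = d ∨ y = M.opp d ∨ y ∈ Q := Iff.rfl

lemma subset_addEdge (Q : Set D) (d : D) : Q ⊆ M.addEdge Q d :=
  fun _ h => Or.inr (Or.inr h)

lemma isEdgeSet_addEdge {Q : Set D} (hQ : M.IsEdgeSet Q) (d : D) : M.IsEdgeSet (M.addEdge Q d) := by
  rintro y (rfl | rfl | hy)
  · exact Or.inr (Or.inl rfl)
  · exact Or.inl (M.opp_opp d)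
  · exact Or.inr (Or.inr (hQ _ hy))

variable {M} in
lemma region_addEdge_of_notMem {Q : Set D} {d : D} {x : D × Bool}
    (h : ∀ b, (d, b) ∉ M.region Q x) :
    M.region (M.addEdge Q d) x = M.region Q x := by
  refine (M.region_anti (M.subset_addEdge Q d) x).antisymm ?_
  have hc := M.isClosed_region (M.addEdge Q d) x
  have hsub := M.region_anti (M.subset_addEdge Q d) x
  have hc' : M.IsClosed Q (M.region (M.addEdge Q d) x) := by
    refine ⟨hc.along, hc.turn, fun y hy hn => hc.cross y hy ?_⟩
    obtain ⟨y, b⟩ := y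
    rintro (h' | h' | h')
    · simp only at h'
      subst h'
      exact h b (hsub hy)
    · have := (M.isClosed_region Q x).along _ (hsub hy)
      simp only at h'
      subst h'
      simp only [along, M.opp_opp] at this
      exact h _ this
    · exact hn h'
  exact hc'.region_subset (M.mem_region_self _ x)

variable {M} in
-- An edge outside `Q` may be crossed, so adding it to `Q` can only cut its face into the parts seen
-- from its two sides.
lemma region_eq_union {Q : Set D} (d : D) (hd : d ∉ Q) (b : Bool) :
    M.region Q (d, b) = M.region (M.addEdge Q d) (d, b) ∪ M.region (M.addEdge Q d) (d, !b) := by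
  apply Set.Subset.antisymm
  · have h1 := M.isClosed_region (M.addEdge Q d) (d, b)
    have h2 := M.isClosed_region (M.addEdge Q d) (d, !b)
    have h := h1.union h2
    refine IsClosed.region_subset (S := _ ∪ _) ⟨h.along, h.turn, fun y hy hn => ?_⟩
      (Or.inl (M.mem_region_self _ _))
    have key : ∀ c, (d, c) ∈ M.region (M.addEdge Q d) (d, b) ∪ M.region (M.addEdge Q d) (d, !b) := by
      intro c
      by_cases hc : c = b
      · subst hc
        exact Or.inl (M.mem_region_self _ _)
      · have : c = !b := by cases c <;> cases b <;> simp_all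
        subst this
        exact Or.inr (M.mem_region_self _ _)
    obtain ⟨y, c⟩ := y
    by_cases hy' : y ∈ M.addEdge Q d
    · rcases hy' with h' | h' | h'
      · subst h'
        exact key _
      · subst h'
        have := h.along _ (key (xor (!c) (M.pos d)))
        simpa [along, cross] using this
      · exact absurd h' hn
    · exact h.cross _ hy hy'
  · apply Set.union_subset
    · exact M.region_anti (M.subset_addEdge Q d) _
    · refine (M.region_anti (M.subset_addEdge Q d) _).trans ?_
      rw [region_eq]
      exact cross_mem_region (y := (d, b)) (M.mem_region_self _ _) hd

end SignedMap

/-! ### The Euler characteristic of unions of faces -/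

namespace SignedMap

variable {V D : Type*} (M : SignedMap V D)

section Euler
set_option linter.unusedSectionVars false
open scoped Classical
open Finset
variable [Fintype D]

/-- The contribution of a flag to the Euler characteristic of the face of `Q` that contains it. -/
noncomputable def weight (Q : Set D) (x : D × Bool) : ℚ :=
  -- Every face of `M` has total weight 1, spread evenly over its flags; every edge that is not in
  -- `Q` has total weight -1, a quarter for each of its four flags.
  (#{y | M.face y = M.face x} : ℚ)⁻¹ - if x.1 ∈ Q then 0 else 4⁻¹

/-- The Euler characteristic of a union `S` of faces of `Q`. -/
noncomputable def chi (Q : Set D) (S : Set (D × Bool)) : ℚ := ∑ y with y ∈ S, M.weight Q y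

/-- The number of flags of `Q` in `S`. -/
noncomputable def flagCard (Q : Set D) (S : Set (D × Bool)) : ℕ := #{y : D × Bool | y ∈ S ∧ y.1 ∈ Q}

lemma chi_union (Q : Set D) {S T : Set (D × Bool)} (h : Disjoint S T) :
    M.chi Q (S ∪ T) = M.chi Q S + M.chi Q T := by
  unfold chi
  rw [← sum_union]
  · congr 1
    ext
    simp
  · rw [Finset.disjoint_left]
    intro y hy hy'
    exact Set.disjoint_left.1 h (by simpa using hy) (by simpa using hy')

lemma flagCard_union (Q : Set D) {S T : Set (D × Bool)} (h : Disjoint S T) :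
    flagCard Q (S ∪ T) = flagCard Q S + flagCard Q T := by
  unfold flagCard
  rw [← card_union_of_disjoint]
  · congr 1
    ext
    simp [or_and_right]
  · rw [Finset.disjoint_left]
    intro y hy hy'
    simp only [mem_filter, mem_univ, true_and] at hy hy'
    exact Set.disjoint_left.1 h hy.1 hy'.1

lemma flagCard_eq_zero {Q : Set D} {S : Set (D × Bool)} (h : ∀ y ∈ S, y.1 ∉ Q) :
    flagCard Q S = 0 := by
  rw [flagCard, card_eq_zero, filter_eq_empty_iff]
  exact fun y _ hy => h y hy.1 hy.2

lemma flagCard_diff {Q Q' : Set D} (h : Q ⊆ Q') (S : Set (D × Bool)) :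
    flagCard Q' S = flagCard Q S + flagCard (Q' \ Q) S := by
  unfold flagCard
  rw [← card_union_of_disjoint]
  · congr 1
    ext y
    have := @h y.1
    simp only [mem_filter, mem_univ, true_and, mem_union, Set.mem_sdiff]
    tauto
  · rw [Finset.disjoint_left]
    intro y hy hy'
    simp only [mem_filter, mem_univ, true_and] at hy hy'
    exact hy'.2.2 hy.2

/-- An edge that enters `Q` no longer counts as an open edge inside a face. This raises the Euler
characteristic by 1, a quarter per flag. -/
lemma chi_diff {Q Q' : Set D} (h : Q ⊆ Q') (S : Set (D × Bool)) :
    M.chi Q' S = M.chi Q S + flagCard (Q' \ Q) S / 4 := by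
  unfold chi flagCard weight
  rw [sum_sub_distrib, sum_sub_distrib, sub_add, sub_right_inj, card_filter, Nat.cast_sum,
    sum_div, sum_filter, sum_filter, ← sum_sub_distrib]
  refine sum_congr rfl fun y _ => ?_
  have := @h y.1
  by_cases h1 : y ∈ S <;> by_cases h2 : y.1 ∈ Q <;> by_cases h3 : y.1 ∈ Q' <;>
    simp_all

/-- The flags of an edge. -/
noncomputable def edgeFlags (d : D) : Finset (D × Bool) := {d, M.opp d} ×ˢ univ

lemma mem_edgeFlags {d : D} {x : D × Bool} : x ∈ M.edgeFlags d ↔ x.1 = d ∨ x.1 = M.opp d := by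
  simp [edgeFlags]

lemma card_edgeFlags (d : D) : #(M.edgeFlags d) = 4 := by
  rw [edgeFlags, card_product, card_pair (M.opp_ne d).symm]
  rfl

variable {M} in
lemma IsClosed.edgeFlags_subset {Q : Set D} {S : Set (D × Bool)} (hS : M.IsClosed Q S) {d : D}
    (h : ∀ b, (d, b) ∈ S) : ∀ x ∈ M.edgeFlags d, x ∈ S := by
  rintro ⟨e, b⟩ hx
  rcases M.mem_edgeFlags.1 hx with rfl | rfl
  · exact h b
  · have := hS.along _ (h (xor b (M.pos d)))
    simpa [SignedMap.along] using this

variable {M} in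
lemma IsClosed.flagCard_addEdge {Q Q' : Set D} {S : Set (D × Bool)} (hS : M.IsClosed Q' S) {d : D}
    (h : ∀ b, (d, b) ∈ S) (hQ : M.IsEdgeSet Q) (hd : d ∉ Q) :
    flagCard (M.addEdge Q d \ Q) S = 4 := by
  rw [← M.card_edgeFlags d, flagCard]
  congr 1
  ext x
  have h1 := hS.edgeFlags_subset h x
  rw [mem_edgeFlags] at *
  have h2 : M.opp d ∉ Q := fun h => hd (hQ.opp_mem_iff.1 h)
  simp only [mem_filter, mem_univ, true_and, Set.mem_sdiff, mem_addEdge]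
  constructor
  · tauto
  · intro h3
    refine ⟨h1 h3, ?_, ?_⟩
    · tauto
    · rcases h3 with h3 | h3 <;> rwa [h3]

variable {M} in
lemma both_mem_region {Q : Set D} {d : D} (hd : d ∉ Q) (b : Bool) :
    ∀ c, (d, c) ∈ M.region Q (d, b) := by
  intro c
  by_cases h : c = b
  · exact h ▸ M.mem_region_self _ _
  · have : (d, c) = cross (d, b) := by cases c <;> cases b <;> simp_all [cross]
    rw [this]
    exact cross_mem_region (M.mem_region_self _ _) hd

lemma chi_addEdge {Q : Set D} (hQ : M.IsEdgeSet Q) {d : D} (hd : d ∉ Q) (b : Bool) :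
    M.chi (M.addEdge Q d) (M.region Q (d, b)) = M.chi Q (M.region Q (d, b)) + 1 := by
  rw [M.chi_diff (M.subset_addEdge Q d), (M.isClosed_region Q _).flagCard_addEdge
    (both_mem_region hd b) hQ hd]
  norm_num

lemma chi_face (x : D × Bool) :
    M.chi Set.univ (M.region Set.univ x) = 1 := by
  have h : ∀ y ∈ ({y | y ∈ M.region Set.univ x} : Finset (D × Bool)),
      M.weight Set.univ y = (#{y | y ∈ M.region Set.univ x} : ℚ)⁻¹ := by
    intro y hy
    rw [mem_filter_univ] at hy
    unfold weight
    simp only [Set.mem_univ, if_true, sub_zero]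
    congr 3
    ext z
    rw [mem_filter_univ, mem_filter_univ, eq_comm, face_eq_iff, region_eq hy]
  rw [chi, sum_congr rfl h, sum_const, nsmul_eq_mul]
  refine mul_inv_cancel₀ ?_
  rw [Nat.cast_ne_zero]
  exact card_ne_zero.2 ⟨x, by simp [mem_region_self]⟩

variable {M} in
lemma region_univ_eq {Q : Set D} {x : D × Bool} (h : ∀ y ∈ M.region Q x, y.1 ∈ Q) :
    M.region Set.univ x = M.region Q x := by
  refine (M.region_anti (Set.subset_univ _) x).antisymm ?_
  have hc := M.isClosed_region Set.univ x
  refine IsClosed.region_subset ⟨hc.along, hc.turn, fun y hy hn => ?_⟩ (M.mem_region_self _ _)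
  exact absurd (h y (M.region_anti (Set.subset_univ Q) x hy)) hn

/-- Induction on the number of darts outside `Q`. A face without inner edges is a single face of `M`
and has `χ = 1`. Cutting along an inner edge raises `χ` by 1 and leaves one or two faces, so the
original value is at most `1 - 1` or `1 + 1 - 1`. -/
lemma exists_chi_eq {Q : Set D} (hQ : M.IsEdgeSet Q) (x : D × Bool) :
    ∃ z : ℤ, M.chi Q (M.region Q x) = z ∧ z ≤ 1 := by
  induction hn : #{d | d ∉ Q} using Nat.strong_induction_on generalizing Q x with
  | _ n ih =>
  subst hn
  by_cases h : ∀ y ∈ M.region Q x, y.1 ∈ Q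
  · refine ⟨1, ?_, le_rfl⟩
    rw [← region_univ_eq h, Int.cast_one, ← M.chi_face x,
      M.chi_diff (Set.subset_univ Q)]
    simp only [left_eq_add, div_eq_zero_iff, Nat.cast_eq_zero, OfNat.ofNat_ne_zero, or_false]
    refine flagCard_eq_zero fun y hy hy' => ?_
    rw [region_univ_eq h] at hy
    exact hy'.2 (h y hy)
  · push Not at h
    obtain ⟨⟨d, b⟩, hy, hd⟩ := h
    rw [← region_eq hy]
    simp only at hd
    have hQ' := M.isEdgeSet_addEdge hQ d
    have hlt : #{e | e ∉ M.addEdge Q d} < #{e | e ∉ Q} := by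
      refine card_lt_card ⟨fun e he => ?_, fun hs => ?_⟩
      · rw [mem_filter_univ] at he ⊢
        exact fun h => he (M.subset_addEdge Q d h)
      · have := hs ((mem_filter_univ d).2 hd)
        rw [mem_filter_univ] at this
        exact this (Or.inl rfl)
    have hadd := M.chi_addEdge hQ hd b
    obtain ⟨z1, h1, h1'⟩ := ih _ hlt hQ' (d, b) rfl
    obtain ⟨z2, h2, h2'⟩ := ih _ hlt hQ' (d, !b) rfl
    have hu := region_eq_union (M := M) d hd b
    by_cases hm : (d, !b) ∈ M.region (M.addEdge Q d) (d, b)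
    · rw [region_eq hm, Set.union_self] at hu
      rw [← hu] at h1
      refine ⟨z1 - 1, ?_, by lia⟩
      push_cast
      linarith
    · rw [hu, M.chi_union _ (region_disjoint M hm), h1, h2, ← hu] at hadd
      refine ⟨z1 + z2 - 1, ?_, by lia⟩
      push_cast
      linarith

lemma chi_le_one {Q : Set D} (hQ : M.IsEdgeSet Q) (x : D × Bool) :
    M.chi Q (M.region Q x) ≤ 1 := by
  obtain ⟨z, hz, hz'⟩ := M.exists_chi_eq hQ x
  rw [hz]
  exact_mod_cast hz'

lemma chi_le_of_lt {Q : Set D} (hQ : M.IsEdgeSet Q) (x : D × Bool) (n : ℤ)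
    (h : M.chi Q (M.region Q x) < n) : M.chi Q (M.region Q x) ≤ n - 1 := by
  obtain ⟨z, hz, -⟩ := M.exists_chi_eq hQ x
  rw [hz] at h ⊢
  have : z < n := by exact_mod_cast h
  exact_mod_cast Int.le_sub_one_of_lt this

/-- An edge inside a disk face separates it into two disks. -/
lemma split_disk {Q : Set D} (hQ : M.IsEdgeSet Q) {d : D} (hd : d ∉ Q) (b : Bool)
    (h : M.chi Q (M.region Q (d, b)) = 1) :
    (d, !b) ∉ M.region (M.addEdge Q d) (d, b) ∧
      M.chi (M.addEdge Q d) (M.region (M.addEdge Q d) (d, b)) = 1 := by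
  have hQ' := M.isEdgeSet_addEdge hQ d
  have hadd := M.chi_addEdge hQ hd b
  have h1 := M.chi_le_one hQ' (d, b)
  have h2 := M.chi_le_one hQ' (d, !b)
  have hu := region_eq_union (M := M) d hd b
  -- If the edge did not separate, the cut face would have Euler characteristic 2.
  have hm : (d, !b) ∉ M.region (M.addEdge Q d) (d, b) := by
    intro hm
    rw [region_eq hm, Set.union_self] at hu
    rw [← hu] at h1
    linarith
  refine ⟨hm, ?_⟩
  rw [hu, M.chi_union _ (region_disjoint M hm), ← hu] at hadd
  linarith

/-! ### Sums over faces -/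

variable {M} in
lemma IsClosed.sum_le {Q : Set D} {S : Set (D × Bool)} (hS : M.IsClosed Q S) {f g : D × Bool → ℚ}
    (h : ∀ x ∈ S, ∑ y with y ∈ M.region Q x, f y ≤ ∑ y with y ∈ M.region Q x, g y) :
    ∑ y with y ∈ S, f y ≤ ∑ y with y ∈ S, g y := by
  have key : ∀ f : D × Bool → ℚ, ∑ y with y ∈ S, f y =
      ∑ R ∈ ({y | y ∈ S} : Finset (D × Bool)).image (M.region Q),
        ∑ y with y ∈ S ∧ M.region Q y = R, f y := by
    intro f
    rw [← sum_fiberwise_of_maps_to (g := M.region Q) fun i hi => mem_image_of_mem _ hi]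
    simp only [filter_filter]
  rw [key f, key g]
  refine sum_le_sum fun R hR => ?_
  obtain ⟨x, hx, rfl⟩ := mem_image.1 hR
  rw [mem_filter_univ] at hx
  have : ({y | y ∈ S ∧ M.region Q y = M.region Q x} : Finset (D × Bool)) =
      ({y | y ∈ M.region Q x} : Finset (D × Bool)) := by
    ext y
    rw [mem_filter_univ, mem_filter_univ]
    constructor
    · rintro ⟨-, h⟩
      exact h ▸ M.mem_region_self Q y
    · exact fun hy => ⟨(hS.iff_of_mem_region hy).2 hx, region_eq hy⟩
  rw [this]
  exact h x hx

variable {M} in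
/-- If every face of `Q` in `S` has `a χ ≤ sides`, the same holds for `S`. -/
lemma IsClosed.mul_chi_le {Q : Set D} {S : Set (D × Bool)} (hS : M.IsClosed Q S) (a : ℚ)
    (h : ∀ x ∈ S, a * M.chi Q (M.region Q x) ≤ flagCard Q (M.region Q x)) :
    a * M.chi Q S ≤ flagCard Q S := by
  have key : ∀ T : Set (D × Bool),
      (flagCard Q T : ℚ) = ∑ y with y ∈ T, if y.1 ∈ Q then (1 : ℚ) else 0 := by
    intro T
    rw [flagCard, ← filter_filter, card_filter]
    push_cast
    rfl
  rw [key, chi, mul_sum]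
  refine hS.sum_le fun x hx => ?_
  rw [← key, ← mul_sum]
  exact h x hx

variable {M} in
lemma IsClosed.chi_le {Q : Set D} {S : Set (D × Bool)} (hS : M.IsClosed Q S)
    (h : ∀ x ∈ S, M.chi Q (M.region Q x) ≤ 0) : M.chi Q S ≤ 0 := by
  have := hS.sum_le (f := M.weight Q) (g := fun _ => 0) fun x hx => by
    simpa [chi] using h x hx
  simpa [chi] using this

end Euler

end SignedMap

/-! ### Topology of disk faces: connected boundary and balance of signs -/

namespace SignedMap

variable {V D : Type*} (M : SignedMap V D)

section Disk
set_option linter.unusedSectionVars false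
open scoped Classical
open Finset
variable [Fintype D]

/-! ### The boundary of a face -/

/-- Following the edges of `Q` and skipping the others. -/
noncomputable def skip (Q : Set D) (x : D × Bool) : D × Bool :=
  if x.1 ∈ Q then M.along x else cross x

lemma skip_of_mem {Q : Set D} {x : D × Bool} (h : x.1 ∈ Q) : M.skip Q x = M.along x := if_pos h

lemma skip_of_notMem {Q : Set D} {x : D × Bool} (h : x.1 ∉ Q) : M.skip Q x = cross x := if_neg h

lemma skip_ne (Q : Set D) (x : D × Bool) : M.skip Q x ≠ x := by
  by_cases h : x.1 ∈ Q
  · rw [skip_of_mem _ h]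
    exact M.along_ne x
  · rw [skip_of_notMem _ h]
    exact cross_ne x

lemma skip_skip {Q : Set D} (hQ : M.IsEdgeSet Q) (x : D × Bool) : M.skip Q (M.skip Q x) = x := by
  by_cases h : x.1 ∈ Q
  · rw [skip_of_mem _ h, skip_of_mem, along_along]
    exact hQ _ h
  · rw [skip_of_notMem _ h, skip_of_notMem, cross_cross]
    exact h

lemma even_card_of_involution {α : Type*} (s : Finset α) (f : α → α) (hf : ∀ a ∈ s, f a ∈ s)
    (hff : ∀ a ∈ s, f (f a) = a) (hne : ∀ a ∈ s, f a ≠ a) : Even #s := by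
  have : ∑ _a ∈ s, (1 : ZMod 2) = 0 :=
    sum_involution (fun a _ => f a) (fun _ _ => by decide) (fun a ha _ => hne a ha)
      (fun a ha => hf a ha) (fun a ha => hff a ha)
  rw [sum_const, nsmul_one] at this
  exact (ZMod.natCast_eq_zero_iff_even).1 this

/-- A set of flags that consists of complete boundary components of faces. -/
structure IsBoundary (Q : Set D) (S : Set (D × Bool)) : Prop where
  turn : ∀ y ∈ S, M.turn y ∈ S
  skip : ∀ y ∈ S, M.skip Q y ∈ S

variable {M} in
-- A parity argument: a boundary component of a disk that contains one end of a chord contains its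
-- other end. Suppose not, and look at the flags of `S` on one side `R` of the chord. The involution
-- `turn` shows that their number is even; `skip` pairs all of them except `(d, b)`, so it is also
-- odd.
lemma IsBoundary.along_mem {Q : Set D} (hQ : M.IsEdgeSet Q) {S : Set (D × Bool)}
    (hS : M.IsBoundary Q S) {d : D} (hd : d ∉ Q) {b : Bool}
    (h : M.chi Q (M.region Q (d, b)) = 1) (hm : (d, b) ∈ S) : M.along (d, b) ∈ S := by
  by_contra hn
  obtain ⟨hsep, -⟩ := M.split_disk hQ hd b h
  set R := M.region (M.addEdge Q d) (d, b) with hR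
  have hc : M.IsClosed (M.addEdge Q d) R := M.isClosed_region _ _
  have hself : (d, b) ∈ R := M.mem_region_self _ _
  have h1 : Even #{y | y ∈ S ∧ y ∈ R} := by
    refine even_card_of_involution _ M.turn (fun y hy => ?_) (fun y _ => M.turn_turn y)
      (fun y _ => M.turn_ne y)
    rw [mem_filter_univ] at hy ⊢
    exact ⟨hS.turn _ hy.1, hc.turn _ hy.2⟩
  have hsep' : ∀ c, (d, c) ∈ R → c = b := by
    intro c hc'
    by_contra hcb
    have : c = !b := by cases c <;> cases b <;> simp_all
    exact hsep (this ▸ hc')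
  have hopp : M.opp d ∉ Q := fun h => hd (hQ.opp_mem_iff.1 h)
  have hne : ∀ y : D × Bool, y ∈ S → y ∈ R → y ≠ (d, b) → y.1 ≠ d ∧ y.1 ≠ M.opp d := by
    rintro ⟨y, c⟩ hyS hyR hy
    refine ⟨fun h => ?_, fun h => ?_⟩
    · simp only at h
      subst h
      exact hy (by rw [hsep' c hyR])
    · simp only at h
      subst h
      have h2 := hc.along _ hyR
      simp only [SignedMap.along, M.opp_opp, M.pos_opp] at h2
      have h3 := hsep' _ h2
      apply hn
      have : M.along (d, b) = (M.opp d, c) := by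
        rw [← h3]
        simp [SignedMap.along]
      rwa [this]
  have h2 : Even #(({y | y ∈ S ∧ y ∈ R} : Finset (D × Bool)).erase (d, b)) := by
    refine even_card_of_involution _ (M.skip Q) (fun y hy => ?_) (fun y _ => M.skip_skip hQ y)
      (fun y _ => M.skip_ne Q y)
    rw [mem_erase, mem_filter_univ] at hy ⊢
    obtain ⟨hy, hyS, hyR⟩ := hy
    obtain ⟨hy1, hy2⟩ := hne y hyS hyR hy
    refine ⟨?_, hS.skip _ hyS, ?_⟩
    · by_cases hyQ : y.1 ∈ Q
      · rw [skip_of_mem _ hyQ]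
        intro h
        apply hy2
        have := congrArg (fun z => M.opp z.1) h
        simpa [M.opp_opp] using this
      · rw [skip_of_notMem _ hyQ]
        intro h
        exact hy1 (congrArg Prod.fst h)
    · by_cases hyQ : y.1 ∈ Q
      · rw [skip_of_mem _ hyQ]
        exact hc.along _ hyR
      · rw [skip_of_notMem _ hyQ]
        refine hc.cross _ hyR ?_
        rintro (h | h | h)
        exacts [hy1 h, hy2 h, hyQ h]
  rw [card_erase_of_mem ((mem_filter_univ _).2 ⟨hm, hself⟩)] at h2
  have h3 : 0 < #({y | y ∈ S ∧ y ∈ R} : Finset (D × Bool)) :=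
    card_pos.2 ⟨_, (mem_filter_univ _).2 ⟨hm, hself⟩⟩
  obtain ⟨a, ha⟩ := h1
  obtain ⟨c, hc⟩ := h2
  omega

/-- The boundary of a disk face is connected. -/
lemma disk_subset {Q : Set D} (hQ : M.IsEdgeSet Q) {x : D × Bool}
    (h : M.chi Q (M.region Q x) = 1) {S : Set (D × Bool)} (hS : M.IsBoundary Q S) (hx : x ∈ S) :
    M.region Q x ⊆ S := by
  induction hn : #{d | d ∉ Q} using Nat.strong_induction_on generalizing Q x S with
  | _ n ih =>
  subst hn
  by_cases hall : ∀ y ∈ M.region Q x, y.1 ∈ Q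
  · have hc := M.isClosed_region Q x
    have : M.IsClosed Q (S ∩ M.region Q x) :=
      ⟨fun y hy => ⟨by simpa [M.skip_of_mem (hall y hy.2)] using hS.skip y hy.1, hc.along y hy.2⟩,
        fun y hy => ⟨hS.turn y hy.1, hc.turn y hy.2⟩, fun y hy hn => absurd (hall y hy.2) hn⟩
    exact (this.region_subset ⟨hx, M.mem_region_self _ _⟩).trans Set.inter_subset_left
  · push Not at hall
    obtain ⟨⟨d, b⟩, hy, hd⟩ := hall
    simp only at hd
    rw [← region_eq hy] at h
    have hQ' := M.isEdgeSet_addEdge hQ d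
    have hlt : #{e | e ∉ M.addEdge Q d} < #{e | e ∉ Q} := by
      refine card_lt_card ⟨fun e he => ?_, fun hs => ?_⟩
      · rw [mem_filter_univ] at he ⊢
        exact fun h => he (M.subset_addEdge Q d h)
      · have := hs ((mem_filter_univ d).2 hd)
        rw [mem_filter_univ] at this
        exact this (Or.inl rfl)
    have hreg : ∀ c, M.region Q (d, c) = M.region Q (d, b) := fun c =>
      region_eq (both_mem_region hd b c)
    have hS' : ∀ c, (d, c) ∈ S → M.along (d, c) ∈ S := fun c hc =>
      hS.along_mem hQ hd (by rw [hreg, h]) hc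
    have hopp : M.opp d ∉ Q := fun h => hd (hQ.opp_mem_iff.1 h)
    have hS'' : ∀ c, (M.opp d, c) ∈ S → M.along (M.opp d, c) ∈ S := fun c hc => by
      refine hS.along_mem hQ hopp ?_ hc
      rw [← h, ← hreg (xor c (M.pos d)), region_eq]
      have := along_mem_region (M.mem_region_self Q (d, xor c (M.pos d)))
      simpa [SignedMap.along] using this
    -- The two graphs differ only in how `skip` acts on the new edge: it used to cross it and now
    -- runs along it. The parity argument covers exactly this change.
    have hB : M.IsBoundary (M.addEdge Q d) S := by
      refine ⟨hS.turn, fun ⟨y, c⟩ hy' => ?_⟩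
      by_cases hyQ : y ∈ M.addEdge Q d
      · rw [M.skip_of_mem hyQ]
        rcases hyQ with hyQ | hyQ | hyQ
        · rw [hyQ] at hy' ⊢
          exact hS' c hy'
        · rw [hyQ] at hy' ⊢
          exact hS'' c hy'
        · simpa [M.skip_of_mem (x := (y, c)) hyQ] using hS.skip _ hy'
      · rw [M.skip_of_notMem hyQ]
        simpa [M.skip_of_notMem (x := (y, c)) fun h => hyQ (M.subset_addEdge Q d h)]
          using hS.skip _ hy'
    have hchi : ∀ c, M.chi (M.addEdge Q d) (M.region (M.addEdge Q d) (d, c)) = 1 := fun c =>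
      (M.split_disk hQ hd c (by rw [hreg, h])).2
    have key : ∀ c, (d, c) ∈ S → M.region (M.addEdge Q d) (d, c) ⊆ S := fun c hc =>
      ih _ hlt hQ' (hchi c) hB hc rfl
    have hxm : ∃ c, x ∈ M.region (M.addEdge Q d) (d, c) := by
      have := mem_region_symm hy
      rw [region_eq_union d hd b] at this
      exact this.elim (fun h => ⟨_, h⟩) fun h => ⟨_, h⟩
    obtain ⟨c, hc⟩ := hxm
    have hc' := ih _ hlt hQ' (by rw [region_eq hc]; exact hchi c) hB hx rfl
    have hdc : (d, c) ∈ S := hc' (mem_region_symm hc)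
    have hdc' : (d, !c) ∈ S := by
      simpa [M.skip_of_notMem (x := (d, c)) hd, cross] using hS.skip _ hdc
    rw [← region_eq hy, ← hreg c, region_eq_union d hd c]
    exact Set.union_subset (key _ hdc) (key _ hdc')

/-! ### Signs -/

/-- The sign of a flag. -/
def sgn (x : D × Bool) : ℤ := if x.2 then 1 else -1

lemma sgn_ne_zero (x : D × Bool) : sgn x ≠ 0 := by
  unfold sgn
  split <;> decide

lemma sgn_turn (x : D × Bool) : sgn (M.turn x) = -sgn x := by
  obtain ⟨d, b⟩ := x
  simp only [sgn, M.turn_snd]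
  cases b <;> simp

lemma sgn_cross (x : D × Bool) : sgn (cross x) = -sgn x := by
  obtain ⟨d, b⟩ := x
  cases b <;> simp [sgn, cross]

lemma sgn_along (x : D × Bool) :
    sgn (M.along x) = if M.pos x.1 = true then -sgn x else sgn x := by
  obtain ⟨d, b⟩ := x
  cases b <;> cases h : M.pos d <;> simp [sgn, along, h]

/-- On the boundary of a union of faces, the two orientations of the sides at negative edges
are balanced. -/
lemma sum_sgn_eq_zero {Q : Set D} (hQ : M.IsEdgeSet Q) {S : Set (D × Bool)}
    (hS : M.IsClosed Q S) :
    ∑ y with y ∈ S ∧ y.1 ∈ Q ∧ M.pos y.1 = false, sgn y = 0 := by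
  -- `turn` reverses all signs.
  have h1 : ∑ y with y ∈ S, sgn y = 0 := by
    have : ∑ y with y ∈ S, sgn y = ∑ y with y ∈ S, sgn (M.turn y) :=
      sum_nbij' M.turn M.turn (fun y hy => by
        rw [mem_filter_univ] at hy ⊢
        exact hS.turn _ hy) (fun y hy => by
        rw [mem_filter_univ] at hy ⊢
        exact hS.turn _ hy) (by simp) (by simp) (by simp)
    simp only [sgn_turn, sum_neg_distrib] at this
    omega
  have hskip : ∀ y ∈ S, M.skip Q y ∈ S := fun y hy => by
    by_cases hyQ : y.1 ∈ Q
    · rw [M.skip_of_mem hyQ]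
      exact hS.along _ hy
    · rw [M.skip_of_notMem hyQ]
      exact hS.cross _ hy hyQ
  have h2 : ∑ y with y ∈ S, sgn y = ∑ y with y ∈ S, sgn (M.skip Q y) :=
    sum_nbij' (M.skip Q) (M.skip Q) (fun y hy => by
      rw [mem_filter_univ] at hy ⊢
      exact hskip _ hy) (fun y hy => by
      rw [mem_filter_univ] at hy ⊢
      exact hskip _ hy) (by simp [M.skip_skip hQ]) (by simp [M.skip_skip hQ])
      (by simp [M.skip_skip hQ])
  -- `skip` reverses the sign of a flag, except at negative edges of `Q`, where it keeps it. So only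
  -- these survive in the sum, each twice.
  have h3 : ∑ y with y ∈ S, (sgn y + sgn (M.skip Q y)) =
      2 * ∑ y with y ∈ S ∧ y.1 ∈ Q ∧ M.pos y.1 = false, sgn y := by
    rw [mul_sum, ← filter_filter, sum_filter (fun y : D × Bool => y.1 ∈ Q ∧ M.pos y.1 = false)]
    refine sum_congr rfl fun y _ => ?_
    by_cases hyQ : y.1 ∈ Q
    · rw [M.skip_of_mem hyQ, sgn_along]
      cases M.pos y.1 <;> simp [hyQ]
      ring
    · rw [M.skip_of_notMem hyQ, sgn_cross]
      simp [hyQ]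
  rw [sum_add_distrib, ← h2, h1] at h3
  omega

/-- There is no negative edge inside a disk face with positive sides. -/
lemma pos_of_disk {Q : Set D} (hQ : M.IsEdgeSet Q) (hpos : ∀ d ∈ Q, M.pos d = true) {d : D}
    {b : Bool} (h : M.chi Q (M.region Q (d, b)) = 1) : M.pos d = true := by
  by_contra hneg
  rw [Bool.not_eq_true] at hneg
  have hd : d ∉ Q := fun hd => by simp [hpos d hd] at hneg
  obtain ⟨hsep, -⟩ := M.split_disk hQ hd b h
  have hS := M.isClosed_region (M.addEdge Q d) (d, b)
  have hself : (d, b) ∈ M.region (M.addEdge Q d) (d, b) := M.mem_region_self _ _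
  have h0 := M.sum_sgn_eq_zero (M.isEdgeSet_addEdge hQ d) hS
  have h2 : ∀ c, (d, c) ∈ M.region (M.addEdge Q d) (d, b) → c = b := by
    intro c hc
    by_contra hcb
    have : c = !b := by cases c <;> cases b <;> simp_all
    exact hsep (this ▸ hc)
  have h1 : ({y | y ∈ M.region (M.addEdge Q d) (d, b) ∧ y.1 ∈ M.addEdge Q d ∧
      M.pos y.1 = false} : Finset (D × Bool)) = {(d, b), (M.opp d, b)} := by
    ext ⟨y, c⟩
    rw [mem_filter_univ, mem_insert, mem_singleton]
    constructor
    · rintro ⟨hy, hyQ | hyQ | hyQ, hyn⟩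
      · simp only at hyQ
        subst hyQ
        rw [h2 c hy]
        exact Or.inl rfl
      · simp only at hyQ
        subst hyQ
        have := hS.along _ hy
        simp only [SignedMap.along, M.opp_opp, M.pos_opp, hneg, Bool.xor_false] at this
        rw [h2 c this]
        exact Or.inr rfl
      · rw [hpos y hyQ] at hyn
        exact absurd hyn (by decide)
    · rintro (hy | hy)
      · obtain ⟨rfl, rfl⟩ := Prod.mk.inj hy
        exact ⟨hself, Or.inl rfl, hneg⟩
      · obtain ⟨rfl, rfl⟩ := Prod.mk.inj hy
        refine ⟨?_, Or.inr (Or.inl rfl), by rw [M.pos_opp, hneg]⟩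
        have := hS.along _ hself
        simpa [SignedMap.along, hneg] using this
  -- The half disk has exactly one negative side. Its two flags have the same sign, so they cannot
  -- balance.
  rw [h1, sum_pair (by
    intro h
    exact M.opp_ne d (congrArg Prod.fst h).symm)] at h0
  have : sgn (M.opp d, b) = sgn (d, b) := rfl
  have h4 := sgn_ne_zero (d, b)
  omega

/-! ### Comparison with the definitions of the statement -/

/-- Each fibre contributes the reciprocal of its size once for each of its elements, hence 1. This
turns sums of weights into numbers of faces and edges. -/
lemma sum_inv_fiber {α β : Type*} [DecidableEq β] (s : Finset α) (f : α → β) :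
    ∑ a ∈ s, (#{c ∈ s | f c = f a} : ℚ)⁻¹ = #(s.image f) := by
  rw [← sum_fiberwise_of_maps_to (g := f) (t := s.image f) fun a ha => mem_image_of_mem f ha,
    card_eq_sum_ones, Nat.cast_sum]
  refine sum_congr rfl fun y hy => ?_
  obtain ⟨a, ha, rfl⟩ := mem_image.1 hy
  have : ∀ c ∈ s.filter (fun c => f c = f a),
      (#{e ∈ s | f e = f c} : ℚ)⁻¹ = (#{e ∈ s | f e = f a} : ℚ)⁻¹ := by
    intro c hc
    rw [(mem_filter.1 hc).2]
  rw [sum_congr rfl this, sum_const, nsmul_eq_mul, Nat.cast_one, mul_inv_cancel₀]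
  rw [Nat.cast_ne_zero]
  exact card_ne_zero.2 ⟨a, mem_filter.2 ⟨ha, rfl⟩⟩

lemma edge_eq_iff {d e : D} : M.edge e = M.edge d ↔ e = d ∨ e = M.opp d := by
  unfold edge
  rw [Sym2.eq_iff]
  constructor
  · rintro (h | h)
    exacts [Or.inl h.1, Or.inr h.1]
  · rintro (rfl | rfl)
    exacts [Or.inl ⟨rfl, rfl⟩, Or.inr ⟨rfl, M.opp_opp _⟩]

/-- The bridge to `IsDiskFace`: faces minus inner edges. Here `S` must be a union of faces of `Q`,
so that it contains all flags of every face and every inner edge that it meets. -/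
lemma chi_eq {Q : Set D} (hQ : M.IsEdgeSet Q) {S : Set (D × Bool)} (hS : M.IsClosed Q S) :
    M.chi Q S = (M.face '' S).ncard -
      ((fun y : D × Bool => M.edge y.1) '' {y ∈ S | y.1 ∉ Q}).ncard := by
  have h1 : ((M.face '' S).ncard : ℚ) =
      ∑ y with y ∈ S, (#{z | M.face z = M.face y} : ℚ)⁻¹ := by
    have : M.face '' S = (({y | y ∈ S} : Finset (D × Bool)).image M.face : Set M.Face) := by
      ext; simp
    rw [this, Set.ncard_coe_finset, ← sum_inv_fiber]
    refine sum_congr rfl fun y hy => ?_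
    rw [mem_filter_univ] at hy
    congr 3
    ext z
    rw [mem_filter, mem_filter_univ, mem_filter_univ, and_iff_right_iff_imp]
    intro h
    exact ((hS.mono (Set.subset_univ _)).iff_of_mem_region (M.face_eq_iff.1 h)).1 hy
  have h2 : (((fun y : D × Bool => M.edge y.1) '' {y ∈ S | y.1 ∉ Q}).ncard : ℚ) =
      ∑ y with y ∈ S ∧ y.1 ∉ Q, (4⁻¹ : ℚ) := by
    have : (fun y : D × Bool => M.edge y.1) '' {y ∈ S | y.1 ∉ Q} =
        (({y | y ∈ S ∧ y.1 ∉ Q} : Finset (D × Bool)).image (fun y : D × Bool => M.edge y.1)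
          : Set (Sym2 D)) := by
      ext; simp
    rw [this, Set.ncard_coe_finset, ← sum_inv_fiber]
    refine sum_congr rfl fun y hy => ?_
    rw [mem_filter_univ] at hy
    have h4 : (4 : ℚ) = (#(M.edgeFlags y.1) : ℚ) := by rw [card_edgeFlags]; norm_num
    rw [h4]
    congr 3
    ext z
    rw [mem_filter, mem_filter_univ, edge_eq_iff, mem_edgeFlags, and_iff_right_iff_imp]
    intro h
    have hb : ∀ b, (y.1, b) ∈ S := by
      intro b
      by_cases hb : b = y.2
      · rw [hb]; exact hy.1
      · have : (y.1, b) = SignedMap.cross y := by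
          obtain ⟨e, c⟩ := y
          cases b <;> cases c <;> simp_all [SignedMap.cross]
        rw [this]
        exact hS.cross _ hy.1 hy.2
    refine ⟨hS.edgeFlags_subset hb z (M.mem_edgeFlags.2 h), ?_⟩
    rcases h with h | h
    · rw [h]; exact hy.2
    · rw [h, hQ.opp_mem_iff]; exact hy.2
  rw [h1, h2, chi, ← filter_filter, sum_filter (fun y : D × Bool => y.1 ∉ Q), ← sum_sub_distrib]
  refine sum_congr rfl fun y _ => ?_
  by_cases hyQ : y.1 ∈ Q <;> simp [weight, hyQ]

lemma flagCard_eq_ncard (Q : Set D) (S : Set (D × Bool)) :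
    flagCard Q S = {y ∈ S | y.1 ∈ Q}.ncard := by
  rw [flagCard, ← Set.ncard_coe_finset]
  congr 1
  ext
  simp

lemma isDiskFace_iff {Q : Set D} (hQ : M.IsEdgeSet Q) (x : D × Bool) (k : ℕ) :
    M.IsDiskFace Q x k ↔
      M.chi Q (M.region Q x) = 1 ∧ flagCard Q (M.region Q x) = 2 * k := by
  rw [IsDiskFace, flagCard_eq_ncard, M.chi_eq hQ (M.isClosed_region Q x)]
  refine and_congr ⟨fun h => ?_, fun h => ?_⟩ Iff.rfl
  · rw [h]
    push_cast
    ring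
  · rw [sub_eq_iff_eq_add'] at h
    exact_mod_cast h

lemma flagCard_univ (Q : Set D) : flagCard Q Set.univ = 2 * Q.ncard := by
  rw [flagCard_eq_ncard]
  have : {y : D × Bool | y ∈ Set.univ ∧ y.1 ∈ Q} = Q ×ˢ Set.univ := by
    ext; simp
  rw [this, Set.ncard_prod]
  simp [mul_comm]

/-- Euler's formula on the Klein bottle. -/
lemma chi_univ (hM : M.IsKleinBottle) (Q : Set D) :
    M.chi Q Set.univ = Q.ncard / 2 - Nat.card V := by
  have h1 := M.chi_eq (fun _ _ => trivial : M.IsEdgeSet Set.univ) (M.isClosed_univ Set.univ)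
  have h2 := M.chi_diff (Set.subset_univ Q) Set.univ
  have h3 := flagCard_diff (Set.subset_univ Q) Set.univ
  rw [flagCard_univ, flagCard_univ, Set.ncard_univ] at h3
  have h4 : (2 : ℚ) * Nat.card V + 2 * Nat.card M.Face = Nat.card D := by exact_mod_cast hM.2.2
  have h5 : M.face '' Set.univ = Set.univ := by
    rw [Set.image_univ]
    exact Set.range_eq_univ.2 Quot.mk_surjective
  rw [h5, Set.ncard_univ] at h1
  simp only [Set.mem_univ, not_true_eq_false, and_false, Set.ofPred_false, Set.image_empty,
    Set.ncard_empty, Nat.cast_zero, sub_zero] at h1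
  have h3' : (2 * Nat.card D : ℚ) = 2 * Q.ncard + flagCard (Set.univ \ Q) Set.univ := by
    exact_mod_cast h3
  linarith

end Disk

end SignedMap

/-! ### The cyclic order of a subgraph around a vertex -/

namespace SignedMap

variable {V D : Type*} (M : SignedMap V D)

section Next
set_option linter.unusedSectionVars false
open scoped Classical
open Finset
variable [Fintype D]

/-! ### The next edge of a graph around a vertex -/

lemma exists_rot_pow_mem {Q : Set D} {d : D} (hd : d ∈ Q) : ∃ n, 0 < n ∧ (M.rot ^ n) d ∈ Q :=
  ⟨orderOf M.rot, orderOf_pos _, by rwa [pow_orderOf_eq_one]⟩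

/-- The first dart of `Q` after `d ∈ Q`. -/
noncomputable def nextFun (Q : Set D) (d : D) : D :=
  -- Being the identity outside `Q` makes this a permutation of all darts.
  if h : d ∈ Q then (M.rot ^ Nat.find (M.exists_rot_pow_mem h)) d else d

lemma nextFun_spec {Q : Set D} {d : D} (hd : d ∈ Q) :
    ∃ n, 0 < n ∧ (M.rot ^ n) d = M.nextFun Q d ∧ M.nextFun Q d ∈ Q ∧
      ∀ i, 0 < i → i < n → (M.rot ^ i) d ∉ Q := by
  have h := Nat.find_spec (M.exists_rot_pow_mem hd)
  refine ⟨Nat.find (M.exists_rot_pow_mem hd), h.1, by rw [nextFun, dif_pos hd],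
    by rw [nextFun, dif_pos hd]; exact h.2, fun i hi hi' hm => ?_⟩
  exact Nat.find_min (M.exists_rot_pow_mem hd) hi' ⟨hi, hm⟩

lemma rot_pow_eq {i j : ℕ} {d e : D} (h : (M.rot ^ i) d = (M.rot ^ j) e) (hij : i ≤ j) :
    d = (M.rot ^ (j - i)) e := by
  apply (M.rot ^ i).injective
  rw [h, ← Equiv.Perm.mul_apply, ← pow_add, Nat.add_sub_cancel' hij]

lemma nextFun_injective (Q : Set D) : Function.Injective (M.nextFun Q) := by
  have key : ∀ d ∈ Q, ∀ e ∈ Q, M.nextFun Q d = M.nextFun Q e → d = e := by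
    intro d hd e he h
    obtain ⟨i, hi, h1, -, h1'⟩ := M.nextFun_spec hd
    obtain ⟨j, hj, h2, -, h2'⟩ := M.nextFun_spec he
    rw [← h1, ← h2] at h
    rcases lt_trichotomy i j with hij | rfl | hij
    · have h3 := M.rot_pow_eq h hij.le
      exact absurd (h3 ▸ hd) (h2' _ (by omega) (by omega))
    · exact (M.rot ^ i).injective h
    · have h3 := M.rot_pow_eq h.symm hij.le
      exact absurd (h3 ▸ he) (h1' _ (by omega) (by omega))
  intro d e h
  by_cases hd : d ∈ Q <;> by_cases he : e ∈ Q
  · exact key d hd e he h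
  · obtain ⟨-, -, -, h', -⟩ := M.nextFun_spec hd
    rw [h, nextFun, dif_neg he] at h'
    exact absurd h' he
  · obtain ⟨-, -, -, h', -⟩ := M.nextFun_spec he
    rw [← h, nextFun, dif_neg hd] at h'
    exact absurd h' hd
  · rwa [nextFun, dif_neg hd, nextFun, dif_neg he] at h

/-- The first dart of `Q` after a dart of `Q`, as a permutation. -/
noncomputable def next (Q : Set D) : Equiv.Perm D :=
  Equiv.ofBijective (M.nextFun Q) (Finite.injective_iff_bijective.1 (M.nextFun_injective Q))

lemma next_spec {Q : Set D} {d : D} (hd : d ∈ Q) :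
    ∃ n, 0 < n ∧ (M.rot ^ n) d = M.next Q d ∧ M.next Q d ∈ Q ∧
      ∀ i, 0 < i → i < n → (M.rot ^ i) d ∉ Q :=
  M.nextFun_spec hd

lemma next_mem {Q : Set D} {d : D} (hd : d ∈ Q) : M.next Q d ∈ Q := by
  obtain ⟨-, -, -, h, -⟩ := M.next_spec hd
  exact h

lemma next_eq {Q : Set D} {d e : D} (hd : d ∈ Q) (he : e ∈ Q) {n : ℕ} (hn : 0 < n)
    (h : (M.rot ^ n) d = e) (hi : ∀ i, 0 < i → i < n → (M.rot ^ i) d ∉ Q) : M.next Q d = e := by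
  obtain ⟨m, hm, h1, h2, h3⟩ := M.next_spec hd
  rcases lt_trichotomy m n with hmn | rfl | hmn
  · exact absurd (h1 ▸ h2) (hi _ hm hmn)
  · rw [← h1, h]
  · exact absurd (h ▸ he) (h3 _ hn hmn)

lemma isNext_next {Q : Set D} {d : D} (hd : d ∈ Q) : IsNext Q M.rot d (M.next Q d) := by
  obtain ⟨n, h1, h2, h3, h4⟩ := M.next_spec hd
  exact ⟨h3, n, h1, h2, h4⟩

lemma vert_rot_pow (n : ℕ) (d : D) : M.vert ((M.rot ^ n) d) = M.vert d := by
  induction n with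
  | zero => rfl
  | succ n ih => rw [pow_succ', Equiv.Perm.mul_apply, M.vert_rot, ih]

lemma vert_next (Q : Set D) (d : D) : M.vert (M.next Q d) = M.vert d := by
  by_cases hd : d ∈ Q
  · obtain ⟨n, -, h, -⟩ := M.next_spec hd
    rw [← h, vert_rot_pow]
  · change M.vert (M.nextFun Q d) = _
    rw [nextFun, dif_neg hd]

lemma next_symm_mem {Q : Set D} {d : D} (hd : d ∈ Q) : (M.next Q).symm d ∈ Q := by
  by_contra h
  have : M.next Q ((M.next Q).symm d) = (M.next Q).symm d := by
    change M.nextFun Q _ = _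
    rw [nextFun, dif_neg h]
  rw [Equiv.apply_symm_apply] at this
  exact h (this ▸ hd)

lemma vert_next_symm (Q : Set D) (d : D) : M.vert ((M.next Q).symm d) = M.vert d := by
  rw [← M.vert_next Q, Equiv.apply_symm_apply]

/-- The darts of `Q` at a vertex. -/
noncomputable def dartsAt (Q : Set D) (v : V) : Finset D := {d | d ∈ Q ∧ M.vert d = v}

variable {M} in
lemma mem_dartsAt {Q : Set D} {v : V} {d : D} : d ∈ M.dartsAt Q v ↔ d ∈ Q ∧ M.vert d = v := by
  simp [dartsAt]

/-- A walk by `rot` between two darts of `Q` is broken at the darts of `Q` that it meets, and each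
piece is one step of `next Q`. -/
lemma isCycleOn_next (Q : Set D) (v : V) : (M.next Q).IsCycleOn (M.dartsAt Q v : Set D) := by
  have key : ∀ n : ℕ, ∀ d ∈ Q, ∀ e ∈ Q, (M.rot ^ n) d = e → (M.next Q).SameCycle d e := by
    intro n
    induction n using Nat.strong_induction_on with
    | _ n ih =>
    intro d hd e he h
    rcases Nat.eq_zero_or_pos n with rfl | hn
    · exact ⟨0, h⟩
    · obtain ⟨m, hm, h1, h2, h3⟩ := M.next_spec hd
      have hmn : m ≤ n := by
        by_contra hlt
        exact h3 n hn (by omega) (h ▸ he)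
      have : (M.rot ^ (n - m)) (M.next Q d) = e := by
        rw [← h1, ← Equiv.Perm.mul_apply, ← pow_add, Nat.sub_add_cancel hmn, h]
      exact Equiv.Perm.sameCycle_apply_left.1 (ih (n - m) (by omega) _ h2 e he this)
  refine ⟨⟨fun d hd => ?_, (M.next Q).injective.injOn, fun d hd => ?_⟩, fun d hd e he => ?_⟩
  · rw [mem_coe, mem_dartsAt] at hd ⊢
    exact ⟨M.next_mem hd.1, by rw [vert_next, hd.2]⟩
  · rw [mem_coe, mem_dartsAt] at hd
    refine ⟨(M.next Q).symm d, ?_, by simp⟩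
    rw [mem_coe, mem_dartsAt]
    exact ⟨M.next_symm_mem hd.1, by rw [vert_next_symm, hd.2]⟩
  · rw [mem_coe, mem_dartsAt] at hd he
    obtain ⟨n, hn⟩ := M.rot_trans d e (hd.2.trans he.2.symm)
    exact key n d hd.1 e he.1 hn

lemma next_univ : M.next Set.univ = M.rot := by
  ext d
  exact M.next_eq trivial trivial one_pos (pow_one M.rot ▸ rfl) (fun i h h' => by omega)

lemma rot_pow_eq_self_iff {d : D} {n : ℕ} :
    (M.rot ^ n) d = d ↔ M.degree (M.vert d) ∣ n := by
  have h := M.isCycleOn_next Set.univ (M.vert d)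
  rw [next_univ] at h
  have hc : M.degree (M.vert d) = #(M.dartsAt Set.univ (M.vert d)) := by
    rw [degree, ← Set.ncard_coe_finset]
    congr 1
    ext
    simp [dartsAt]
  rw [hc]
  exact h.pow_apply_eq (by simp [mem_dartsAt])

lemma degree_pos (d : D) : 0 < M.degree (M.vert d) := by
  rw [degree, Set.ncard_pos (Set.toFinite _)]
  exact ⟨d, rfl⟩

/-! ### Corners -/

/-- The dart `e` lies between the dart `d` of `Q` and the next dart of `Q`. -/
def InCorner (Q : Set D) (d e : D) : Prop :=
  ∃ n, 0 < n ∧ (M.rot ^ n) d = e ∧ ∀ i, 0 < i → i ≤ n → (M.rot ^ i) d ∉ Q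

variable {M} in
lemma InCorner.notMem {Q : Set D} {d e : D} (h : M.InCorner Q d e) : e ∉ Q := by
  obtain ⟨n, h1, h2, h3⟩ := h
  exact h2 ▸ h3 n h1 le_rfl

variable {M} in
lemma InCorner.vert_eq {Q : Set D} {d e : D} (h : M.InCorner Q d e) : M.vert e = M.vert d := by
  obtain ⟨n, h1, h2, h3⟩ := h
  rw [← h2, vert_rot_pow]

variable {M} in
lemma InCorner.unique {Q : Set D} {d d' e : D} (hd : d ∈ Q) (hd' : d' ∈ Q)
    (h : M.InCorner Q d e) (h' : M.InCorner Q d' e) : d = d' := by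
  obtain ⟨i, hi, h1, h1'⟩ := h
  obtain ⟨j, hj, h2, h2'⟩ := h'
  rw [← h2] at h1
  rcases lt_trichotomy i j with hij | rfl | hij
  · exact absurd (M.rot_pow_eq h1 hij.le ▸ hd) (h2' _ (by omega) (by omega))
  · exact (M.rot ^ i).injective h1
  · exact absurd (M.rot_pow_eq h1.symm hij.le ▸ hd') (h1' _ (by omega) (by omega))

/-- Among all ways to reach `e` from a dart of `Q` by turning, the shortest starts at the last dart
of `Q` before `e`. -/
lemma exists_inCorner {Q : Set D} {d e : D} (hd : d ∈ Q) (he : e ∉ Q) (h : M.vert d = M.vert e) :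
    ∃ d' ∈ Q, M.InCorner Q d' e := by
  have hex : ∃ n, ∃ d' ∈ Q, (M.rot ^ n) d' = e := by
    obtain ⟨n, hn⟩ := M.rot_trans d e h
    exact ⟨n, d, hd, hn⟩
  obtain ⟨d', hd', hn⟩ := Nat.find_spec hex
  refine ⟨d', hd', Nat.find hex, Nat.pos_of_ne_zero fun h0 => ?_, hn, fun i hi hi' hm => ?_⟩
  · rw [h0] at hn
    exact he (hn ▸ hd')
  · refine Nat.find_min hex (m := Nat.find hex - i) (by omega) ⟨_, hm, ?_⟩
    rw [← Equiv.Perm.mul_apply, ← pow_add, Nat.sub_add_cancel hi', hn]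

lemma turn_true (d : D) : M.turn (d, true) = (M.rot d, false) := rfl

lemma turn_false (d : D) : M.turn (d, false) = (M.rot.symm d, true) := rfl

lemma rot_pow_succ (n : ℕ) (d : D) : (M.rot ^ (n + 1)) d = M.rot ((M.rot ^ n) d) := by
  rw [pow_succ', Equiv.Perm.mul_apply]

variable {M} in
lemma IsClosed.corner_aux {Q : Set D} {S : Set (D × Bool)} (h : M.IsClosed Q S) {d : D} (n : ℕ)
    (hn : ∀ i, 0 < i → i ≤ n → (M.rot ^ i) d ∉ Q) :
    ((M.rot ^ n) d, true) ∈ S ↔ (d, true) ∈ S := by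
  induction n with
  | zero => rfl
  | succ n ih =>
    rw [← ih fun i h1 h2 => hn i h1 (by omega), ← h.turn_iff (y := ((M.rot ^ n) d, true)),
      turn_true, ← rot_pow_succ]
    have : ((M.rot ^ (n + 1)) d, true) = SignedMap.cross ((M.rot ^ (n + 1)) d, false) := rfl
    rw [this]
    exact h.cross_iff (hn _ (by omega) le_rfl)

variable {M} in
lemma IsClosed.next_mem_iff {Q : Set D} {S : Set (D × Bool)} (h : M.IsClosed Q S) {d : D}
    (hd : d ∈ Q) : (M.next Q d, false) ∈ S ↔ (d, true) ∈ S := by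
  obtain ⟨n, h1, h2, -, h4⟩ := M.next_spec hd
  obtain ⟨m, rfl⟩ : ∃ m, n = m + 1 := ⟨n - 1, by omega⟩
  rw [← h.corner_aux m fun i hi hi' => h4 i hi (by omega), ← h2,
    ← h.turn_iff (y := ((M.rot ^ m) d, true)), turn_true, rot_pow_succ]

variable {M} in
lemma IsClosed.inCorner_iff {Q : Set D} {S : Set (D × Bool)} (h : M.IsClosed Q S) {d e : D}
    (he : M.InCorner Q d e) (b : Bool) : (e, b) ∈ S ↔ (d, true) ∈ S := by
  have heQ := he.notMem
  obtain ⟨n, h1, h2, h3⟩ := he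
  rw [← h.corner_aux n h3, h2]
  cases b
  · rw [← h.cross_iff (y := (e, false)) heQ]
    rfl
  · rfl

variable {M} in
/-- A set of flags of `Q` that is closed under following the boundaries of the faces of `Q`
contains the whole boundary of a disk face that it meets. -/
lemma disk_flags_subset {Q : Set D} (hQ : M.IsEdgeSet Q) {x : D × Bool}
    (h : M.chi Q (M.region Q x) = 1) {T : Set (D × Bool)} (hx : x ∈ T) (hxQ : x.1 ∈ Q)
    (h1 : ∀ y ∈ T, y.1 ∈ Q → M.along y ∈ T)
    (h2 : ∀ d ∈ Q, (d, true) ∈ T ↔ (M.next Q d, false) ∈ T) :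
    ∀ y ∈ M.region Q x, y.1 ∈ Q → y ∈ T := by
  -- To apply `disk_subset`, the set `T` is completed by the flags of inner edges whose corner
  -- begins with a flag of `T`.
  set S : Set (D × Bool) := {y | (y.1 ∈ Q → y ∈ T) ∧
    (y.1 ∉ Q → ∃ d ∈ Q, (d, true) ∈ T ∧ M.InCorner Q d y.1)} with hS
  have hB : M.IsBoundary Q S := by
    refine ⟨?_, ?_⟩
    · rintro ⟨e, b⟩ ⟨hy1, hy2⟩
      cases b
      · have key : ∀ d ∈ Q, (d, true) ∈ T → ∀ n, 0 < n → (M.rot ^ n) d = e →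
            (∀ i, 0 < i → i < n → (M.rot ^ i) d ∉ Q) → M.turn (e, false) ∈ S := by
          intro d hd hdT n hn hne hi
          obtain ⟨m, rfl⟩ : ∃ m, n = m + 1 := ⟨n - 1, by omega⟩
          have : M.turn (e, false) = ((M.rot ^ m) d, true) := by
            rw [turn_false, ← hne, rot_pow_succ, Equiv.symm_apply_apply]
          rw [this]
          rcases Nat.eq_zero_or_pos m with rfl | hm
          · exact ⟨fun _ => hdT, fun h => absurd hd h⟩
          · exact ⟨fun h => absurd h (hi m hm (by omega)), fun _ =>
              ⟨d, hd, hdT, m, hm, rfl, fun i h1 h2 => hi i h1 (by omega)⟩⟩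
        by_cases he : e ∈ Q
        · have heT := hy1 he
          have hd := M.next_symm_mem he
          obtain ⟨n, hn1, hn2, -, hn3⟩ := M.next_spec hd
          rw [Equiv.apply_symm_apply] at hn2
          refine key _ hd ?_ n hn1 hn2 hn3
          rw [h2 _ hd, Equiv.apply_symm_apply]
          exact heT
        · obtain ⟨d, hd, hdT, n, hn1, hn2, hn3⟩ := hy2 he
          exact key d hd hdT n hn1 hn2 fun i h1 h2 => hn3 i h1 h2.le
      · rw [turn_true]
        have key : ∀ d ∈ Q, (d, true) ∈ T → ∀ n, (M.rot ^ n) d = e →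
            (∀ i, 0 < i → i ≤ n → (M.rot ^ i) d ∉ Q) → (M.rot e, false) ∈ S := by
          intro d hd hdT n hne hi
          by_cases he : M.rot e ∈ Q
          · refine ⟨fun _ => ?_, fun h => absurd he h⟩
            have : M.next Q d = M.rot e := M.next_eq hd he (n := n + 1) (by omega)
              (by rw [rot_pow_succ, hne]) (fun i h1 h2 => hi i h1 (by omega))
            rw [← this, ← h2 d hd]
            exact hdT
          · refine ⟨fun h => absurd h he, fun _ => ⟨d, hd, hdT, n + 1, by omega,
              by rw [rot_pow_succ, hne], fun i h1 h2 => ?_⟩⟩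
            rcases Nat.lt_or_ge n i with h3 | h3
            · obtain rfl : i = n + 1 := by omega
              rw [rot_pow_succ, hne]
              exact he
            · exact hi i h1 h3
        by_cases he : e ∈ Q
        · exact key e he (hy1 he) 0 rfl fun i h1 h2 => by omega
        · obtain ⟨d, hd, hdT, n, hn1, hn2, hn3⟩ := hy2 he
          exact key d hd hdT n hn2 hn3
    · rintro y ⟨hy1, hy2⟩
      by_cases he : y.1 ∈ Q
      · rw [M.skip_of_mem he]
        exact ⟨fun _ => h1 y (hy1 he) he, fun h => absurd (hQ _ he) h⟩
      · rw [M.skip_of_notMem he]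
        exact ⟨fun h => absurd h he, fun _ => hy2 he⟩
  have := M.disk_subset hQ h hB (x := x) ⟨fun _ => hx, fun h => absurd hxQ h⟩
  exact fun y hy hyQ => (this hy).1 hyQ

/-- If the negative edges at a vertex all lie in one corner between positive edges, then the
vertex is good. -/
lemma isGood_of_inCorner {G P : Set D} (hP : P = {d | d ∈ G ∧ M.pos d = true}) {a : D}
    (ha : a ∈ P)
    (h : ∀ e ∈ G, M.vert e = M.vert a → M.pos e = false → M.InCorner P a e) :
    M.IsGood G (M.vert a) := by
  obtain ⟨n, hn, hn1, hn2, hn3⟩ := M.next_spec ha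
  have hper : ∀ i, (M.rot ^ i) a = a → M.degree (M.vert a) ∣ i := fun i hi =>
    M.rot_pow_eq_self_iff.1 hi
  have hdeg := M.degree_pos a
  have hdega : (M.rot ^ M.degree (M.vert a)) a = a := M.rot_pow_eq_self_iff.2 dvd_rfl
  set N := M.degree (M.vert a) with hN
  have hnN : n ≤ N := by
    by_contra hlt
    exact hn3 N hdeg (by omega) (hdega.symm ▸ ha)
  -- The count starts at the positive dart after `a`. Of the `N` positions, `N - n` is that of `a`,
  -- the last positive dart; the remaining `n - 1` fill the corner behind it.
  refine ⟨(M.rot ^ n) a, M.vert_rot_pow n a, N - n + 1, fun i hi hG => ?_⟩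
  rw [← Equiv.Perm.mul_apply, ← pow_add] at hG ⊢
  constructor
  · intro hpos
    by_contra hlt
    have : (M.rot ^ (i + n - N)) a = (M.rot ^ (i + n)) a := by
      conv_rhs => rw [← Nat.sub_add_cancel (show N ≤ i + n by omega), pow_add,
        Equiv.Perm.mul_apply, hdega]
    apply hn3 (i + n - N) (by omega) (by omega)
    rw [this, hP]
    exact ⟨hG, hpos⟩
  · intro hlt
    by_contra hneg
    obtain ⟨j, hj, hj1, hj2⟩ := h _ hG (M.vert_rot_pow _ _) (by simpa using hneg)
    have hjn : j < n := by
      by_contra hle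
      exact hj2 n hn (by omega) (hn1 ▸ hn2)
    have h1 := M.rot_pow_eq hj1 (by omega)
    have := Nat.le_of_dvd (by omega) (hper _ h1.symm)
    omega

end Next

end SignedMap

/-! ### Negative loops occur at no more than two vertices -/

namespace SignedMap

variable {V D : Type*} (M : SignedMap V D)

section Loops
set_option linter.unusedSectionVars false
open scoped Classical
open Finset
variable [Fintype D]

/-! ### Connectedness -/

variable {M} in
lemma IsClosed.mem_of_vert_eq {S : Set (D × Bool)} {Q : Set D} (hS : M.IsClosed Q S)
    {d e : D} (hQ : ∀ d', M.vert d' = M.vert d → ∀ b, (d', b) ∈ S → (d', !b) ∈ S)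
    (h : M.vert d = M.vert e) {b : Bool} (hd : (d, b) ∈ S) (c : Bool) : (e, c) ∈ S := by
  have hall : ∀ d' b, M.vert d' = M.vert d → (d', b) ∈ S → ∀ c, (d', c) ∈ S := by
    intro d' b hd' hb c
    by_cases hcb : c = b
    · rwa [hcb]
    · have : c = !b := by cases c <;> cases b <;> simp_all
      exact this ▸ hQ d' hd' b hb
  obtain ⟨n, rfl⟩ := M.rot_trans d e h
  clear h
  induction n generalizing c with
  | zero => exact hall d b rfl hd c
  | succ n ih =>
    rw [rot_pow_succ]
    have := hS.turn _ (ih true)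
    rw [turn_true] at this
    exact hall _ false (by rw [M.vert_rot, vert_rot_pow]) this c

variable {M} in
-- A nonempty union of faces that does not stop at any edge spreads around each vertex and then
-- along all edges of the connected graph.
lemma IsClosed.eq_univ (hM : M.Connected) {S : Set (D × Bool)} {Q : Set D} (hS : M.IsClosed Q S)
    (hQ : ∀ d b, (d, b) ∈ S → (d, !b) ∈ S) {x : D × Bool} (hx : x ∈ S) : S = Set.univ := by
  have key : ∀ v, ∀ e, M.vert e = v → ∀ b, (e, b) ∈ S := by
    intro v
    induction hM (M.vert x.1) v with
    | refl =>
      intro e he b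
      exact hS.mem_of_vert_eq (d := x.1) (b := x.2) (fun d' _ => hQ d') he.symm hx b
    | tail _ h ih =>
      obtain ⟨d, h1, h2⟩ := h
      intro e he b
      have := hS.along _ (ih d h1 true)
      exact hS.mem_of_vert_eq (d := M.opp d) (fun d' _ => hQ d') (h2.trans he.symm) this b
  exact Set.eq_univ_of_forall fun y => key _ y.1 rfl y.2

/-- There is a walk of `n` edges from `v` to `r`. -/
def Reach (r : V) : ℕ → V → Prop
  | 0, v => v = r
  | n + 1, v => ∃ d, M.vert d = v ∧ Reach r n (M.vert (M.opp d))

/-- The level is the distance from `r`. Choosing for each other vertex a dart that leads to a lower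
level amounts to choosing a spanning tree. -/
lemma exists_level (hM : M.Connected) (r : V) :
    ∃ lev : V → ℕ, ∀ v, v ≠ r → ∃ d, M.vert d = v ∧ lev (M.vert (M.opp d)) < lev v := by
  have hex : ∀ v, ∃ n, M.Reach r n v := by
    intro v
    induction hM v r using Relation.ReflTransGen.head_induction_on with
    | refl => exact ⟨0, rfl⟩
    | head h _ ih =>
      obtain ⟨n, hn⟩ := ih
      obtain ⟨d, h1, rfl⟩ := h
      exact ⟨n + 1, d, h1, hn⟩
  refine ⟨fun v => Nat.find (hex v), fun v hv => ?_⟩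
  have hspec := Nat.find_spec (hex v)
  obtain ⟨n, hn⟩ : ∃ n, Nat.find (hex v) = n + 1 := by
    refine ⟨Nat.find (hex v) - 1, ?_⟩
    have : Nat.find (hex v) ≠ 0 := fun h0 => hv (by rw [h0] at hspec; exact hspec)
    omega
  rw [hn] at hspec
  obtain ⟨d, h1, h2⟩ := hspec
  refine ⟨d, h1, ?_⟩
  have : Nat.find (hex (M.vert (M.opp d))) ≤ n := Nat.find_min' _ h2
  simp only
  omega

/-- `1`, `0` or `-1` according to the sides of the edge of `d` that lie in `S`. -/
noncomputable def jump (S : Set (D × Bool)) (d : D) : ℤ :=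
  (if (d, true) ∈ S then 1 else 0) - (if (d, false) ∈ S then 1 else 0)

lemma jump_eq_zero_iff {S : Set (D × Bool)} {d : D} :
    jump S d = 0 ↔ ((d, true) ∈ S ↔ (d, false) ∈ S) := by
  unfold jump
  split_ifs <;> simp_all

lemma odd_jump {S : Set (D × Bool)} {d : D} (h : jump S d ≠ 0) : Odd (jump S d) := by
  unfold jump at *
  split_ifs at * <;> simp_all

variable {M} in
lemma IsClosed.jump_opp {Q : Set D} {S : Set (D × Bool)} (hS : M.IsClosed Q S) (d : D) :
    jump S (M.opp d) = if M.pos d = true then -jump S d else jump S d := by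
  have h1 := hS.along_iff (y := (d, true))
  have h2 := hS.along_iff (y := (d, false))
  unfold jump
  cases h : M.pos d <;> simp_all [SignedMap.along]

variable {M} in
lemma IsClosed.jump_of_notMem {Q : Set D} {S : Set (D × Bool)} (hS : M.IsClosed Q S) {d : D}
    (hd : d ∉ Q) : jump S d = 0 := by
  rw [jump_eq_zero_iff]
  exact hS.cross_iff (y := (d, false)) hd

variable {M} in
-- The left side of a dart and the right side of the next one belong to the same corner, so the sum
-- telescopes around the vertex.
lemma IsClosed.sum_jump {Q : Set D} {S : Set (D × Bool)} (hS : M.IsClosed Q S) (v : V) :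
    ∑ d with M.vert d = v, jump S d = 0 := by
  unfold jump
  rw [sum_sub_distrib, sub_eq_zero]
  refine sum_nbij' M.rot M.rot.symm (fun d hd => ?_) (fun d hd => ?_) (by simp) (by simp)
    (fun d _ => ?_)
  · rw [mem_filter_univ] at hd ⊢
    rw [M.vert_rot, hd]
  · rw [mem_filter_univ] at hd ⊢
    rw [M.vert_rot_symm, hd]
  · rw [← turn_true]
    simp only [hS.turn_iff]

/-- There are negative loops at no more than two vertices. -/
lemma card_le_two [Finite V] (hM : M.IsKleinBottle) (W : Finset V) (l : V → D)
    (hl : ∀ v ∈ W, M.vert (l v) = v ∧ M.vert (M.opp (l v)) = v ∧ M.pos (l v) = false) :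
    #W ≤ 2 := by
  have := Fintype.ofFinite V
  rcases W.eq_empty_or_nonempty with rfl | ⟨r, hr⟩
  · simp
  obtain ⟨lev, hlev⟩ := M.exists_level hM.1 r
  have : Nonempty D := ⟨l r⟩
  choose! p hp1 hp2 using hlev
  set T1 : Finset D := (univ.erase r).image p
  set T2 : Finset D := (univ.erase r).image (fun v => M.opp (p v))
  set T3 : Finset D := W.image l
  set T4 : Finset D := W.image (fun v => M.opp (l v))
  -- A spanning tree, formed by the edges of the darts `p v`, and one negative loop at each vertex
  -- of `W`.
  set Q : Set D := ((T1 ∪ T2 ∪ (T3 ∪ T4) : Finset D) : Set D) with hQdef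
  have hmem : ∀ d, d ∈ Q ↔ (∃ v, v ≠ r ∧ (d = p v ∨ d = M.opp (p v))) ∨
      ∃ v ∈ W, d = l v ∨ d = M.opp (l v) := by
    intro d
    simp only [hQdef, T1, T2, T3, T4, mem_coe, mem_union, mem_image, mem_erase, mem_univ, and_true]
    constructor
    · rintro ((⟨v, h, rfl⟩ | ⟨v, h, rfl⟩) | (⟨v, h, rfl⟩ | ⟨v, h, rfl⟩))
      exacts [Or.inl ⟨v, h, Or.inl rfl⟩, Or.inl ⟨v, h, Or.inr rfl⟩, Or.inr ⟨v, h, Or.inl rfl⟩,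
        Or.inr ⟨v, h, Or.inr rfl⟩]
    · rintro (⟨v, h, rfl | rfl⟩ | ⟨v, h, rfl | rfl⟩)
      exacts [Or.inl (Or.inl ⟨v, h, rfl⟩), Or.inl (Or.inr ⟨v, h, rfl⟩),
        Or.inr (Or.inl ⟨v, h, rfl⟩), Or.inr (Or.inr ⟨v, h, rfl⟩)]
  have hQ : M.IsEdgeSet Q := by
    intro d hd
    rw [hmem] at hd ⊢
    rcases hd with ⟨v, h, rfl | rfl⟩ | ⟨v, h, rfl | rfl⟩
    exacts [Or.inl ⟨v, h, Or.inr rfl⟩, Or.inl ⟨v, h, Or.inl (M.opp_opp _)⟩,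
      Or.inr ⟨v, h, Or.inr rfl⟩, Or.inr ⟨v, h, Or.inl (M.opp_opp _)⟩]
  have hcard : Q.ncard = 2 * (Nat.card V - 1) + 2 * #W := by
    rw [hQdef, Set.ncard_coe_finset, card_union_of_disjoint, card_union_of_disjoint,
      card_union_of_disjoint, card_image_of_injOn, card_image_of_injOn, card_image_of_injOn,
      card_image_of_injOn, card_erase_of_mem (mem_univ r), card_univ, Nat.card_eq_fintype_card]
    · ring
    · intro v hv w hw h
      have := congrArg (fun d => M.vert (M.opp d)) h
      simp only [M.opp_opp] at this
      rwa [(hl v hv).1, (hl w hw).1] at this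
    · intro v hv w hw h
      have := congrArg M.vert h
      rwa [(hl v hv).1, (hl w hw).1] at this
    · intro v hv w hw h
      have := congrArg (fun d => M.vert (M.opp d)) h
      simp only [M.opp_opp] at this
      rwa [hp1 v (ne_of_mem_erase hv), hp1 w (ne_of_mem_erase hw)] at this
    · intro v hv w hw h
      have := congrArg M.vert h
      rwa [hp1 v (ne_of_mem_erase hv), hp1 w (ne_of_mem_erase hw)] at this
    · rw [Finset.disjoint_left]
      intro d hd hd'
      obtain ⟨v, hv, rfl⟩ := mem_image.1 hd
      obtain ⟨w, hw, h⟩ := mem_image.1 hd'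
      have := congrArg M.vert h
      rw [(hl w hw).2.1, (hl v hv).1] at this
      subst this
      exact M.opp_ne _ h
    · rw [Finset.disjoint_left]
      intro d hd hd'
      obtain ⟨v, hv, rfl⟩ := mem_image.1 hd
      obtain ⟨w, hw, h⟩ := mem_image.1 hd'
      have h1 := congrArg (fun d => lev (M.vert d)) h
      have h2 := congrArg (fun d => lev (M.vert (M.opp d))) h
      simp only [M.opp_opp] at h1 h2
      have h3 := hp2 v (ne_of_mem_erase hv)
      have h4 := hp2 w (ne_of_mem_erase hw)
      rw [hp1 v (ne_of_mem_erase hv)] at h1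
      rw [hp1 w (ne_of_mem_erase hw)] at h2
      omega
    · rw [Finset.disjoint_left]
      intro d hd hd'
      have h1 : lev (M.vert d) ≠ lev (M.vert (M.opp d)) := by
        rcases mem_union.1 hd with hd | hd <;> obtain ⟨v, hv, rfl⟩ := mem_image.1 hd
        all_goals
          have h3 := hp2 v (ne_of_mem_erase hv)
          have h4 := hp1 v (ne_of_mem_erase hv)
          simp only [M.opp_opp, h4]
          omega
      apply h1
      rcases mem_union.1 hd' with hd | hd <;> obtain ⟨v, hv, rfl⟩ := mem_image.1 hd
      all_goals simp only [M.opp_opp, (hl v hv).1, (hl v hv).2.1]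
  set x : D × Bool := (l r, true)
  set S := M.region Q x with hSdef
  have hS : M.IsClosed Q S := M.isClosed_region Q x
  obtain ⟨K, hK⟩ : ∃ K, ∀ v, lev v ≤ K :=
    ⟨univ.sup lev, fun v => le_sup (f := lev) (mem_univ v)⟩
  have hloop : ∀ v ∈ W, jump S (M.opp (l v)) = jump S (l v) := fun v hv => by
    rw [hS.jump_opp, (hl v hv).2.2]
    rfl
  -- No edge of `Q` has `S` on one side only. The induction runs from the leaves of the tree towards
  -- the root: at `v`, the edges to its children are already settled, so only the parent edge and
  -- the loop can have a nonzero jump.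
  have key : ∀ k, ∀ v, K - lev v = k → ∀ d, M.vert d = v → jump S d = 0 := by
    intro k
    induction k using Nat.strong_induction_on with
    | _ k ih =>
    intro v hv
    set s : Finset D := {d | M.vert d = v ∧ jump S d ≠ 0} with hs
    have hs1 : ∀ d ∈ s, (v ≠ r ∧ d = p v) ∨ (v ∈ W ∧ (d = l v ∨ d = M.opp (l v))) := by
      intro d hd
      rw [hs, mem_filter_univ] at hd
      have hdQ : d ∈ Q := by
        by_contra h
        exact hd.2 (hS.jump_of_notMem h)
      rcases (hmem d).1 hdQ with ⟨u, hu, rfl | rfl⟩ | ⟨u, hu, rfl | rfl⟩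
      · rw [hp1 u hu] at hd
        exact Or.inl (hd.1 ▸ ⟨hu, rfl⟩)
      · have h1 := hp2 u hu
        rw [hd.1] at h1
        have h2 := ih (K - lev u) (by have := hK u; omega) u rfl (p u) (hp1 u hu)
        refine absurd ?_ hd.2
        rw [hS.jump_opp, h2]
        simp
      · rw [(hl u hu).1] at hd
        exact Or.inr (hd.1 ▸ ⟨hu, Or.inl rfl⟩)
      · rw [(hl u hu).2.1] at hd
        exact Or.inr (hd.1 ▸ ⟨hu, Or.inr rfl⟩)
    have hsum : ∑ d ∈ s, jump S d = 0 := by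
      rw [← hS.sum_jump v, hs, ← filter_filter, sum_filter_ne_zero]
    have hodd : ∀ d ∈ s, Odd (jump S d) := fun d hd => odd_jump ((mem_filter_univ _).1 hd).2
    have hle : ∀ d ∈ s, M.opp d ∈ s ∨ (v ≠ r ∧ d = p v) := by
      intro d hd
      refine (hs1 d hd).symm.imp_left ?_
      rw [hs, mem_filter_univ] at hd ⊢
      rintro ⟨hvW, rfl | rfl⟩
      · rw [hloop v hvW]
        exact ⟨(hl v hvW).2.1, hd.2⟩
      · rw [M.opp_opp, ← hloop v hvW]
        exact ⟨(hl v hvW).1, hd.2⟩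
    -- The jumps in `s` are odd and add up to 0.
    have heven : Even #s := by
      have h1 : Even (∑ d ∈ s, jump S d) := hsum ▸ Even.zero
      have h2 : ((∑ d ∈ s, jump S d : ℤ) : ZMod 2) = (#s : ZMod 2) := by
        rw [Int.cast_sum, sum_congr rfl fun d hd => (ZMod.intCast_eq_one_iff_odd).2 (hodd d hd)]
        simp
      rw [(ZMod.intCast_eq_zero_iff_even).2 h1] at h2
      exact (ZMod.natCast_eq_zero_iff_even).1 h2.symm
    -- The two ends of a loop are in `s` together or not at all, so by parity the parent edge cannot
    -- be in `s`.
    have hp : v ≠ r → p v ∉ s := by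
      intro hvr hps
      have hnl : ∀ w ∈ W, p v ≠ l w ∧ p v ≠ M.opp (l w) := by
        intro w hw
        have h3 := hp2 v hvr
        have h4 := hp1 v hvr
        constructor
        · intro h
          rw [h] at h3 h4
          rw [(hl w hw).1] at h4
          rw [(hl w hw).2.1, h4] at h3
          omega
        · intro h
          rw [h] at h3 h4
          rw [(hl w hw).2.1] at h4
          rw [M.opp_opp, (hl w hw).1, h4] at h3
          omega
      have : Even #(s.erase (p v)) := by
        refine even_card_of_involution _ M.opp (fun d hd => ?_) (fun d _ => M.opp_opp d)
          (fun d _ => M.opp_ne d)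
        rw [mem_erase] at hd ⊢
        rcases hle d hd.2 with h | h
        · refine ⟨?_, h⟩
          rcases hs1 d hd.2 with h' | ⟨hw, rfl | rfl⟩
          · exact absurd h'.2 hd.1
          · exact (hnl v hw).2.symm
          · rw [M.opp_opp]
            exact (hnl v hw).1.symm
        · exact absurd h.2 hd.1
      rw [card_erase_of_mem hps] at this
      have h3 := card_pos.2 ⟨_, hps⟩
      obtain ⟨a, ha⟩ := heven
      obtain ⟨b, hb⟩ := this
      omega
    have hs2 : ∀ d ∈ s, v ∈ W ∧ (d = l v ∨ d = M.opp (l v)) := fun d hd =>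
      (hs1 d hd).resolve_left fun h => hp h.1 (h.2 ▸ hd)
    intro d hdv
    by_contra hd
    have hds : d ∈ s := (mem_filter_univ _).2 ⟨hdv, hd⟩
    have hvW := (hs2 d hds).1
    have hls : jump S (l v) ≠ 0 := by
      rcases (hs2 d hds).2 with h | h
      · exact h ▸ hd
      · rw [← hloop v hvW]
        exact h ▸ hd
    have hseq : s = {l v, M.opp (l v)} := by
      ext e
      rw [mem_insert, mem_singleton]
      refine ⟨fun he => (hs2 e he).2, ?_⟩
      rintro (rfl | rfl)
      · exact (mem_filter_univ _).2 ⟨(hl v hvW).1, hls⟩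
      · exact (mem_filter_univ _).2 ⟨(hl v hvW).2.1, by rwa [hloop v hvW]⟩
    -- Both ends of a negative loop have the same jump, so these two jumps alone do not cancel.
    rw [hseq, sum_pair (M.opp_ne _).symm, hloop v hvW] at hsum
    omega
  have huniv : S = Set.univ := by
    refine hS.eq_univ hM.1 (fun d b hd => ?_) (M.mem_region_self _ _)
    have := jump_eq_zero_iff.1 (key _ _ rfl d rfl)
    cases b
    · exact this.2 hd
    · exact this.1 hd
  -- The complement of `Q` is a single face, of Euler characteristic `(|V| - 1 + #W) - |V| = #W -
  -- 1`, and this is at most 1.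
  have h1 := M.chi_le_one hQ x
  rw [← hSdef, huniv, M.chi_univ hM, hcard] at h1
  have hV : 1 ≤ Nat.card V := Nat.card_pos_iff.2 ⟨⟨r⟩, inferInstance⟩
  push_cast [Nat.cast_sub hV] at h1
  have : (#W : ℚ) ≤ 2 := by linarith
  exact_mod_cast this

end Loops

end SignedMap

/-! ### Consequences of the absence of small disks; negative loops in one face -/

namespace SignedMap

variable {V D : Type*} (M : SignedMap V D)

section Corners
set_option linter.unusedSectionVars false
open scoped Classical
open Finset
variable [Fintype D]

lemma flagCard_eq_card {Q : Set D} {S : Set (D × Bool)} {T : Finset (D × Bool)}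
    (h : ∀ y, y ∈ T ↔ y ∈ S ∧ y.1 ∈ Q) : flagCard Q S = #T := by
  rw [flagCard]
  congr 1
  ext y
  rw [mem_filter_univ, h]

/-! ### Disk faces have at least three sides -/

/-- Every disk face of `G` has at least three sides. -/
def NoSmallDisks (G : Set D) : Prop :=
  ∀ x, M.chi G (M.region G x) = 1 → 6 ≤ flagCard G (M.region G x)

variable {M} in
-- A disk has `χ = 1` and at least six flags on its sides; every other face has `χ ≤ 0` by
-- integrality. The estimate is additive over faces.
lemma NoSmallDisks.six_chi_le {G : Set D} (h : M.NoSmallDisks G) (hG : M.IsEdgeSet G)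
    {S : Set (D × Bool)} (hS : M.IsClosed G S) : 6 * M.chi G S ≤ flagCard G S := by
  refine hS.mul_chi_le 6 fun x _ => ?_
  rcases (M.chi_le_one hG x).eq_or_lt with h1 | h1
  · rw [h1, mul_one]
    exact_mod_cast h x h1
  · have := M.chi_le_of_lt hG x 1 (by exact_mod_cast h1)
    have h2 : (0 : ℚ) ≤ flagCard G (M.region G x) := Nat.cast_nonneg _
    push_cast at this
    linarith

variable {M} in
-- If a disk face of `Q` contains `m` flags of `G` in its interior, the estimate for the faces of
-- `G` inside reads `6 + 6 m / 4 ≤ s + m`, where `s` counts the flags on its sides. Hence `6 ≤ s`.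
lemma NoSmallDisks.subset {G Q : Set D} (h : M.NoSmallDisks G) (hG : M.IsEdgeSet G)
    (hQG : Q ⊆ G) : M.NoSmallDisks Q := by
  intro x hx
  have h1 := h.six_chi_le hG ((M.isClosed_region Q x).mono hQG)
  have h2 := M.chi_diff hQG (M.region Q x)
  have h3 := flagCard_diff hQG (M.region Q x)
  rw [hx] at h2
  rw [h2, h3] at h1
  push_cast at h1
  have h4 : (0 : ℚ) ≤ flagCard (G \ Q) (M.region Q x) := Nat.cast_nonneg _
  have : (6 : ℚ) ≤ flagCard Q (M.region Q x) := by linarith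
  exact_mod_cast this

/-! ### The edges in a corner -/

lemma next_pow_mem {Q : Set D} {d : D} (hd : d ∈ Q) (n : ℕ) : (M.next Q ^ n) d ∈ Q := by
  induction n with
  | zero => exact hd
  | succ n ih =>
    rw [pow_succ', Equiv.Perm.mul_apply]
    exact M.next_mem ih

lemma exists_next_pow_of_rot_pow {P Q : Set D} (n : ℕ) (hn : 0 < n) {d e : D} (hd : d ∈ Q)
    (he : e ∈ Q) (h : (M.rot ^ n) d = e) (hi : ∀ i, 0 < i → i ≤ n → (M.rot ^ i) d ∉ P) :
    ∃ j, 0 < j ∧ (M.next Q ^ j) d = e ∧ ∀ i, 0 < i → i ≤ j → (M.next Q ^ i) d ∉ P := by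
  induction n using Nat.strong_induction_on generalizing d with
  | _ n ih =>
  obtain ⟨m, hm, h1, h2, h3⟩ := M.next_spec hd
  have hmn : m ≤ n := by
    by_contra hlt
    exact h3 n hn (by omega) (h ▸ he)
  have hnot : M.next Q d ∉ P := h1 ▸ hi m hm hmn
  rcases hmn.eq_or_lt with rfl | hlt
  · refine ⟨1, one_pos, by rw [pow_one, ← h1, h], fun i hi1 hi2 => ?_⟩
    obtain rfl : i = 1 := by omega
    rwa [pow_one]
  · obtain ⟨j, hj, hj1, hj2⟩ := ih (n - m) (by omega) (by omega) h2
      (by rw [← h1, ← Equiv.Perm.mul_apply, ← pow_add, Nat.sub_add_cancel hmn, h])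
      (fun i hi1 hi2 => by
        rw [← h1, ← Equiv.Perm.mul_apply, ← pow_add]
        exact hi _ (by omega) (by omega))
    refine ⟨j + 1, by omega, by rw [pow_succ, Equiv.Perm.mul_apply, hj1], fun i hi1 hi2 => ?_⟩
    obtain ⟨k, rfl⟩ : ∃ k, i = k + 1 := ⟨i - 1, by omega⟩
    rw [pow_succ, Equiv.Perm.mul_apply]
    rcases Nat.eq_zero_or_pos k with rfl | hk
    · exact hnot
    · exact hj2 k hk (by omega)

lemma exists_rot_pow_of_next_pow {P Q : Set D} (hPQ : P ⊆ Q) {d : D} (hd : d ∈ Q) (j : ℕ)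
    (hj : ∀ i, 0 < i → i < j → (M.next Q ^ i) d ∉ P) :
    ∃ n, j ≤ n ∧ (j = 0 → n = 0) ∧ (M.rot ^ n) d = (M.next Q ^ j) d ∧
      ∀ i, 0 < i → i < n → (M.rot ^ i) d ∉ P := by
  induction j with
  | zero => exact ⟨0, le_rfl, fun _ => rfl, rfl, fun i h1 h2 => by omega⟩
  | succ j ih =>
    obtain ⟨n, hn, hn0, hn1, hn2⟩ := ih fun i h1 h2 => hj i h1 (by omega)
    obtain ⟨m, hm, hm1, -, hm2⟩ := M.next_spec (M.next_pow_mem hd j)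
    refine ⟨m + n, by omega, by omega, ?_, fun i h1 h2 => ?_⟩
    · rw [pow_add, Equiv.Perm.mul_apply, hn1, hm1, pow_succ', Equiv.Perm.mul_apply]
    · rcases lt_trichotomy i n with h | rfl | h
      · exact hn2 i h1 h
      · rw [hn1]
        exact hj j (by omega) (by omega)
      · have := hm2 (i - n) (by omega) (by omega)
        rw [← hn1, ← Equiv.Perm.mul_apply, ← pow_add, Nat.sub_add_cancel h.le] at this
        exact fun h => this (hPQ h)

/-- The darts of `Q` in a corner of `P` are met one after the other. -/
lemma corner_enum {P Q : Set D} (hPQ : P ⊆ Q) {a : D} (ha : a ∈ P) (L : Finset D)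
    (hL : ∀ e, e ∈ L ↔ e ∈ Q ∧ M.InCorner P a e) :
    (∀ i, 0 < i → i ≤ #L → (M.next Q ^ i) a ∈ L) ∧
      (M.next Q ^ (#L + 1)) a = M.next P a ∧
      (∀ i j, 0 < i → i < j → j ≤ #L → (M.next Q ^ i) a ≠ (M.next Q ^ j) a) := by
  have haQ := hPQ ha
  have hex : ∃ k, (M.next Q ^ (k + 1)) a ∈ P := by
    refine ⟨orderOf (M.next Q) - 1, ?_⟩
    rw [Nat.sub_add_cancel (orderOf_pos _), pow_orderOf_eq_one]
    exact ha
  set J := Nat.find hex with hJ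
  have hJ1 : (M.next Q ^ (J + 1)) a ∈ P := Nat.find_spec hex
  have hJ2 : ∀ i, 0 < i → i ≤ J → (M.next Q ^ i) a ∉ P := by
    intro i h1 h2 h3
    refine Nat.find_min hex (m := i - 1) (by omega) ?_
    rwa [Nat.sub_add_cancel h1]
  have hmem : ∀ i, 0 < i → i ≤ J → (M.next Q ^ i) a ∈ L := by
    intro i h1 h2
    rw [hL]
    refine ⟨M.next_pow_mem haQ i, ?_⟩
    obtain ⟨n, hn, -, hn1, hn2⟩ := M.exists_rot_pow_of_next_pow hPQ haQ i
      fun k h3 h4 => hJ2 k h3 (by omega)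
    refine ⟨n, by omega, hn1, fun k h3 h4 => ?_⟩
    rcases h4.eq_or_lt with rfl | h4
    · rw [hn1]
      exact hJ2 i h1 h2
    · exact hn2 k h3 h4
  have hinj : ∀ i j, 0 < i → i < j → j ≤ J → (M.next Q ^ i) a ≠ (M.next Q ^ j) a := by
    intro i j h1 h2 h3 h
    refine hJ2 (j - i) (by omega) (by omega) ?_
    have : (M.next Q ^ (j - i)) a = a := by
      apply (M.next Q ^ i).injective
      rw [← Equiv.Perm.mul_apply, ← pow_add, Nat.add_sub_cancel' h2.le, h]
    rwa [this]
  have hcard : #L = J := by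
    have : L = (Icc 1 J).image fun i => (M.next Q ^ i) a := by
      ext e
      rw [mem_image]
      constructor
      · intro he
        obtain ⟨heQ, n, hn, hn1, hn2⟩ := (hL e).1 he
        obtain ⟨j, hj, hj1, hj2⟩ := M.exists_next_pow_of_rot_pow n hn haQ heQ hn1 hn2
        refine ⟨j, mem_Icc.2 ⟨hj, ?_⟩, hj1⟩
        by_contra hlt
        exact hj2 (J + 1) (by omega) (by omega) hJ1
      · rintro ⟨i, hi, rfl⟩
        rw [mem_Icc] at hi
        exact hmem i hi.1 hi.2
    rw [this, card_image_of_injOn, Nat.card_Icc, Nat.add_sub_cancel]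
    intro i hi j hj h
    rw [mem_coe, mem_Icc] at hi hj
    rcases lt_trichotomy i j with hij | hij | hij
    · exact absurd h (hinj i j hi.1 hij hj.2)
    · exact hij
    · exact absurd h.symm (hinj j i hj.1 hij hi.2)
  rw [hcard]
  refine ⟨hmem, ?_, hinj⟩
  obtain ⟨n, hn, -, hn1, hn2⟩ := M.exists_rot_pow_of_next_pow hPQ haQ (J + 1)
    fun k h3 h4 => hJ2 k h3 (by omega)
  exact (M.next_eq ha hJ1 (by omega) hn1 hn2).symm

/-! ### Negative loops -/

variable {M} in
lemma IsClosed.along_neg {Q : Set D} {S : Set (D × Bool)} (hS : M.IsClosed Q S) {d e : D}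
    (hd : M.pos d = false) (h : M.opp d = e) (b : Bool) : (d, b) ∈ S ↔ (e, b) ∈ S := by
  subst h
  have := hS.along_iff (y := (d, b))
  simp only [SignedMap.along, hd, Bool.xor_false] at this
  exact this.symm

variable {M} in
/-- Two negative edges never bound a two-sided disk. -/
lemma NoSmallDisks.chi_bigon_le {Q : Set D} (h : M.NoSmallDisks Q) (hQ : M.IsEdgeSet Q) {p q : D}
    (hp : p ∈ Q) (hpn : M.pos p = false) (hqn : M.pos q = false)
    (h1 : M.next Q p = q) (h2 : M.next Q (M.opp p) = M.opp q) :
    M.chi Q (M.region Q (p, true)) ≤ 0 := by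
  by_contra hlt
  have hchi : M.chi Q (M.region Q (p, true)) = 1 := by
    refine le_antisymm (M.chi_le_one hQ _) ?_
    by_contra hlt'
    have := M.chi_le_of_lt hQ (p, true) 1 (by exact_mod_cast not_le.1 hlt')
    push_cast at this
    linarith
  -- The flags on the facing sides of the two edges close up under the boundary walk, so a disk
  -- there would have only these four flags on its sides.
  set T : Finset (D × Bool) := {(p, true), (M.opp p, true), (q, false), (M.opp q, false)} with hT
  have hmem : ∀ y, y ∈ T ↔ y = (p, true) ∨ y = (M.opp p, true) ∨ y = (q, false) ∨
      y = (M.opp q, false) := by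
    intro y
    simp [hT]
  have hsub : ∀ y ∈ M.region Q (p, true), y.1 ∈ Q → y ∈ (T : Set (D × Bool)) := by
    refine disk_flags_subset hQ hchi ?_ hp ?_ ?_
    · rw [mem_coe, hmem]
      exact Or.inl rfl
    · intro y hy _
      rw [mem_coe, hmem] at hy ⊢
      rcases hy with rfl | rfl | rfl | rfl <;>
        simp [SignedMap.along, M.opp_opp, M.pos_opp, hpn, hqn]
    · intro d _
      rw [mem_coe, mem_coe, hmem, hmem]
      simp only [Prod.mk.injEq, and_true, and_false, or_false, false_or, Bool.true_eq_false,
        Bool.false_eq_true]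
      have i1 : d = p ↔ M.next Q d = q := by rw [← h1, (M.next Q).injective.eq_iff]
      have i2 : d = M.opp p ↔ M.next Q d = M.opp q := by
        rw [← h2, (M.next Q).injective.eq_iff]
      rw [i1, i2]
  have h6 := h _ hchi
  have : flagCard Q (M.region Q (p, true)) ≤ #T := by
    refine card_le_card fun y hy => ?_
    rw [mem_filter_univ] at hy
    exact hsub y hy.1 hy.2
  have := this.trans card_le_four
  omega

/-- The combined information about the ends `x₁, x₂, x₃, x₄` of two negative loops which follow
each other around a vertex. -/
structure LoopEnds (P Q : Set D) (x₁ x₂ x₃ x₄ : D) : Prop where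
  mem : ∀ d, d ∈ Q ↔ d ∈ P ∨ d ∈ ({x₁, x₂, x₃, x₄} : Finset D)
  notMem : ∀ d ∈ ({x₁, x₂, x₃, x₄} : Finset D), d ∉ P
  ne : x₁ ≠ x₂ ∧ x₁ ≠ x₃ ∧ x₁ ≠ x₄ ∧ x₂ ≠ x₃ ∧ x₂ ≠ x₄ ∧ x₃ ≠ x₄
  neg : ∀ d ∈ ({x₁, x₂, x₃, x₄} : Finset D), M.pos d = false
  opp : ∀ d ∈ ({x₁, x₂, x₃, x₄} : Finset D), M.opp d ∈ ({x₁, x₂, x₃, x₄} : Finset D)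
  next₁ : M.next Q x₁ = x₂
  next₂ : M.next Q x₂ = x₃
  next₃ : M.next Q x₃ = x₄

namespace LoopEnds
variable {M} {P Q : Set D} {x₁ x₂ x₃ x₄ : D}

lemma isEdgeSet (h : M.LoopEnds P Q x₁ x₂ x₃ x₄) (hP : M.IsEdgeSet P) : M.IsEdgeSet Q := by
  intro d hd
  rw [h.mem] at hd ⊢
  exact hd.imp (hP d) (h.opp d)

lemma subset (h : M.LoopEnds P Q x₁ x₂ x₃ x₄) : P ⊆ Q := fun d hd => (h.mem d).2 (Or.inl hd)

lemma card_ends (h : M.LoopEnds P Q x₁ x₂ x₃ x₄) : #({x₁, x₂, x₃, x₄} : Finset D) = 4 := by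
  obtain ⟨h1, h2, h3, h4, h5, h6⟩ := h.ne
  rw [card_insert_of_notMem (by simp [h1, h2, h3]), card_insert_of_notMem (by simp [h4, h5]),
    card_pair h6]

lemma opp_cases (h : M.LoopEnds P Q x₁ x₂ x₃ x₄) :
    (M.opp x₁ = x₂ ∧ M.opp x₃ = x₄) ∨ (M.opp x₁ = x₃ ∧ M.opp x₂ = x₄) ∨
      (M.opp x₁ = x₄ ∧ M.opp x₂ = x₃) := by
  have h1 := h.opp x₁ (by simp)
  have h2 := h.opp x₂ (by simp)
  have h3 := h.opp x₃ (by simp)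
  have hne := h.ne
  simp only [mem_insert, mem_singleton] at h1 h2 h3
  have n1 := M.opp_ne x₁
  have n2 := M.opp_ne x₂
  have n3 := M.opp_ne x₃
  have o1 := M.opp_opp x₁
  have o2 := M.opp_opp x₂
  have o3 := M.opp_opp x₃
  grind

lemma next_iff (h : M.LoopEnds P Q x₁ x₂ x₃ x₄) {S : Set (D × Bool)} (hS : M.IsClosed Q S) :
    ((x₂, false) ∈ S ↔ (x₁, true) ∈ S) ∧ ((x₃, false) ∈ S ↔ (x₂, true) ∈ S) ∧
      ((x₄, false) ∈ S ↔ (x₃, true) ∈ S) := by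
  have hm : ∀ d ∈ ({x₁, x₂, x₃, x₄} : Finset D), d ∈ Q := fun d hd => (h.mem d).2 (Or.inr hd)
  have h1 := hS.next_mem_iff (hm x₁ (by simp))
  have h2 := hS.next_mem_iff (hm x₂ (by simp))
  have h3 := hS.next_mem_iff (hm x₃ (by simp))
  rw [h.next₁] at h1
  rw [h.next₂] at h2
  rw [h.next₃] at h3
  exact ⟨h1, h2, h3⟩

/-- The flags of both loops lie in the same face of `P`. -/
lemma mem_region (h : M.LoopEnds P Q x₁ x₂ x₃ x₄) :
    ∀ d ∈ ({x₁, x₂, x₃, x₄} : Finset D), ∀ b, (d, b) ∈ M.region P (x₁, true) := by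
  have hS := M.isClosed_region P (x₁, true)
  obtain ⟨h1, h2, h3⟩ := h.next_iff (hS.mono h.subset)
  have hc : ∀ d ∈ ({x₁, x₂, x₃, x₄} : Finset D), ((d, false) ∈ M.region P (x₁, true) ↔
      (d, true) ∈ M.region P (x₁, true)) := fun d hd =>
    hS.cross_iff (y := (d, true)) (h.notMem d hd)
  have c1 := hc x₁ (by simp)
  have c2 := hc x₂ (by simp)
  have c3 := hc x₃ (by simp)
  have c4 := hc x₄ (by simp)
  have h0 := M.mem_region_self P (x₁, true)
  intro d hd b
  simp only [mem_insert, mem_singleton] at hd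
  rcases hd with rfl | rfl | rfl | rfl <;> cases b <;> grind

lemma chi_eq (h : M.LoopEnds P Q x₁ x₂ x₃ x₄) :
    M.chi Q (M.region P (x₁, true)) = M.chi P (M.region P (x₁, true)) + 2 := by
  rw [M.chi_diff h.subset]
  have : flagCard (Q \ P) (M.region P (x₁, true)) =
      #(({x₁, x₂, x₃, x₄} : Finset D) ×ˢ (univ : Finset Bool)) := by
    refine flagCard_eq_card fun ⟨d, b⟩ => ?_
    rw [mem_product]
    simp only [mem_univ, and_true, Set.mem_sdiff, h.mem]
    constructor
    · exact fun hd => ⟨h.mem_region d hd b, Or.inr hd, h.notMem d hd⟩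
    · rintro ⟨-, h1 | h1, h2⟩
      exacts [absurd h1 h2, h1]
  rw [this, card_product, h.card_ends]
  norm_num

lemma region_eq_of_mem (h : M.LoopEnds P Q x₁ x₂ x₃ x₄) {S : Set (D × Bool)}
    (hS : M.IsClosed Q S) (hsub : S ⊆ M.region P (x₁, true))
    (hm : ∀ d ∈ ({x₁, x₂, x₃, x₄} : Finset D), ∀ b, (d, b) ∈ S) :
    S = M.region P (x₁, true) := by
  refine hsub.antisymm (IsClosed.region_subset ⟨hS.along, hS.turn, fun y hy hn => ?_⟩
    (hm x₁ (by simp) true))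
  by_cases hyL : y.1 ∈ ({x₁, x₂, x₃, x₄} : Finset D)
  · exact hm _ hyL _
  · exact hS.cross y hy fun hyQ => ((h.mem _).1 hyQ).elim hn hyL

/-- Either the loops do not separate their face, or they are interlaced. -/
lemma region_cases (h : M.LoopEnds P Q x₁ x₂ x₃ x₄) :
    M.region Q (x₁, true) = M.region P (x₁, true) ∨
    (M.opp x₁ = x₃ ∧ M.opp x₂ = x₄ ∧ M.chi Q (M.region P (x₁, true)) ≤
      M.chi Q (M.region Q (x₁, true)) + M.chi Q (M.region Q (x₂, true))) := by
  have hneg : ∀ d ∈ ({x₁, x₂, x₃, x₄} : Finset D), M.pos d = false := h.neg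
  have n1 := hneg x₁ (by simp)
  have n2 := hneg x₂ (by simp)
  have n3 := hneg x₃ (by simp)
  have hA := M.isClosed_region Q (x₁, true)
  have hA0 := M.mem_region_self Q (x₁, true)
  have hAsub := M.region_anti h.subset (x₁, true)
  obtain ⟨h1, h2, h3⟩ := h.next_iff hA
  rcases h.opp_cases with ⟨o1, o2⟩ | ⟨o1, o2⟩ | ⟨o1, o2⟩
  · left
    refine h.region_eq_of_mem hA hAsub fun d hd b => ?_
    have e1 := hA.along_neg n1 o1
    have e2 := hA.along_neg n3 o2
    have := e1 true
    have := e1 false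
    have := e2 true
    have := e2 false
    simp only [mem_insert, mem_singleton] at hd
    rcases hd with rfl | rfl | rfl | rfl <;> cases b <;> grind
  · by_cases hB : (x₂, true) ∈ M.region Q (x₁, true)
    · left
      refine h.region_eq_of_mem hA hAsub fun d hd b => ?_
      have e1 := hA.along_neg n1 o1
      have e2 := hA.along_neg n2 o2
      have := e1 true
      have := e1 false
      have := e2 true
      have := e2 false
      simp only [mem_insert, mem_singleton] at hd
      rcases hd with rfl | rfl | rfl | rfl <;> cases b <;> grind
    -- Between them, the walks from `(x₁, true)` and `(x₂, true)` meet every flag of the two loops,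
    -- so at most two faces result.
    · right
      refine ⟨o1, o2, ?_⟩
      rw [← M.chi_union _ (region_disjoint M hB), h.region_eq_of_mem (hA.union
        (M.isClosed_region Q (x₂, true)))]
      · refine Set.union_subset hAsub ?_
        rw [← region_eq (h.mem_region x₂ (by simp) true)]
        exact M.region_anti h.subset _
      · intro d hd b
        have hB := M.isClosed_region Q (x₂, true)
        have hB0 := M.mem_region_self Q (x₂, true)
        obtain ⟨k1, k2, k3⟩ := h.next_iff hB
        have e1 := hA.along_neg n1 o1 true
        have e2 := hA.along_neg n2 o2 false
        have e3 := hB.along_neg n1 o1 false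
        have e4 := hB.along_neg n2 o2 true
        simp only [mem_insert, mem_singleton] at hd
        rcases hd with rfl | rfl | rfl | rfl <;> cases b <;>
          first
          | exact Or.inl (by grind)
          | exact Or.inr (by grind)
  · left
    refine h.region_eq_of_mem hA hAsub fun d hd b => ?_
    have e1 := hA.along_neg n1 o1
    have e2 := hA.along_neg n2 o2
    have := e1 true
    have := e1 false
    have := e2 true
    have := e2 false
    simp only [mem_insert, mem_singleton] at hd
    rcases hd with rfl | rfl | rfl | rfl <;> cases b <;> grind

/-- Adding the two loops raises `χ` by 2. Afterwards there is either one face, with `χ ≤ 1`, or the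
loops are interlaced and one of two faces is bounded by `x₁` and `x₂` like a bigon. That one is not
a disk, so the total is again at most 1. -/
lemma chi_le_neg_one (h : M.LoopEnds P Q x₁ x₂ x₃ x₄) (hP : M.IsEdgeSet P)
    (hQ : M.NoSmallDisks Q) : M.chi P (M.region P (x₁, true)) ≤ -1 := by
  have hQe := h.isEdgeSet hP
  have h1 := h.chi_eq
  have hA := M.chi_le_one hQe (x₁, true)
  rcases h.region_cases with h2 | ⟨o1, o2, h2⟩
  · rw [h2] at hA
    linarith
  · have hB := M.chi_le_one hQe (x₂, true)
    have := hQ.chi_bigon_le hQe (p := x₁) (q := x₂) ((h.mem _).2 (Or.inr (by simp)))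
      (h.neg _ (by simp)) (h.neg _ (by simp)) h.next₁
      (by rw [o1, o2, h.next₃])
    linarith

/-- When the loop ends are all the darts of `Q` at their vertex, one more unit is gained. In the
interlaced case both faces look like bigons. In the other case a disk would have its whole boundary
at this vertex, and then the graph would have no other vertex. -/
lemma chi_le_neg_two (h : M.LoopEnds P Q x₁ x₂ x₃ x₄) (hP : M.IsEdgeSet P)
    (hQ : M.NoSmallDisks Q) (hM : M.Connected) (hV : 1 < Nat.card V)
    (h4 : M.next Q x₄ = x₁) (hv : ∀ d ∈ Q, M.vert d = M.vert x₁ →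
      d ∈ ({x₁, x₂, x₃, x₄} : Finset D)) :
    M.chi P (M.region P (x₁, true)) ≤ -2 := by
  have hQe := h.isEdgeSet hP
  have h1 := h.chi_eq
  have hA := M.chi_le_one hQe (x₁, true)
  have hx1 : x₁ ∈ Q := (h.mem _).2 (Or.inr (by simp))
  have hx2 : x₂ ∈ Q := (h.mem _).2 (Or.inr (by simp))
  rcases h.region_cases with h2 | ⟨o1, o2, h2⟩
  · rcases hA.eq_or_lt with hA | hA
    · exfalso
      have hvert : ∀ d ∈ ({x₁, x₂, x₃, x₄} : Finset D), M.vert d = M.vert x₁ := by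
        have e1 := M.vert_next Q x₁
        have e2 := M.vert_next Q x₂
        have e3 := M.vert_next Q x₃
        rw [h.next₁] at e1
        rw [h.next₂, e1] at e2
        rw [h.next₃, e2] at e3
        intro d hd
        simp only [mem_insert, mem_singleton] at hd
        rcases hd with rfl | rfl | rfl | rfl
        exacts [rfl, e1, e2, e3]
      -- The flags at this vertex form complete boundary components, because all edges of `Q` there
      -- are loops; the boundary of a disk is connected.
      have hsub : M.region Q (x₁, true) ⊆ {y | M.vert y.1 = M.vert x₁} := by
        refine M.disk_subset hQe hA ⟨fun y hy => ?_, fun y hy => ?_⟩ rfl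
        · exact (M.vert_turn y).trans hy
        · change M.vert y.1 = M.vert x₁ at hy
          change M.vert (M.skip Q y).1 = M.vert x₁
          by_cases hyQ : y.1 ∈ Q
          · rw [M.skip_of_mem hyQ, along_fst]
            exact hvert _ (h.opp _ (hv _ hyQ hy))
          · rw [M.skip_of_notMem hyQ]
            exact hy
      rw [h2] at hsub
      have hP : ∀ d b, (d, b) ∈ M.region P (x₁, true) → (d, !b) ∈ M.region P (x₁, true) := by
        intro d b hd
        have hdv := hsub hd
        refine (M.isClosed_region P _).cross _ hd fun hdP => ?_
        exact h.notMem d (hv d (h.subset hdP) hdv) hdP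
      have huniv := (M.isClosed_region P _).eq_univ hM hP (M.mem_region_self _ _)
      rw [huniv] at hsub
      have : ∀ v, v = M.vert x₁ := by
        intro v
        induction hM (M.vert x₁) v with
        | refl => rfl
        | tail _ hd _ =>
          obtain ⟨d, -, rfl⟩ := hd
          exact hsub (Set.mem_univ (M.opp d, true))
      have hsubs : Subsingleton V := ⟨fun v w => by rw [this v, this w]⟩
      have := Finite.card_le_one_iff_subsingleton.2 hsubs
      omega
    · have := M.chi_le_of_lt hQe (x₁, true) 1 (by exact_mod_cast hA)
      rw [h2] at this
      push_cast at this
      linarith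
  · have k1 := hQ.chi_bigon_le hQe hx1 (h.neg _ (by simp)) (h.neg _ (by simp)) h.next₁
      (by rw [o1, o2, h.next₃])
    have k2 := hQ.chi_bigon_le hQe hx2 (h.neg _ (by simp)) (h.neg _ (by simp)) h.next₂
      (by rw [o2, ← o1, M.opp_opp, h4])
    linarith

end LoopEnds

/-- A negative loop whose ends lie in the same corner does not separate the face. -/
lemma region_addEdge_loop {Q : Set D} {a l : D} (ha : a ∈ Q) (hn : M.pos l = false)
    (h1 : M.InCorner Q a l) (h2 : M.InCorner Q a (M.opp l)) :
    M.region (M.addEdge Q l) (a, true) = M.region Q (a, true) := by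
  set Q' := M.addEdge Q l with hQ'
  have hlQ := h1.notMem
  have hl'Q := h2.notMem
  refine (M.region_anti (M.subset_addEdge Q l) _).antisymm ?_
  have hS := M.isClosed_region Q' (a, true)
  have h0 := M.mem_region_self Q' (a, true)
  have hen := M.corner_enum (M.subset_addEdge Q l) ha {l, M.opp l} fun e => by
    rw [mem_insert, mem_singleton]
    constructor
    · rintro (rfl | rfl)
      exacts [⟨Or.inl rfl, h1⟩, ⟨Or.inr (Or.inl rfl), h2⟩]
    · rintro ⟨h | h | h, h'⟩
      exacts [Or.inl h, Or.inr h, absurd h h'.notMem]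
  rw [card_pair (M.opp_ne l).symm] at hen
  obtain ⟨e1, -, e3⟩ := hen
  have m1 := e1 1 (by norm_num) (by norm_num)
  have m2 := e1 2 (by norm_num) (by norm_num)
  have m3 := e3 1 2 (by norm_num) (by norm_num) (by norm_num)
  rw [pow_one] at m1 m3
  rw [pow_two, Equiv.Perm.mul_apply] at m2 m3
  set y := M.next Q' a with hy
  have hyn : M.pos y = false ∧ M.next Q' y = M.opp y ∧ y ∈ Q' := by
    simp only [mem_insert, mem_singleton] at m1 m2
    rcases m1 with m1 | m1 <;> rcases m2 with m2 | m2 <;> rw [m1] at m2 m3 ⊢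
    · exact absurd m2.symm m3
    · exact ⟨hn, m2, Or.inl rfl⟩
    · exact ⟨by rw [M.pos_opp, hn], by rw [m2, M.opp_opp], Or.inr (Or.inl rfl)⟩
    · exact absurd m2.symm m3
  have k1 := hS.next_mem_iff (M.subset_addEdge Q l ha)
  have k2 := hS.next_mem_iff hyn.2.2
  rw [← hy] at k1
  rw [hyn.2.1] at k2
  have k3 := hS.along_neg hyn.1 rfl true
  have k4 := hS.along_neg hyn.1 rfl false
  -- Here `y` is the first end of the loop in the corner. The boundary walk enters on its right
  -- side, stays right along the negative loop, and returns through the corner between the ends to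
  -- the left side. So both sides belong to one face.
  have hall : ∀ b, (y, b) ∈ M.region Q' (a, true) ∧ (M.opp y, b) ∈ M.region Q' (a, true) := by
    intro b
    cases b <;> grind
  refine IsClosed.region_subset ⟨hS.along, hS.turn, fun z hz hzn => ?_⟩ h0
  by_cases hz' : z.1 ∈ Q'
  · have : z.1 = y ∨ z.1 = M.opp y := by
      simp only [mem_insert, mem_singleton] at m1
      rcases m1 with m1 | m1 <;> rw [m1] <;> rcases hz' with h | h | h
      exacts [Or.inl h, Or.inr h, absurd h hzn, Or.inr (by rw [h, M.opp_opp]), Or.inl h,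
        absurd h hzn]
    rcases this with h | h
    · have := (hall (!z.2)).1
      rw [← h] at this
      exact this
    · have := (hall (!z.2)).2
      rw [← h] at this
      exact this
  · exact hS.cross z hz hz'

/-- A face with negative loops at two vertices has negative Euler characteristic. -/
lemma chi_le_of_loops {P : Set D} (hP : M.IsEdgeSet P) {a a' l l' : D} (ha : a ∈ P) (ha' : a' ∈ P)
    (hn : M.pos l = false) (hn' : M.pos l' = false) (hv : M.vert a ≠ M.vert a')
    (h1 : M.InCorner P a l) (h2 : M.InCorner P a (M.opp l))
    (h1' : M.InCorner P a' l') (h2' : M.InCorner P a' (M.opp l'))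
    (h : (a', true) ∈ M.region P (a, true)) :
    M.chi P (M.region P (a, true)) ≤ -1 := by
  have hl := h1.notMem
  have key : ∀ e, M.InCorner P a' e → M.InCorner (M.addEdge P l) a' e := by
    rintro e ⟨n, hn1, hn2, hn3⟩
    refine ⟨n, hn1, hn2, fun i hi hi' => ?_⟩
    have hvi : M.vert ((M.rot ^ i) a') ≠ M.vert a := by
      rw [vert_rot_pow]
      exact hv.symm
    rintro (h | h | h)
    · exact hvi (by rw [h, h1.vert_eq])
    · exact hvi (by rw [h, h2.vert_eq])
    · exact hn3 i hi hi' h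
  have hl' := (key _ h1').notMem
  have hP' := M.isEdgeSet_addEdge hP l
  have r1 := M.region_addEdge_loop ha hn h1 h2
  have r2 := M.region_addEdge_loop (M.subset_addEdge P l ha') hn' (key _ h1') (key _ h2')
  have hreg : M.region (M.addEdge P l) (a', true) = M.region P (a, true) := by
    rw [region_eq (x := (a, true))]
    · exact r1
    · rwa [r1]
  have e1 : M.region P (l, true) = M.region P (a, true) :=
    region_eq (((M.isClosed_region P (a, true)).inCorner_iff h1 true).2 (M.mem_region_self _ _))
  have e2 : M.region (M.addEdge P l) (l', true) = M.region P (a, true) := by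
    rw [← hreg]
    exact region_eq (((M.isClosed_region _ (a', true)).inCorner_iff (key _ h1') true).2
      (M.mem_region_self _ _))
  -- Neither loop separates, so adding both raises `χ` of the one face by 2, to a value that is at
  -- most 1.
  have c1 := M.chi_addEdge hP hl true
  have c2 := M.chi_addEdge hP' hl' true
  rw [e1] at c1
  rw [e2, c1] at c2
  have c3 := M.chi_le_one (M.isEdgeSet_addEdge hP' l') (a', true)
  rw [r2, hreg, c2] at c3
  linarith

end Corners

end SignedMap

/-! ### Counting corners outside the disk faces of the positive subgraph -/

namespace SignedMap

variable {V D : Type*} (M : SignedMap V D)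

section Counting
set_option linter.unusedSectionVars false
open scoped Classical
open Finset
variable [Fintype D]

/-! ### The subgraph of the positive edges -/

/-- The darts of the positive edges of `G`. -/
def posPart (G : Set D) : Set D := {d | d ∈ G ∧ M.pos d = true}

lemma posPart_subset (G : Set D) : M.posPart G ⊆ G := fun _ h => h.1

lemma isEdgeSet_posPart {G : Set D} (hG : M.IsEdgeSet G) : M.IsEdgeSet (M.posPart G) :=
  fun d h => ⟨hG d h.1, by rw [M.pos_opp, h.2]⟩

/-- The darts of `P` after which comes a corner of a face that is not a disk. -/
noncomputable def wild (P : Set D) : Finset D :=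
  {a | a ∈ P ∧ M.chi P (M.region P (a, true)) ≤ 0}

variable {M} in
lemma mem_wild {P : Set D} {a : D} :
    a ∈ M.wild P ↔ a ∈ P ∧ M.chi P (M.region P (a, true)) ≤ 0 := by
  simp [wild]

/-- The darts of `wild P` at `v`. -/
noncomputable def wildAt (P : Set D) (v : V) : Finset D := {a ∈ M.wild P | M.vert a = v}

variable {M} in
lemma mem_wildAt {P : Set D} {v : V} {a : D} :
    a ∈ M.wildAt P v ↔ a ∈ M.wild P ∧ M.vert a = v := by
  simp [wildAt]

/-- The union of the faces of `P` that are not disks. -/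
def wildPart (P : Set D) : Set (D × Bool) := {x | M.chi P (M.region P x) ≤ 0}

lemma isClosed_wildPart (P : Set D) : M.IsClosed P (M.wildPart P) := by
  have key : ∀ x y, y ∈ M.region P x → x ∈ M.wildPart P → y ∈ M.wildPart P := by
    intro x y hy hx
    change M.chi P (M.region P y) ≤ 0
    rw [region_eq hy]
    exact hx
  have hc := fun x => M.isClosed_region P x
  have h0 := M.mem_region_self P
  exact ⟨fun y => key _ _ ((hc y).along y (h0 y)), fun y => key _ _ ((hc y).turn y (h0 y)),
    fun y hy hn => key _ _ ((hc y).cross y (h0 y) hn) hy⟩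

lemma chi_eq_one_or_le {P : Set D} (hP : M.IsEdgeSet P) (x : D × Bool) :
    M.chi P (M.region P x) = 1 ∨ M.chi P (M.region P x) ≤ 0 := by
  rcases (M.chi_le_one hP x).eq_or_lt with h | h
  · exact Or.inl h
  · right
    have := M.chi_le_of_lt hP x 1 (by exact_mod_cast h)
    push_cast at this
    linarith

variable {M} in
-- The corner after `a` contains the left flag of `a` and the right flag of `next P a`, and nothing
-- else of `P`. So flags on the sides are counted by corners, two for each.
lemma IsClosed.flagCard_eq {P : Set D} {S : Set (D × Bool)} (hS : M.IsClosed P S) :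
    flagCard P S = 2 * #{a | a ∈ P ∧ (a, true) ∈ S} := by
  have h1 : #{a | a ∈ P ∧ (a, true) ∈ S} = #{a | a ∈ P ∧ (a, false) ∈ S} := by
    refine card_nbij' (M.next P) (M.next P).symm (fun a ha => ?_) (fun a ha => ?_)
      (fun a _ => Equiv.symm_apply_apply _ a) (fun a _ => Equiv.apply_symm_apply _ a)
    · rw [mem_coe, mem_filter_univ] at ha ⊢
      exact ⟨M.next_mem ha.1, (hS.next_mem_iff ha.1).2 ha.2⟩
    · rw [mem_coe, mem_filter_univ] at ha ⊢
      refine ⟨M.next_symm_mem ha.1, ?_⟩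
      rw [← hS.next_mem_iff (M.next_symm_mem ha.1), Equiv.apply_symm_apply]
      exact ha.2
  have h2 : flagCard P S = #((({a | a ∈ P ∧ (a, true) ∈ S} : Finset D) ×ˢ {true}) ∪
      (({a | a ∈ P ∧ (a, false) ∈ S} : Finset D) ×ˢ {false})) := by
    refine flagCard_eq_card fun ⟨a, b⟩ => ?_
    cases b <;> simp [and_comm]
  rw [h2, card_union_of_disjoint, card_product, card_product, ← h1, card_singleton, card_singleton]
  · ring
  · rw [Finset.disjoint_left]
    rintro ⟨a, b⟩ h3 h4
    rw [mem_product, mem_singleton] at h3 h4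
    have := h3.2.symm.trans h4.2
    simp at this

variable {M} in
-- The other wild faces contribute at most 0.
lemma wildPart_le {P : Set D} {x : D × Bool} {c : ℚ} (hc : c ≤ 0)
    (h : M.chi P (M.region P x) ≤ c) : M.chi P (M.wildPart P) ≤ c := by
  have hx : x ∈ M.wildPart P := h.trans hc
  have hS := M.isClosed_wildPart P
  have hR := M.isClosed_region P x
  have hu : M.wildPart P = M.region P x ∪ (M.wildPart P ∩ (M.region P x)ᶜ) := by
    ext y
    by_cases hy : y ∈ M.region P x
    · simp [hy, hS.region_subset hx hy]
    · simp [hy]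
  have h1 : M.chi P (M.wildPart P ∩ (M.region P x)ᶜ) ≤ 0 :=
    (hS.inter hR.compl).chi_le fun y hy => hy.1
  rw [hu, M.chi_union _ (Set.disjoint_left.2 fun y hy hy' => hy'.2 hy)]
  linarith

lemma chi_wildPart_nonpos (P : Set D) : M.chi P (M.wildPart P) ≤ 0 :=
  (M.isClosed_wildPart P).chi_le fun _ h => h

lemma flagCard_wildPart (P : Set D) : flagCard P (M.wildPart P) = 2 * #(M.wild P) := by
  rw [(M.isClosed_wildPart P).flagCard_eq]
  congr 2
  ext a
  rw [mem_filter_univ, mem_wild]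
  rfl

variable {M} in
lemma flagCard_compl (P : Set D) (S : Set (D × Bool)) :
    flagCard P S + flagCard P Sᶜ = 2 * P.ncard := by
  rw [← flagCard_univ, ← flagCard_union _ disjoint_compl_right,
    Set.union_compl_self]

variable {M} in
lemma chi_compl (P : Set D) (S : Set (D × Bool)) :
    M.chi P S + M.chi P Sᶜ = M.chi P Set.univ := by
  rw [← M.chi_union _ disjoint_compl_right, Set.union_compl_self]

variable {M} in
-- The central inequality. The disk faces have total Euler characteristic `|P| / 2 - |V| -
-- χ(wildPart)` by Euler's formula, and `2 |P| - 2 #wild` flags of `P` on their sides, with `|P|`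
-- counting darts. Each disk needs at least six of these flags.
lemma NoSmallDisks.card_le (hM : M.IsKleinBottle) {P : Set D} (h : M.NoSmallDisks P)
    (hP : M.IsEdgeSet P) :
    (P.ncard + 2 * #(M.wild P) : ℚ) ≤ 6 * Nat.card V + 6 * M.chi P (M.wildPart P) := by
  have h1 := h.six_chi_le hP (M.isClosed_wildPart P).compl
  have h2 := M.flagCard_wildPart P
  have h3 : (_ : ℚ) = _ := congrArg Nat.cast (flagCard_compl P (M.wildPart P))
  have h4 := M.chi_compl P (M.wildPart P)
  rw [M.chi_univ hM] at h4
  rw [h2] at h3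
  push_cast at h3
  linarith

variable {M} in
-- In the case of equality no disk has flags to spare: the estimate for all other disks leaves at
-- most six for this one.
lemma NoSmallDisks.triangle (hM : M.IsKleinBottle) {P : Set D} (h : M.NoSmallDisks P)
    (hP : M.IsEdgeSet P)
    (heq : (6 * Nat.card V + 6 * M.chi P (M.wildPart P) : ℚ) ≤ P.ncard + 2 * #(M.wild P))
    {x : D × Bool} (hx : M.chi P (M.region P x) = 1) : flagCard P (M.region P x) = 6 := by
  refine le_antisymm ?_ (h x hx)
  have hS := (M.isClosed_wildPart P).compl
  have hR := M.isClosed_region P x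
  have hxS : x ∈ (M.wildPart P)ᶜ := fun hx' => by
    have : M.chi P (M.region P x) ≤ 0 := hx'
    linarith
  have hu : (M.wildPart P)ᶜ = M.region P x ∪ ((M.wildPart P)ᶜ ∩ (M.region P x)ᶜ) := by
    ext y
    by_cases hy : y ∈ M.region P x
    · simpa [hy] using hS.region_subset hxS hy
    · simp [hy]
  have hd : Disjoint (M.region P x) ((M.wildPart P)ᶜ ∩ (M.region P x)ᶜ) :=
    Set.disjoint_left.2 fun y hy hy' => hy'.2 hy
  have h1 := h.six_chi_le hP (hS.inter hR.compl)
  have h2 := M.flagCard_wildPart P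
  have h3 : (_ : ℚ) = _ := congrArg Nat.cast (flagCard_compl P (M.wildPart P))
  have h4 := M.chi_compl P (M.wildPart P)
  rw [M.chi_univ hM] at h4
  rw [h2, hu, flagCard_union _ hd] at h3
  rw [hu, M.chi_union _ hd, hx] at h4
  push_cast at h3
  have : (flagCard P (M.region P x) : ℚ) ≤ 6 := by linarith
  exact_mod_cast this

lemma posDegree_eq (G : Set D) (v : V) : M.posDegree G v = #(M.dartsAt (M.posPart G) v) := by
  rw [posDegree, ← Set.ncard_coe_finset]
  congr 1
  ext d
  rw [mem_coe, mem_dartsAt]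
  exact ⟨fun h => ⟨⟨h.1, h.2.2⟩, h.2.1⟩, fun h => ⟨h.1.1, h.2, h.1.2⟩⟩

lemma even_ncard {P : Set D} (hP : M.IsEdgeSet P) : Even P.ncard := by
  have : P.ncard = #({d | d ∈ P} : Finset D) := by
    rw [← Set.ncard_coe_finset]
    congr 1
    ext
    simp
  rw [this]
  refine even_card_of_involution _ M.opp (fun d hd => ?_) (fun d _ => M.opp_opp d)
    (fun d _ => M.opp_ne d)
  rw [mem_filter_univ] at hd ⊢
  exact hP d hd

/-- A graph with at least three vertices on a Klein bottle, without small disk faces and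
interior vertices, and such that no vertex has small positive degree in the sense of the first
three conclusions of the theorem. -/
structure IsExtremal (G : Set D) : Prop where
  klein : M.IsKleinBottle
  three_le : 3 ≤ Nat.card V
  isEdgeSet : M.IsEdgeSet G
  noSmallDisks : M.NoSmallDisks G
  exists_neg : ∀ v, ∃ d ∈ G, M.vert d = v ∧ M.pos d = false
  not_good : ∀ v, M.IsGood G v → M.posDegree G v = 4 → M.negLoops G v ≠ ∅
  four_le : ∀ v, M.posDegree G v ≤ 3 → M.negLoops G v ≠ ∅
  three_le_of_loop : ∀ v, M.posDegree G v ≤ 2 → (M.negLoops G v).ncard ≠ 1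

namespace IsExtremal
variable {M} {G : Set D}

lemma noSmallDisks_of_subset (h : M.IsExtremal G) {Q : Set D} (hQ : Q ⊆ G) : M.NoSmallDisks Q :=
  h.noSmallDisks.subset h.isEdgeSet hQ

lemma isEdgeSet_pos (h : M.IsExtremal G) : M.IsEdgeSet (M.posPart G) :=
  M.isEdgeSet_posPart h.isEdgeSet

/-- A disk face of the positive subgraph contains positive edges only. -/
lemma chi_nonpos_of_neg (h : M.IsExtremal G) {e : D} (he : M.pos e = false) (b : Bool) :
    M.chi (M.posPart G) (M.region (M.posPart G) (e, b)) ≤ 0 := by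
  rcases M.chi_eq_one_or_le h.isEdgeSet_pos (e, b) with h1 | h1
  · have := M.pos_of_disk h.isEdgeSet_pos (fun d hd => hd.2) h1
    rw [he] at this
    exact absurd this (by decide)
  · exact h1

lemma exists_wild (h : M.IsExtremal G) {e a : D} (he : M.pos e = false)
    (ha : a ∈ M.posPart G) (hv : M.vert a = M.vert e) :
    ∃ a' ∈ M.wildAt (M.posPart G) (M.vert e), M.InCorner (M.posPart G) a' e := by
  obtain ⟨a', ha', hc⟩ := M.exists_inCorner ha (e := e)
    (fun h' => by rw [h'.2] at he; exact absurd he (by decide)) hv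
  refine ⟨a', mem_wildAt.2 ⟨mem_wild.2 ⟨ha', ?_⟩, hc.vert_eq.symm⟩, hc⟩
  rw [← region_eq (((M.isClosed_region _ _).inCorner_iff hc true).2 (M.mem_region_self _ _))]
  exact h.chi_nonpos_of_neg he true

lemma wildAt_subset (v : V) : M.wildAt (M.posPart G) v ⊆ M.dartsAt (M.posPart G) v :=
  fun _ ha => mem_dartsAt.2 ⟨(mem_wild.1 (mem_wildAt.1 ha).1).1, (mem_wildAt.1 ha).2⟩

lemma card_wildAt_le (v : V) : #(M.wildAt (M.posPart G) v) ≤ M.posDegree G v := by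
  rw [posDegree_eq]
  exact card_le_card (wildAt_subset v)

lemma wildAt_nonempty (h : M.IsExtremal G) {v : V} (hv : 0 < M.posDegree G v) :
    0 < #(M.wildAt (M.posPart G) v) := by
  rw [posDegree_eq, card_pos] at hv
  obtain ⟨a, ha⟩ := hv
  rw [mem_dartsAt] at ha
  obtain ⟨e, -, hev, he⟩ := h.exists_neg v
  obtain ⟨a', ha', -⟩ := h.exists_wild he ha.1 (ha.2.trans hev.symm)
  rw [hev] at ha'
  exact card_pos.2 ⟨a', ha'⟩

lemma inCorner_of_card_eq_one (h : M.IsExtremal G) {a e : D}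
    (hn : #(M.wildAt (M.posPart G) (M.vert a)) = 1) (ha : a ∈ M.wild (M.posPart G))
    (he : M.pos e = false) (hv : M.vert e = M.vert a) : M.InCorner (M.posPart G) a e := by
  obtain ⟨a', ha', hc⟩ := h.exists_wild he (mem_wild.1 ha).1 hv.symm
  rw [hv] at ha'
  rwa [card_le_one.1 hn.le a (mem_wildAt.2 ⟨ha, rfl⟩) a' ha']

/-- Negative darts lie in wild corners only, and all of them in the same one if there is only one.
-/
lemma isGood_of_card_eq_one (h : M.IsExtremal G) {v : V}
    (hn : #(M.wildAt (M.posPart G) v) = 1) : M.IsGood G v := by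
  obtain ⟨a, ha⟩ := card_pos.1 (hn ▸ one_pos : 0 < #(M.wildAt (M.posPart G) v))
  rw [mem_wildAt] at ha
  obtain ⟨ha, rfl⟩ := ha
  exact M.isGood_of_inCorner rfl (mem_wild.1 ha).1 fun e _ hev he =>
    h.inCorner_of_card_eq_one hn ha he hev

/-- A vertex without negative loops. -/
lemma of_negLoops_eq_zero (h : M.IsExtremal G) {v : V} (hv : (M.negLoops G v).ncard = 0) :
    (5 ≤ M.posDegree G v ∧ 1 ≤ #(M.wildAt (M.posPart G) v)) ∨
      (M.posDegree G v = 4 ∧ 2 ≤ #(M.wildAt (M.posPart G) v)) := by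
  have h0 : M.negLoops G v = ∅ := (Set.ncard_eq_zero (Set.toFinite _)).1 hv
  have h4 : 4 ≤ M.posDegree G v := by
    by_contra hlt
    exact h.four_le v (by omega) h0
  have h1 := h.wildAt_nonempty (v := v) (by omega)
  rcases h4.eq_or_lt with h4 | h4
  · right
    refine ⟨h4.symm, ?_⟩
    by_contra hlt
    exact h.not_good v (h.isGood_of_card_eq_one (by omega)) h4.symm h0
  · exact Or.inl ⟨h4, h1⟩

lemma of_negLoops_eq_one (h : M.IsExtremal G) {v : V} (hv : (M.negLoops G v).ncard = 1) :
    3 ≤ M.posDegree G v ∧ 1 ≤ #(M.wildAt (M.posPart G) v) := by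
  have h4 : 3 ≤ M.posDegree G v := by
    by_contra hlt
    exact h.three_le_of_loop v (by omega) hv
  exact ⟨h4, h.wildAt_nonempty (by omega)⟩

lemma exists_loop {v : V} (hv : 0 < (M.negLoops G v).ncard) :
    ∃ l ∈ G, M.vert l = v ∧ M.vert (M.opp l) = v ∧ M.pos l = false := by
  obtain ⟨e, he⟩ := (Set.ncard_pos (Set.toFinite _)).1 hv
  obtain ⟨l, hl, rfl⟩ := (Set.mem_image _ _ _).1 he
  exact ⟨l, hl.1, hl.2.1, hl.2.2.1, hl.2.2.2⟩

lemma exists_two_loops {v : V} (hv : 2 ≤ (M.negLoops G v).ncard) :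
    ∃ l ∈ G, ∃ l' ∈ G, (M.vert l = v ∧ M.vert (M.opp l) = v ∧ M.pos l = false) ∧
      (M.vert l' = v ∧ M.vert (M.opp l') = v ∧ M.pos l' = false) ∧
      l' ≠ l ∧ l' ≠ M.opp l := by
  obtain ⟨e, he, e', he', hne⟩ := (Set.one_lt_ncard (Set.toFinite _)).1 hv
  obtain ⟨l, hl, rfl⟩ := he
  obtain ⟨l', hl', rfl⟩ := he'
  refine ⟨l, hl.1, l', hl'.1, hl.2, hl'.2, ?_⟩
  rw [← not_or, ← M.edge_eq_iff]
  exact fun h => hne h.symm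

/-- A vertex with several negative loops. -/
lemma of_two_le_negLoops (h : M.IsExtremal G) {v : V} (hv : 2 ≤ (M.negLoops G v).ncard) :
    M.chi (M.posPart G) (M.wildPart (M.posPart G)) ≤ -2 ∨
    (1 ≤ #(M.wildAt (M.posPart G) v) ∧
      M.chi (M.posPart G) (M.wildPart (M.posPart G)) ≤ -1) ∨
    2 ≤ #(M.wildAt (M.posPart G) v) := by
  obtain ⟨l, hl, l', hl', ⟨hl1, hl2, hl3⟩, ⟨hl1', hl2', hl3'⟩, hne, hne'⟩ := exists_two_loops hv
  set P := M.posPart G with hPdef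
  set L : Finset D := {l, M.opp l, l', M.opp l'} with hLdef
  have hL : ∀ d, d ∈ L ↔ d = l ∨ d = M.opp l ∨ d = l' ∨ d = M.opp l' := by
    intro d
    simp [hLdef]
  have hLc : #L = 4 := by
    have h1 : l ≠ M.opp l' := fun e => hne' (by rw [e, M.opp_opp])
    have h2 : M.opp l ≠ M.opp l' := fun e => hne (by rw [← M.opp_opp l', ← e, M.opp_opp])
    rw [hLdef, card_insert_of_notMem (by simp [(M.opp_ne l).symm, hne.symm, h1]),
      card_insert_of_notMem (by simp [hne'.symm, h2]), card_pair (M.opp_ne l').symm]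
  set Q : Set D := {d | d ∈ P ∨ d ∈ L} with hQdef
  have hQG : Q ⊆ G := by
    rintro d (hd | hd)
    · exact hd.1
    · rcases (hL d).1 hd with rfl | rfl | rfl | rfl
      exacts [hl, h.isEdgeSet _ hl, hl', h.isEdgeSet _ hl']
  have hLneg : ∀ d ∈ L, M.pos d = false := by
    intro d hd
    rcases (hL d).1 hd with rfl | rfl | rfl | rfl <;> simp [M.pos_opp, hl3, hl3']
  have hLP : ∀ d ∈ L, d ∉ P := fun d hd hdP => by
    have := hLneg d hd
    rw [hdP.2] at this
    exact absurd this (by decide)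
  have hLv : ∀ d ∈ L, M.vert d = v := by
    intro d hd
    rcases (hL d).1 hd with rfl | rfl | rfl | rfl <;> assumption
  have hLopp : ∀ d ∈ L, M.opp d ∈ L := by
    intro d hd
    rw [hL]
    rcases (hL d).1 hd with rfl | rfl | rfl | rfl <;> simp [M.opp_opp]
  have hPQ : P ⊆ Q := fun d hd => Or.inl hd
  have ends : ∀ x₁ ∈ L, M.next Q x₁ ∈ L → M.next Q (M.next Q x₁) ∈ L →
      M.next Q (M.next Q (M.next Q x₁)) ∈ L → (x₁ ≠ M.next Q x₁ ∧ x₁ ≠ M.next Q (M.next Q x₁) ∧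
      x₁ ≠ M.next Q (M.next Q (M.next Q x₁)) ∧ M.next Q x₁ ≠ M.next Q (M.next Q x₁) ∧
      M.next Q x₁ ≠ M.next Q (M.next Q (M.next Q x₁)) ∧
      M.next Q (M.next Q x₁) ≠ M.next Q (M.next Q (M.next Q x₁))) →
      M.LoopEnds P Q x₁ (M.next Q x₁) (M.next Q (M.next Q x₁))
        (M.next Q (M.next Q (M.next Q x₁))) ∧
      ({x₁, M.next Q x₁, M.next Q (M.next Q x₁),
        M.next Q (M.next Q (M.next Q x₁))} : Finset D) = L := by
    intro x₁ h1 h2 h3 h4 hd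
    have heq : ({x₁, M.next Q x₁, M.next Q (M.next Q x₁),
        M.next Q (M.next Q (M.next Q x₁))} : Finset D) = L := by
      obtain ⟨d1, d2, d3, d4, d5, d6⟩ := hd
      refine eq_of_subset_of_card_le ?_ ?_
      · intro d hd
        simp only [mem_insert, mem_singleton] at hd
        rcases hd with rfl | rfl | rfl | rfl <;> assumption
      · rw [hLc, card_insert_of_notMem (by simp [d1, d2, d3]),
          card_insert_of_notMem (by simp [d4, d5]), card_pair d6]
    refine ⟨⟨?_, ?_, hd, ?_, ?_, rfl, rfl, rfl⟩, heq⟩ <;> rw [heq]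
    exacts [fun d => Iff.rfl, hLP, hLneg, hLopp]
  have hQs := h.noSmallDisks_of_subset hQG
  have hcyc := M.isCycleOn_next Q v
  -- Without positive edges at `v`, the four loop ends are the whole cycle of `Q` around `v`. With a
  -- single wild corner, they follow each other inside that corner.
  rcases Nat.eq_zero_or_pos (M.posDegree G v) with h0 | h0
  · left
    rw [posDegree_eq, card_eq_zero] at h0
    have hdarts : M.dartsAt Q v = L := by
      ext d
      rw [mem_dartsAt]
      constructor
      · rintro ⟨hd | hd, hdv⟩
        · have : d ∈ M.dartsAt (M.posPart G) v := mem_dartsAt.2 ⟨hd, hdv⟩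
          rw [h0] at this
          simp at this
        · exact hd
      · exact fun hd => ⟨Or.inr hd, hLv d hd⟩
    rw [hdarts] at hcyc
    have hlL : l ∈ L := (hL l).2 (Or.inl rfl)
    have hmem : ∀ n : ℕ, (M.next Q ^ n) l ∈ L := fun n => hcyc.1.mapsTo.perm_pow n hlL
    have hpow : ∀ m n : ℕ, (M.next Q ^ m) l = (M.next Q ^ n) l ↔ m ≡ n [MOD 4] := fun m n => by
      rw [hcyc.pow_apply_eq_pow_apply hlL, hLc]
    have h4 := hcyc.pow_card_apply hlL
    rw [hLc] at h4
    have e2 : ∀ x, (M.next Q ^ 2) x = M.next Q (M.next Q x) := fun x => rfl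
    have e3 : ∀ x, (M.next Q ^ 3) x = M.next Q (M.next Q (M.next Q x)) := fun x => rfl
    have e4 : ∀ x, (M.next Q ^ 4) x = M.next Q (M.next Q (M.next Q (M.next Q x))) := fun x => rfl
    obtain ⟨hE, hEL⟩ := ends l hlL (hmem 1) (hmem 2) (hmem 3)
      ⟨fun e => absurd ((hpow 0 1).1 e) (by decide), fun e => absurd ((hpow 0 2).1 e) (by decide),
        fun e => absurd ((hpow 0 3).1 e) (by decide), fun e => absurd ((hpow 1 2).1 e) (by decide),
        fun e => absurd ((hpow 1 3).1 e) (by decide), fun e => absurd ((hpow 2 3).1 e) (by decide)⟩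
    have := hE.chi_le_neg_two h.isEdgeSet_pos hQs h.klein.1 (by have := h.three_le; omega) h4
      (fun d hd hdv => by
        rw [hEL, ← hdarts, mem_dartsAt]
        exact ⟨hd, hdv.trans hl1⟩)
    exact wildPart_le (by norm_num) this
  · right
    have h1 := h.wildAt_nonempty h0
    rcases Nat.lt_or_ge 1 #(M.wildAt P v) with h2 | h2
    · exact Or.inr h2
    left
    have hn : #(M.wildAt P v) = 1 := le_antisymm h2 h1
    refine ⟨h1, ?_⟩
    obtain ⟨a, ha⟩ := card_pos.1 h1
    obtain ⟨ha, hav⟩ := mem_wildAt.1 ha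
    have haP := (mem_wild.1 ha).1
    obtain ⟨c1, -, c3⟩ := M.corner_enum hPQ haP L fun e => by
      constructor
      · exact fun he => ⟨Or.inr he, h.inCorner_of_card_eq_one (hav.symm ▸ hn) ha (hLneg e he)
          ((hLv e he).trans hav.symm)⟩
      · exact fun he => he.1.resolve_left he.2.notMem
    rw [hLc] at c1 c3
    obtain ⟨hE, -⟩ := ends (M.next Q a) (c1 1 (by norm_num) (by norm_num))
      (c1 2 (by norm_num) (by norm_num)) (c1 3 (by norm_num) (by norm_num))
      (c1 4 (by norm_num) (by norm_num))
      ⟨c3 1 2 (by norm_num) (by norm_num) (by norm_num),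
        c3 1 3 (by norm_num) (by norm_num) (by norm_num),
        c3 1 4 (by norm_num) (by norm_num) (by norm_num),
        c3 2 3 (by norm_num) (by norm_num) (by norm_num),
        c3 2 4 (by norm_num) (by norm_num) (by norm_num),
        c3 3 4 (by norm_num) (by norm_num) (by norm_num)⟩
    exact wildPart_le (by norm_num) (hE.chi_le_neg_one h.isEdgeSet_pos hQs)

end IsExtremal

end Counting

end SignedMap

/-! ### The numerical possibilities -/

namespace SignedMap

variable {V D : Type*} (M : SignedMap V D)

section Numeric
set_option linter.unusedSectionVars false
open scoped Classical
open Finset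
variable [Fintype D]

/-- The positive degree of a vertex together with the number of corners at it that do not lie in
disk faces of the subgraph of the positive edges. -/
def HasType (G : Set D) (v : V) (d n : ℕ) : Prop :=
  M.posDegree G v = d ∧ #(M.wildAt (M.posPart G) v) = n

/-- The contributions are at least 5, 5 and 7, the total is at most 18, and being even it is exactly
18. So one unit is distributed beyond the minimum. -/
lemma three_types {dx nx dy ny dz nz k : ℕ} (hx : dx ≥ 3 ∧ nx ≥ 1 ∨ dx ≥ nx ∧ nx ≥ 2)
    (hy : dy ≥ 3 ∧ ny ≥ 1 ∨ dy ≥ ny ∧ ny ≥ 2) (hz : 5 ≤ dz ∧ 1 ≤ nz ∨ dz = 4 ∧ 2 ≤ nz)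
    (hle : dx + 2 * nx + (dy + 2 * ny) + (dz + 2 * nz) ≤ 18)
    (hk : dx + 2 * nx + (dy + 2 * ny) + (dz + 2 * nz) = k + k) :
    (((dx = 2 ∧ nx = 2) ∧ (dy = 3 ∧ ny = 1) ∧ (dz = 5 ∧ nz = 1)) ∨
      ((dy = 2 ∧ ny = 2) ∧ (dx = 3 ∧ nx = 1) ∧ (dz = 5 ∧ nz = 1))) ∨
    ((dx = 3 ∧ nx = 1) ∧ (dy = 3 ∧ ny = 1) ∧ (dz = 6 ∧ nz = 1)) ∨
    (((dx = 4 ∧ nx = 1) ∧ (dy = 3 ∧ ny = 1) ∧ (dz = 5 ∧ nz = 1)) ∨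
      ((dy = 4 ∧ ny = 1) ∧ (dx = 3 ∧ nx = 1) ∧ (dz = 5 ∧ nz = 1))) ∨
    ((dx = 3 ∧ nx = 1) ∧ (dy = 3 ∧ ny = 1) ∧ (dz = 4 ∧ nz = 2)) := by
  have h1 : (dx = 3 ∧ nx = 1) ∨ (dx = 4 ∧ nx = 1) ∨ (dx = 2 ∧ nx = 2) := by omega
  have h2 : (dy = 3 ∧ ny = 1) ∨ (dy = 4 ∧ ny = 1) ∨ (dy = 2 ∧ ny = 2) := by omega
  have h3 : (dz = 5 ∧ nz = 1) ∨ (dz = 6 ∧ nz = 1) ∨ (dz = 4 ∧ nz = 2) := by omega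
  rcases h1 with ⟨rfl, rfl⟩ | ⟨rfl, rfl⟩ | ⟨rfl, rfl⟩ <;>
    rcases h2 with ⟨rfl, rfl⟩ | ⟨rfl, rfl⟩ | ⟨rfl, rfl⟩ <;>
    rcases h3 with ⟨rfl, rfl⟩ | ⟨rfl, rfl⟩ | ⟨rfl, rfl⟩ <;>
    first
    | (exfalso; omega)
    | simp

/-- The minimal contributions 5, 5, 7, 7 already add up to 24. -/
lemma four_types {dx nx dy ny dz nz dw nw : ℕ} (hx : dx ≥ 3 ∧ nx ≥ 1 ∨ dx ≥ nx ∧ nx ≥ 2)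
    (hy : dy ≥ 3 ∧ ny ≥ 1 ∨ dy ≥ ny ∧ ny ≥ 2) (hz : 5 ≤ dz ∧ 1 ≤ nz ∨ dz = 4 ∧ 2 ≤ nz)
    (hw : 5 ≤ dw ∧ 1 ≤ nw ∨ dw = 4 ∧ 2 ≤ nw)
    (hle : dx + 2 * nx + (dy + 2 * ny) + (dz + 2 * nz + (dw + 2 * nw)) ≤ 24) :
    (dx = 3 ∧ nx = 1) ∧ (dy = 3 ∧ ny = 1) ∧ (dz = 5 ∧ nz = 1) ∧ (dw = 5 ∧ nw = 1) := by
  have h1 : 5 ≤ dx + 2 * nx := by omega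
  have h2 : 5 ≤ dy + 2 * ny := by omega
  have h3 : 7 ≤ dz + 2 * nz := by omega
  have h4 : 7 ≤ dw + 2 * nw := by omega
  refine ⟨?_, ?_, ?_, ?_⟩ <;> omega

namespace IsExtremal
variable {M} {G : Set D}

lemma sum_posDegree [Fintype V] : ∑ v, M.posDegree G v = (M.posPart G).ncard := by
  have : (M.posPart G).ncard = #({d | d ∈ M.posPart G} : Finset D) := by
    rw [← Set.ncard_coe_finset]
    congr 1
    ext
    simp
  rw [this, card_eq_sum_card_fiberwise (f := M.vert) (t := univ) (fun _ _ => mem_coe.2 (mem_univ _))]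
  refine sum_congr rfl fun v _ => ?_
  rw [posDegree_eq]
  congr 1
  ext d
  simp [dartsAt]

lemma sum_wildAt [Fintype V] :
    ∑ v, #(M.wildAt (M.posPart G) v) = #(M.wild (M.posPart G)) := by
  rw [card_eq_sum_card_fiberwise (f := M.vert) (t := univ) (fun _ _ => mem_coe.2 (mem_univ _))]
  rfl

lemma wildPart_cases (h : M.IsExtremal G) :
    M.chi (M.posPart G) (M.wildPart (M.posPart G)) = 0 ∨
      M.chi (M.posPart G) (M.wildPart (M.posPart G)) ≤ -1 := by
  by_cases hx : ∃ x, M.chi (M.posPart G) (M.region (M.posPart G) x) < 0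
  · obtain ⟨x, hx⟩ := hx
    right
    have := M.chi_le_of_lt h.isEdgeSet_pos x 0 (by exact_mod_cast hx)
    refine wildPart_le (x := x) (by norm_num) ?_
    push_cast at this
    linarith
  · left
    push Not at hx
    refine le_antisymm (M.chi_wildPart_nonpos _) ?_
    have := (M.isClosed_wildPart (M.posPart G)).sum_le (f := fun _ => 0)
      (g := M.weight (M.posPart G)) fun x _ => by
        simpa [chi] using hx x
    simpa [chi] using this

lemma chi_eq_zero (h : M.IsExtremal G)
    (h0 : M.chi (M.posPart G) (M.wildPart (M.posPart G)) = 0) {a : D}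
    (ha : a ∈ M.wild (M.posPart G)) : M.chi (M.posPart G) (M.region (M.posPart G) (a, true)) = 0 := by
  refine le_antisymm (mem_wild.1 ha).2 ?_
  by_contra hlt
  have := M.chi_le_of_lt h.isEdgeSet_pos (a, true) 0 (by exact_mod_cast not_le.1 hlt)
  have h1 := wildPart_le (x := (a, true)) (c := -1) (by norm_num) (by push_cast at this; linarith)
  linarith

/-- The numerical possibilities. -/
lemma numeric [Fintype V] (h : M.IsExtremal G) :
    M.chi (M.posPart G) (M.wildPart (M.posPart G)) = 0 ∧
    (6 * Nat.card V ≤ (M.posPart G).ncard + 2 * #(M.wild (M.posPart G))) ∧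
    ∃ x y, x ≠ y ∧ 0 < (M.negLoops G x).ncard ∧ 0 < (M.negLoops G y).ncard ∧
    ((∃ z, (univ : Finset V) = {x, y, z} ∧ z ≠ x ∧ z ≠ y ∧ (M.negLoops G z).ncard = 0 ∧
      ((M.HasType G x 2 2 ∧ M.HasType G y 3 1 ∧ M.HasType G z 5 1) ∨
      (M.HasType G x 3 1 ∧ M.HasType G y 3 1 ∧ M.HasType G z 6 1) ∨
      (M.HasType G x 4 1 ∧ M.HasType G y 3 1 ∧ M.HasType G z 5 1) ∨
      (M.HasType G x 3 1 ∧ M.HasType G y 3 1 ∧ M.HasType G z 4 2))) ∨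
    (∃ z w, (univ : Finset V) = {x, y, z, w} ∧ z ≠ x ∧ z ≠ y ∧ w ≠ x ∧ w ≠ y ∧ z ≠ w ∧
      (M.negLoops G z).ncard = 0 ∧ (M.negLoops G w).ncard = 0 ∧
      M.HasType G x 3 1 ∧ M.HasType G y 3 1 ∧ M.HasType G z 5 1 ∧ M.HasType G w 5 1)) := by
  have hV := h.three_le
  -- The contribution `d(v) + 2 n(v)` of a vertex to the left side of the central inequality.
  set val : V → ℕ := fun v => M.posDegree G v + 2 * #(M.wildAt (M.posPart G) v) with hval
  have hsum : ∑ v, val v = (M.posPart G).ncard + 2 * #(M.wild (M.posPart G)) := by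
    rw [hval, sum_add_distrib, ← mul_sum, sum_posDegree, sum_wildAt]
  have hle := (h.noSmallDisks_of_subset (M.posPart_subset G)).card_le h.klein h.isEdgeSet_pos
  set S := M.chi (M.posPart G) (M.wildPart (M.posPart G)) with hS
  have hle' : ((∑ v, val v : ℕ) : ℚ) ≤ 6 * Nat.card V + 6 * S := by
    rw [hsum]
    push_cast
    exact hle
  set W : Finset V := {v | 0 < (M.negLoops G v).ncard} with hW
  have hWmem : ∀ v, v ∈ W ↔ 0 < (M.negLoops G v).ncard := fun v => mem_filter_univ v
  have hloops : ∀ v ∈ W, ∃ l, M.vert l = v ∧ M.vert (M.opp l) = v ∧ M.pos l = false := by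
    intro v hv
    obtain ⟨l, -, hl⟩ := exists_loop ((hWmem v).1 hv)
    exact ⟨l, hl⟩
  have hD : Nonempty D := by
    have : Nonempty V := (Nat.card_pos_iff.1 (by omega)).1
    obtain ⟨d, -⟩ := h.exists_neg this.some
    exact ⟨d⟩
  choose! l hl using hloops
  have hW2 : #W ≤ 2 := M.card_le_two h.klein W l hl
  have hcompl : ∀ v ∈ Wᶜ, 7 ≤ val v := by
    intro v hv
    rw [mem_compl, hWmem] at hv
    have := h.of_negLoops_eq_zero (v := v) (by omega)
    simp only [hval]
    omega
  have hsplit : ∑ v, val v = ∑ v ∈ W, val v + ∑ v ∈ Wᶜ, val v := (sum_add_sum_compl W val).symm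
  have hcc : #W + #Wᶜ = Nat.card V := by
    rw [card_add_card_compl, Nat.card_eq_fintype_card]
  have hlow : ∀ c, (∀ v ∈ W, c ≤ val v) → c * #W + 7 * #Wᶜ ≤ ∑ v, val v := by
    intro c hc
    rw [hsplit]
    have h1 := card_nsmul_le_sum W val c hc
    have h2 := card_nsmul_le_sum Wᶜ val 7 hcompl
    simp only [smul_eq_mul] at h1 h2
    linarith
  have hlow' : ∀ c : ℕ, (∀ v ∈ W, c ≤ val v) → (c * #W + 7 * #Wᶜ : ℚ) ≤ 6 * Nat.card V + 6 * S := by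
    intro c hc
    refine le_trans ?_ hle'
    exact_mod_cast hlow c hc
  have hccq : (#W + #Wᶜ : ℚ) = Nat.card V := by exact_mod_cast hcc
  have hW2q : (#W : ℚ) ≤ 2 := by exact_mod_cast hW2
  have hVq : (3 : ℚ) ≤ Nat.card V := by exact_mod_cast hV
  have hloop : ∀ v ∈ W, S ≤ -2 ∨ (3 ≤ val v ∧ S ≤ -1) ∨
      (M.posDegree G v ≥ 3 ∧ #(M.wildAt (M.posPart G) v) ≥ 1) ∨
      (M.posDegree G v ≥ #(M.wildAt (M.posPart G) v) ∧ #(M.wildAt (M.posPart G) v) ≥ 2) := by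
    intro v hv
    rw [hWmem] at hv
    have hcard := card_wildAt_le (M := M) (G := G) v
    rcases Nat.lt_or_ge 1 (M.negLoops G v).ncard with h2 | h2
    · rcases h.of_two_le_negLoops h2 with h3 | ⟨h3, h4⟩ | h3
      · exact Or.inl h3
      · refine Or.inr (Or.inl ⟨?_, h4⟩)
        simp only [hval]
        omega
      · exact Or.inr (Or.inr (Or.inr ⟨hcard, h3⟩))
    · exact Or.inr (Or.inr (Or.inl (h.of_negLoops_eq_one (by omega))))
  -- Vertices without negative loops alone give `7 (|V| - 2) ≤ 6 |V| - 12`, which fails for `|V| ≥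
  -- 3`.
  have hS2 : ¬ S ≤ -2 := by
    intro hS2
    have := hlow' 0 fun _ _ => Nat.zero_le _
    push_cast at this
    linarith
  -- Now vertices with negative loops contribute at least 3, and `3 * 2 + 7 (|V| - 2) ≤ 6 |V| - 6`
  -- fails as well.
  have hS1 : ¬ S ≤ -1 := by
    intro hS1
    have := hlow' 3 fun v hv => by
      rcases hloop v hv with h1 | h1 | h1 | h1
      · exact absurd h1 hS2
      · exact h1.1
      all_goals
        simp only [hval]
        omega
    push_cast at this
    linarith
  have hS0 : S = 0 := h.wildPart_cases.resolve_right hS1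
  refine ⟨hS0, ?_⟩
  have hloop' : ∀ v ∈ W,
      (M.posDegree G v ≥ 3 ∧ #(M.wildAt (M.posPart G) v) ≥ 1) ∨
      (M.posDegree G v ≥ #(M.wildAt (M.posPart G) v) ∧ #(M.wildAt (M.posPart G) v) ≥ 2) := by
    intro v hv
    rcases hloop v hv with h1 | h1 | h1
    · exact absurd h1 hS2
    · exact absurd h1.2 hS1
    · exact h1
  -- Together with the upper bound `6 |V|` this gives `|V| ≤ 2 #W`. As `#W ≤ 2` and `|V| ≥ 3`, there
  -- are two vertices with negative loops and at most two others.
  have h5 := hlow 5 fun v hv => by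
    have := hloop' v hv
    simp only [hval]
    omega
  have h6 : ∑ v, val v ≤ 6 * Nat.card V := by
    rw [hS0] at hle'
    have : ((∑ v, val v : ℕ) : ℚ) ≤ (6 * Nat.card V : ℕ) := by
      push_cast at hle' ⊢
      linarith
    exact_mod_cast this
  have heven : Even (∑ v, val v) := by
    rw [hsum]
    exact (M.even_ncard h.isEdgeSet_pos).add (even_two_mul _)
  obtain ⟨k, hk⟩ := heven
  have hWcard : #W = 2 := by omega
  obtain ⟨x, y, hxy, hWxy⟩ := card_eq_two.1 hWcard
  have hxW : x ∈ W := by rw [hWxy]; simp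
  have hyW : y ∈ W := by rw [hWxy]; simp
  refine ⟨by rw [← hsum]; omega, ?_⟩
  have hx := hloop' x hxW
  have hy := hloop' y hyW
  have hsumW : ∑ v ∈ W, val v = val x + val y := by rw [hWxy, sum_pair hxy]
  have hc : #Wᶜ = 1 ∨ #Wᶜ = 2 := by omega
  rcases hc with hc | hc
  · obtain ⟨z, hz⟩ := card_eq_one.1 hc
    have hzW : z ∉ W := by
      rw [← mem_compl, hz]
      simp
    have hzx : z ≠ x := fun e => hzW (e ▸ hxW)
    have hzy : z ≠ y := fun e => hzW (e ▸ hyW)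
    have hz0 : (M.negLoops G z).ncard = 0 := by
      rw [hWmem] at hzW
      omega
    have hzt := h.of_negLoops_eq_zero hz0
    have huniv : ∀ v, v = x ∨ v = y ∨ v = z := by
      intro v
      by_cases hv : v ∈ W
      · rw [hWxy] at hv
        simp only [mem_insert, mem_singleton] at hv
        exact hv.elim Or.inl fun hv => Or.inr (Or.inl hv)
      · rw [← mem_compl, hz, mem_singleton] at hv
        exact Or.inr (Or.inr hv)
    have huniv1 : (univ : Finset V) = {x, y, z} := by
      ext v
      simpa using huniv v
    have huniv2 : (univ : Finset V) = {y, x, z} := by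
      rw [huniv1, insert_comm]
    have hsz : ∑ v ∈ Wᶜ, val v = val z := by rw [hz, sum_singleton]
    have hcases : ((M.HasType G x 2 2 ∧ M.HasType G y 3 1 ∧ M.HasType G z 5 1) ∨
        (M.HasType G y 2 2 ∧ M.HasType G x 3 1 ∧ M.HasType G z 5 1)) ∨
        (M.HasType G x 3 1 ∧ M.HasType G y 3 1 ∧ M.HasType G z 6 1) ∨
        ((M.HasType G x 4 1 ∧ M.HasType G y 3 1 ∧ M.HasType G z 5 1) ∨
        (M.HasType G y 4 1 ∧ M.HasType G x 3 1 ∧ M.HasType G z 5 1)) ∨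
        (M.HasType G x 3 1 ∧ M.HasType G y 3 1 ∧ M.HasType G z 4 2) := by
      refine three_types (k := k) hx hy hzt ?_ ?_
      · change val x + val y + val z ≤ 18
        omega
      · change val x + val y + val z = k + k
        omega
    rcases hcases with (h1 | h1) | h1 | (h1 | h1) | h1
    · exact ⟨x, y, hxy, (hWmem x).1 hxW, (hWmem y).1 hyW, Or.inl ⟨z, huniv1,
        hzx, hzy, hz0, Or.inl h1⟩⟩
    · exact ⟨y, x, hxy.symm, (hWmem y).1 hyW, (hWmem x).1 hxW, Or.inl ⟨z, huniv2, hzy, hzx, hz0, Or.inl h1⟩⟩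
    · exact ⟨x, y, hxy, (hWmem x).1 hxW, (hWmem y).1 hyW, Or.inl ⟨z, huniv1,
        hzx, hzy, hz0, Or.inr (Or.inl h1)⟩⟩
    · exact ⟨x, y, hxy, (hWmem x).1 hxW, (hWmem y).1 hyW, Or.inl ⟨z, huniv1,
        hzx, hzy, hz0, Or.inr (Or.inr (Or.inl h1))⟩⟩
    · exact ⟨y, x, hxy.symm, (hWmem y).1 hyW, (hWmem x).1 hxW, Or.inl ⟨z, huniv2, hzy, hzx, hz0, Or.inr (Or.inr (Or.inl h1))⟩⟩
    · exact ⟨x, y, hxy, (hWmem x).1 hxW, (hWmem y).1 hyW, Or.inl ⟨z, huniv1,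
        hzx, hzy, hz0, Or.inr (Or.inr (Or.inr h1))⟩⟩
  · obtain ⟨z, w, hzw, hz⟩ := card_eq_two.1 hc
    have hzW : z ∉ W := by
      rw [← mem_compl, hz]
      simp
    have hwW : w ∉ W := by
      rw [← mem_compl, hz]
      simp
    have hz0 : (M.negLoops G z).ncard = 0 := by
      rw [hWmem] at hzW
      omega
    have hw0 : (M.negLoops G w).ncard = 0 := by
      rw [hWmem] at hwW
      omega
    have hzt := h.of_negLoops_eq_zero hz0
    have hwt := h.of_negLoops_eq_zero hw0
    have hsz : ∑ v ∈ Wᶜ, val v = val z + val w := by rw [hz, sum_pair hzw]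
    refine ⟨x, y, hxy, (hWmem x).1 hxW, (hWmem y).1 hyW, Or.inr ⟨z, w, ?_, fun e => hzW (e ▸ hxW),
      fun e => hzW (e ▸ hyW), fun e => hwW (e ▸ hxW), fun e => hwW (e ▸ hyW), hzw, hz0, hw0, ?_⟩⟩
    · ext v
      simp only [mem_univ, mem_insert, mem_singleton, true_iff]
      by_cases hv : v ∈ W
      · rw [hWxy] at hv
        simp only [mem_insert, mem_singleton] at hv
        exact hv.elim Or.inl fun hv => Or.inr (Or.inl hv)
      · rw [← mem_compl, hz] at hv
        simp only [mem_insert, mem_singleton] at hv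
        exact Or.inr (Or.inr hv)
    · refine four_types hx hy hzt hwt ?_
      change val x + val y + (val z + val w) ≤ 24
      omega

end IsExtremal

end Numeric

end SignedMap

/-! ### Triangles and the boundary walk of the positive subgraph -/

namespace SignedMap

variable {V D : Type*} (M : SignedMap V D)

section Puzzle
set_option linter.unusedSectionVars false
open scoped Classical
open Finset
variable [Fintype D]

/-! ### Triangles -/

/-- Passing to the opposite dart, as a permutation. -/
def oppPerm : Equiv.Perm D := Function.Involutive.toPerm M.opp M.opp_opp

@[simp] lemma oppPerm_apply (d : D) : M.oppPerm d = M.opp d := rfl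

lemma opp_injective : Function.Injective M.opp := M.oppPerm.injective

variable {M} in
-- Along a positive edge the right side becomes the left side seen from the other end. Hence `a ↦
-- opp (next P a)` follows the boundary of a face through left flags only; all later combinatorics
-- is about this permutation.
lemma faceNext_mem_region {P : Set D} (hpos : ∀ d ∈ P, M.pos d = true) {a : D} (ha : a ∈ P) :
    (M.opp (M.next P a), true) ∈ M.region P (a, true) := by
  have hS := M.isClosed_region P (a, true)
  have h1 := hS.along _ ((hS.next_mem_iff ha).2 (M.mem_region_self _ _))
  simpa [SignedMap.along, hpos _ (M.next_mem ha)] using h1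

variable {M} in
/-- A disk face with three positive sides. -/
lemma faceNext_triple {P : Set D} (hP : M.IsEdgeSet P) (hpos : ∀ d ∈ P, M.pos d = true) {a : D}
    (ha : a ∈ P) (h1 : M.chi P (M.region P (a, true)) = 1)
    (h6 : flagCard P (M.region P (a, true)) = 6) :
    M.opp (M.next P (M.opp (M.next P (M.opp (M.next P a))))) = a := by
  set f : Equiv.Perm D := M.oppPerm * M.next P with hf
  have hfa : ∀ d, f d = M.opp (M.next P d) := fun d => rfl
  have hS := M.isClosed_region P (a, true)
  set A : Finset D := {e | e ∈ P ∧ (e, true) ∈ M.region P (a, true)} with hA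
  have hAmem : ∀ e, e ∈ A ↔ e ∈ P ∧ (e, true) ∈ M.region P (a, true) := fun e => mem_filter_univ e
  have hcard : #A = 3 := by
    have h7 : flagCard P (M.region P (a, true)) = 2 * #A := hS.flagCard_eq
    omega
  have hmaps : ∀ e ∈ A, f e ∈ A := by
    intro e he
    rw [hAmem] at he ⊢
    exact ⟨hP _ (M.next_mem he.1), mem_region_trans he.2 (faceNext_mem_region hpos he.1)⟩
  have hfP : ∀ e, e ∈ P → f.symm e ∈ P := by
    intro e he
    have : f.symm e = (M.next P).symm (M.opp e) := by
      rw [Equiv.symm_apply_eq, hfa, Equiv.apply_symm_apply, M.opp_opp]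
    rw [this]
    exact M.next_symm_mem (hP e he)
  have hzP : ∀ i : ℤ, (f ^ i) a ∈ P := by
    intro i
    induction i with
    | zero => exact ha
    | succ i ih =>
      rw [zpow_add_one, (Commute.self_zpow f _).symm.eq, Equiv.Perm.mul_apply, hfa]
      exact hP _ (M.next_mem ih)
    | pred i ih =>
      rw [zpow_sub_one, (Commute.inv_left (Commute.self_zpow f _)).symm.eq,
        Equiv.Perm.mul_apply]
      exact hfP _ ih
  -- The flags that belong to the orbit of `a` are closed under the boundary walk, and the boundary
  -- of a disk is connected. So the three sides form one cycle of `f`.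
  have hcyc : ∀ e ∈ A, f.SameCycle a e := by
    intro e he
    rw [hAmem] at he
    have := disk_flags_subset hP h1
      (T := {y | (y.2 = true ∧ f.SameCycle a y.1) ∨
        (y.2 = false ∧ f.SameCycle a ((M.next P).symm y.1))}) (Or.inl ⟨rfl, 0, rfl⟩) ha ?_ ?_
      (e, true) he.2 he.1
    · simpa using this
    · rintro ⟨d, b⟩ hd hdP
      rcases hd with ⟨hb, hd⟩ | ⟨hb, hd⟩ <;> simp only at hb hd hdP <;> subst hb
      · right
        refine ⟨by simp [SignedMap.along, hpos d hdP], ?_⟩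
        rw [← Equiv.Perm.sameCycle_apply_right, hfa, Equiv.apply_symm_apply]
        simpa [M.opp_opp] using hd
      · left
        refine ⟨by simp [SignedMap.along, hpos d hdP], ?_⟩
        rw [← Equiv.Perm.sameCycle_apply_right, hfa, Equiv.apply_symm_apply] at hd
        exact hd
    · intro d hd
      simp
  have hon : f.IsCycleOn (A : Set D) := by
    refine ⟨⟨hmaps, f.injective.injOn, ?_⟩, fun d hd e he => (hcyc d hd).symm.trans (hcyc e he)⟩
    exact surjOn_of_injOn_of_card_le f hmaps f.injective.injOn le_rfl
  have := hon.pow_card_apply ((hAmem a).2 ⟨ha, M.mem_region_self _ _⟩)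
  rw [hcard] at this
  exact this

/-! ### The darts at a vertex -/

variable {M} in
-- The labels certify that the darts around a vertex are distinct, in a form suited to automation:
-- different darts have different numbers.
lemma exists_label {P : Set D} {a : D} (ha : a ∈ P) {n : ℕ}
    (hn : #(M.dartsAt P (M.vert a)) = n) :
    ∃ lab : D → ℕ, (∀ i < n, lab ((M.next P ^ i) a) = i) ∧ (M.next P ^ n) a = a ∧
      ∀ e ∈ P, M.vert e = M.vert a → ∃ i < n, (M.next P ^ i) a = e := by
  have hc := M.isCycleOn_next P (M.vert a)
  have ham : a ∈ M.dartsAt P (M.vert a) := mem_dartsAt.2 ⟨ha, rfl⟩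
  have hex : ∀ e ∈ P, M.vert e = M.vert a → ∃ i < n, (M.next P ^ i) a = e := by
    intro e he hev
    rw [← hn]
    exact hc.exists_pow_eq ham (mem_dartsAt.2 ⟨he, hev⟩)
  refine ⟨fun e => if h : ∃ i < n, (M.next P ^ i) a = e then h.choose else 0, fun i hi => ?_,
    hn ▸ hc.pow_card_apply ham, hex⟩
  have h : ∃ j < n, (M.next P ^ j) a = (M.next P ^ i) a := ⟨i, hi, rfl⟩
  simp only
  rw [dif_pos h]
  have h1 := (hc.pow_apply_eq_pow_apply ham).1 h.choose_spec.2
  rw [hn] at h1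
  exact h1.eq_of_lt_of_lt h.choose_spec.1 hi

variable {M} in
lemma cycle_two {P : Set D} {a : D} (ha : a ∈ P) (hn : #(M.dartsAt P (M.vert a)) = 2) :
    ∃ (lab : D → ℕ) (a₁ : D), M.next P a = a₁ ∧ M.next P a₁ = a ∧ lab a = 0 ∧ lab a₁ = 1 ∧
      a₁ ∈ P ∧ M.vert a₁ = M.vert a ∧
      ∀ e ∈ P, M.vert e = M.vert a → e = a ∨ e = a₁ := by
  obtain ⟨lab, h1, h2, h3⟩ := exists_label ha hn
  refine ⟨lab, _, rfl, h2, h1 0 (by norm_num), h1 1 (by norm_num), M.next_mem ha,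
    M.vert_next _ _, fun e he hev => ?_⟩
  obtain ⟨i, hi, rfl⟩ := h3 e he hev
  interval_cases i
  exacts [Or.inl rfl, Or.inr rfl]

variable {M} in
lemma cycle_three {P : Set D} {a : D} (ha : a ∈ P) (hn : #(M.dartsAt P (M.vert a)) = 3) :
    ∃ (lab : D → ℕ) (a₁ a₂ : D), (M.next P a = a₁ ∧ M.next P a₁ = a₂ ∧ M.next P a₂ = a) ∧
      (lab a = 0 ∧ lab a₁ = 1 ∧ lab a₂ = 2) ∧ (a₁ ∈ P ∧ a₂ ∈ P) ∧
      (M.vert a₁ = M.vert a ∧ M.vert a₂ = M.vert a) ∧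
      ∀ e ∈ P, M.vert e = M.vert a → e = a ∨ e = a₁ ∨ e = a₂ := by
  obtain ⟨lab, h1, h2, h3⟩ := exists_label ha hn
  have m1 := M.next_mem ha
  have m2 := M.next_mem m1
  refine ⟨lab, _, _, ⟨rfl, rfl, h2⟩,
    ⟨h1 0 (by norm_num), h1 1 (by norm_num), h1 2 (by norm_num)⟩, ⟨m1, m2⟩,
    ⟨M.vert_next _ _, by simp only [M.vert_next]⟩, fun e he hev => ?_⟩
  obtain ⟨i, hi, rfl⟩ := h3 e he hev
  interval_cases i
  exacts [Or.inl rfl, Or.inr (Or.inl rfl), Or.inr (Or.inr rfl)]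

variable {M} in
lemma cycle_four {P : Set D} {a : D} (ha : a ∈ P) (hn : #(M.dartsAt P (M.vert a)) = 4) :
    ∃ (lab : D → ℕ) (a₁ a₂ a₃ : D),
      (M.next P a = a₁ ∧ M.next P a₁ = a₂ ∧ M.next P a₂ = a₃ ∧ M.next P a₃ = a) ∧
      (lab a = 0 ∧ lab a₁ = 1 ∧ lab a₂ = 2 ∧ lab a₃ = 3) ∧ (a₁ ∈ P ∧ a₂ ∈ P ∧ a₃ ∈ P) ∧
      (M.vert a₁ = M.vert a ∧ M.vert a₂ = M.vert a ∧ M.vert a₃ = M.vert a) ∧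
      ∀ e ∈ P, M.vert e = M.vert a → e = a ∨ e = a₁ ∨ e = a₂ ∨ e = a₃ := by
  obtain ⟨lab, h1, h2, h3⟩ := exists_label ha hn
  have m1 := M.next_mem ha
  have m2 := M.next_mem m1
  have m3 := M.next_mem m2
  refine ⟨lab, _, _, _, ⟨rfl, rfl, rfl, h2⟩,
    ⟨h1 0 (by norm_num), h1 1 (by norm_num), h1 2 (by norm_num), h1 3 (by norm_num)⟩,
    ⟨m1, m2, m3⟩, ⟨M.vert_next _ _, by simp only [M.vert_next], by simp only [M.vert_next]⟩,
    fun e he hev => ?_⟩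
  obtain ⟨i, hi, rfl⟩ := h3 e he hev
  interval_cases i
  exacts [Or.inl rfl, Or.inr (Or.inl rfl), Or.inr (Or.inr (Or.inl rfl)),
    Or.inr (Or.inr (Or.inr rfl))]

variable {M} in
lemma cycle_five {P : Set D} {a : D} (ha : a ∈ P) (hn : #(M.dartsAt P (M.vert a)) = 5) :
    ∃ (lab : D → ℕ) (a₁ a₂ a₃ a₄ : D),
      (M.next P a = a₁ ∧ M.next P a₁ = a₂ ∧ M.next P a₂ = a₃ ∧ M.next P a₃ = a₄ ∧
        M.next P a₄ = a) ∧
      (lab a = 0 ∧ lab a₁ = 1 ∧ lab a₂ = 2 ∧ lab a₃ = 3 ∧ lab a₄ = 4) ∧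
      (a₁ ∈ P ∧ a₂ ∈ P ∧ a₃ ∈ P ∧ a₄ ∈ P) ∧
      (M.vert a₁ = M.vert a ∧ M.vert a₂ = M.vert a ∧ M.vert a₃ = M.vert a ∧
        M.vert a₄ = M.vert a) ∧
      ∀ e ∈ P, M.vert e = M.vert a → e = a ∨ e = a₁ ∨ e = a₂ ∨ e = a₃ ∨ e = a₄ := by
  obtain ⟨lab, h1, h2, h3⟩ := exists_label ha hn
  have m1 := M.next_mem ha
  have m2 := M.next_mem m1
  have m3 := M.next_mem m2
  have m4 := M.next_mem m3
  refine ⟨lab, _, _, _, _, ⟨rfl, rfl, rfl, rfl, h2⟩,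
    ⟨h1 0 (by norm_num), h1 1 (by norm_num), h1 2 (by norm_num), h1 3 (by norm_num),
      h1 4 (by norm_num)⟩, ⟨m1, m2, m3, m4⟩, ⟨M.vert_next _ _, by simp only [M.vert_next],
      by simp only [M.vert_next], by simp only [M.vert_next]⟩, fun e he hev => ?_⟩
  obtain ⟨i, hi, rfl⟩ := h3 e he hev
  interval_cases i
  exacts [Or.inl rfl, Or.inr (Or.inl rfl), Or.inr (Or.inr (Or.inl rfl)),
    Or.inr (Or.inr (Or.inr (Or.inl rfl))), Or.inr (Or.inr (Or.inr (Or.inr rfl)))]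

/-- What is left to know about the positive edges of an extremal graph when all faces of the
subgraph of the positive edges are triangles, annuli and Moebius bands. -/
structure IsTight (G : Set D) : Prop extends M.IsExtremal G where
  chi_zero : ∀ a ∈ M.wild (M.posPart G),
    M.chi (M.posPart G) (M.region (M.posPart G) (a, true)) = 0
  triangle : ∀ a ∈ M.posPart G, a ∉ M.wild (M.posPart G) →
    M.opp (M.next (M.posPart G) (M.opp (M.next (M.posPart G)
      (M.opp (M.next (M.posPart G) a))))) = a
  two_le : ∀ v, 2 ≤ M.posDegree G v

variable {M} in
-- The hypothesis `heq`, together with `χ = 0` of the wild part, is the case of equality in the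
-- central inequality, so corners that are not wild belong to triangles.
lemma IsExtremal.isTight {G : Set D} (h : M.IsExtremal G)
    (h0 : M.chi (M.posPart G) (M.wildPart (M.posPart G)) = 0)
    (heq : 6 * Nat.card V ≤ (M.posPart G).ncard + 2 * #(M.wild (M.posPart G)))
    (h2 : ∀ v, 2 ≤ M.posDegree G v) : M.IsTight G := by
  refine ⟨h, fun a ha => h.chi_eq_zero h0 ha, fun a ha haw => ?_, h2⟩
  have h1 : M.chi (M.posPart G) (M.region (M.posPart G) (a, true)) = 1 :=
    (M.chi_eq_one_or_le h.isEdgeSet_pos (a, true)).resolve_right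
      fun hle => haw (mem_wild.2 ⟨ha, hle⟩)
  refine faceNext_triple h.isEdgeSet_pos (fun d hd => hd.2) ha h1 ?_
  refine (h.noSmallDisks_of_subset (M.posPart_subset G)).triangle h.klein h.isEdgeSet_pos ?_ h1
  rw [h0]
  have : ((6 * Nat.card V : ℕ) : ℚ) ≤ ((M.posPart G).ncard + 2 * #(M.wild (M.posPart G)) : ℕ) := by
    exact_mod_cast heq
  push_cast at this
  linarith

namespace IsTight
variable {M} {G : Set D}

lemma faceNext_wild (h : M.IsTight G) {a : D} (ha : a ∈ M.wild (M.posPart G)) :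
    M.opp (M.next (M.posPart G) a) ∈ M.wild (M.posPart G) := by
  rw [mem_wild] at ha ⊢
  refine ⟨h.isEdgeSet_pos _ (M.next_mem ha.1), ?_⟩
  rw [region_eq (faceNext_mem_region (fun d hd => hd.2) ha.1)]
  exact ha.2

lemma wild_subset {a : D} (ha : a ∈ M.wild (M.posPart G)) : a ∈ M.posPart G := (mem_wild.1 ha).1

lemma region_faceNext {a b : D} (ha : a ∈ M.wild (M.posPart G))
    (hb : M.opp (M.next (M.posPart G) a) = b) :
    M.region (M.posPart G) (b, true) = M.region (M.posPart G) (a, true) := by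
  subst hb
  exact region_eq (faceNext_mem_region (fun d hd => hd.2) (wild_subset ha))

/-- Vertices with a negative loop and a single corner outside the triangles lie on different
faces. -/
lemma region_ne (h : M.IsTight G) {a a' : D} (ha : a ∈ M.wild (M.posPart G))
    (ha' : a' ∈ M.wild (M.posPart G)) (hv : M.vert a ≠ M.vert a')
    (hl : 0 < (M.negLoops G (M.vert a)).ncard) (hl' : 0 < (M.negLoops G (M.vert a')).ncard)
    (hn : #(M.wildAt (M.posPart G) (M.vert a)) = 1)
    (hn' : #(M.wildAt (M.posPart G) (M.vert a')) = 1) :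
    M.region (M.posPart G) (a', true) ≠ M.region (M.posPart G) (a, true) := by
  intro heq
  obtain ⟨l, -, hl1, hl2, hl3⟩ := IsExtremal.exists_loop hl
  obtain ⟨l', -, hl1', hl2', hl3'⟩ := IsExtremal.exists_loop hl'
  have := M.chi_le_of_loops h.isEdgeSet_pos (wild_subset ha) (wild_subset ha') hl3 hl3' hv
    (h.inCorner_of_card_eq_one hn ha hl3 hl1)
    (h.inCorner_of_card_eq_one hn ha (by rw [M.pos_opp, hl3]) hl2)
    (h.inCorner_of_card_eq_one hn' ha' hl3' hl1')
    (h.inCorner_of_card_eq_one hn' ha' (by rw [M.pos_opp, hl3']) hl2')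
    (heq ▸ M.mem_region_self _ _)
  rw [h.chi_zero a ha] at this
  norm_num at this

/-- A vertex of positive degree three does not have a face of its own. -/
lemma faceNext_ne (h : M.IsTight G) {a a₁ a₂ : D}
    (h1 : M.next (M.posPart G) a₁ = a₂) (h2 : M.next (M.posPart G) a₂ = a)
    (m1 : a₁ ∈ M.posPart G) (m2 : a₂ ∈ M.posPart G) (w1 : a₁ ∉ M.wild (M.posPart G)) :
    M.opp a₁ ≠ a := by
  intro ho
  have ht := h.triangle a₁ m1 w1
  rw [h1] at ht
  -- If `a` and `a₁` were the ends of one loop, the triangle at `a₁` would have both other sides on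
  -- the edge of `a₂`, and `opp a₂` would be the only positive dart at its vertex.
  have e1 : M.next (M.posPart G) (M.opp (M.next (M.posPart G) (M.opp a₂))) = a := by
    rw [← ho, ← ht, M.opp_opp]
  have e2 : M.opp (M.next (M.posPart G) (M.opp a₂)) = a₂ := by
    apply (M.next (M.posPart G)).injective
    rw [e1, h2]
  have e3 : M.next (M.posPart G) (M.opp a₂) = M.opp a₂ := by
    conv_rhs => rw [← e2, M.opp_opp]
  have hc := M.isCycleOn_next (M.posPart G) (M.vert (M.opp a₂))
  have hm : M.opp a₂ ∈ M.dartsAt (M.posPart G) (M.vert (M.opp a₂)) :=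
    mem_dartsAt.2 ⟨h.isEdgeSet_pos _ m2, rfl⟩
  have hd := (hc.pow_apply_eq hm (n := 1)).1 e3
  have := h.two_le (M.vert (M.opp a₂))
  rw [posDegree_eq] at this
  have := Nat.le_of_dvd one_pos hd
  omega

/-- The two triangles at a vertex of positive degree three which shares its face with another
vertex. -/
lemma consecutive (h : M.IsTight G) {a a₁ a₂ b b₁ b₂ b' : D}
    (h1 : M.next (M.posPart G) a₁ = a₂) (h2 : M.next (M.posPart G) a₂ = a)
    (k1 : M.next (M.posPart G) b₁ = b₂) (k2 : M.next (M.posPart G) b' = b)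
    (m1 : a₁ ∈ M.posPart G) (m2 : a₂ ∈ M.posPart G)
    (w1 : a₁ ∉ M.wild (M.posPart G)) (w2 : a₂ ∉ M.wild (M.posPart G))
    (o1 : M.opp a₁ = b) (o2 : M.opp b₁ = a) :
    M.next (M.posPart G) (M.opp b₂) = M.opp a₂ ∧
      M.next (M.posPart G) (M.opp a₂) = M.opp b' := by
  have t1 := h.triangle a₁ m1 w1
  have t2 := h.triangle a₂ m2 w2
  rw [h1] at t1
  rw [h2, ← o2, M.opp_opp, k1] at t2
  constructor
  · rw [← M.opp_opp (M.next (M.posPart G) (M.opp b₂)), t2]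
  · have e1 : M.next (M.posPart G) (M.opp (M.next (M.posPart G) (M.opp a₂))) = b := by
      rw [← o1, ← M.opp_opp (M.next _ (M.opp (M.next _ (M.opp a₂)))), t1]
    have e2 : M.opp (M.next (M.posPart G) (M.opp a₂)) = b' := by
      apply (M.next (M.posPart G)).injective
      rw [e1, k2]
    rw [← e2, M.opp_opp]

lemma exists_wildAt_eq {v : V} (hn : #(M.wildAt (M.posPart G) v) = 1) :
    ∃ a, M.vert a = v ∧ a ∈ M.wild (M.posPart G) ∧
      ∀ e ∈ M.wild (M.posPart G), M.vert e = v → e = a := by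
  obtain ⟨a, ha⟩ := card_eq_one.1 hn
  have h1 : a ∈ M.wildAt (M.posPart G) v := by rw [ha]; simp
  rw [mem_wildAt] at h1
  refine ⟨a, h1.2, h1.1, fun e he hev => ?_⟩
  have : e ∈ M.wildAt (M.posPart G) v := mem_wildAt.2 ⟨he, hev⟩
  rw [ha, mem_singleton] at this
  exact this

end IsTight

end Puzzle

end SignedMap

/-! ### Solving for the positive edges -/

namespace SignedMap

variable {V D : Type*} (M : SignedMap V D)

section Solutions
set_option linter.unusedSectionVars false
open scoped Classical
open Finset
variable [Fintype D]

namespace IsTight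
variable {M} {G : Set D}

/-- The darts at a vertex of positive degree three with one corner outside the triangles. -/
lemma exists_three {v : V} (hv : M.HasType G v 3 1) :
    ∃ (lab : D → ℕ) (a a₁ a₂ : D), a ∈ M.wild (M.posPart G) ∧
      (∀ e ∈ M.wild (M.posPart G), M.vert e = v → e = a) ∧
      (M.next (M.posPart G) a = a₁ ∧ M.next (M.posPart G) a₁ = a₂ ∧
        M.next (M.posPart G) a₂ = a) ∧
      (lab a = 0 ∧ lab a₁ = 1 ∧ lab a₂ = 2) ∧
      (a ∈ M.posPart G ∧ a₁ ∈ M.posPart G ∧ a₂ ∈ M.posPart G) ∧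
      (M.vert a = v ∧ M.vert a₁ = v ∧ M.vert a₂ = v) ∧
      (a₁ ∉ M.wild (M.posPart G) ∧ a₂ ∉ M.wild (M.posPart G)) ∧
      ∀ e ∈ M.posPart G, M.vert e = v → e = a ∨ e = a₁ ∨ e = a₂ := by
  obtain ⟨a, rfl, haw, hau⟩ := exists_wildAt_eq hv.2
  obtain ⟨lab, a₁, a₂, hn, hl, hm, hvt, hex⟩ :=
    cycle_three (wild_subset haw) (posDegree_eq (M := M) (G := G) _ ▸ hv.1)
  refine ⟨lab, a, a₁, a₂, haw, hau, hn, hl, ⟨wild_subset haw, hm⟩, ⟨rfl, hvt⟩, ⟨fun hw => ?_, fun hw => ?_⟩, hex⟩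
  · have := hau _ hw hvt.1
    rw [this] at hl
    omega
  · have := hau _ hw hvt.2
    rw [this] at hl
    omega

lemma exists_five {v : V} (hv : M.HasType G v 5 1) :
    ∃ (lab : D → ℕ) (a a₁ a₂ a₃ a₄ : D), a ∈ M.wild (M.posPart G) ∧
      (∀ e ∈ M.wild (M.posPart G), M.vert e = v → e = a) ∧
      (M.next (M.posPart G) a = a₁ ∧ M.next (M.posPart G) a₁ = a₂ ∧
        M.next (M.posPart G) a₂ = a₃ ∧ M.next (M.posPart G) a₃ = a₄ ∧
        M.next (M.posPart G) a₄ = a) ∧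
      (lab a = 0 ∧ lab a₁ = 1 ∧ lab a₂ = 2 ∧ lab a₃ = 3 ∧ lab a₄ = 4) ∧
      (a ∈ M.posPart G ∧ a₁ ∈ M.posPart G ∧ a₂ ∈ M.posPart G ∧ a₃ ∈ M.posPart G ∧
        a₄ ∈ M.posPart G) ∧
      (M.vert a = v ∧ M.vert a₁ = v ∧ M.vert a₂ = v ∧ M.vert a₃ = v ∧ M.vert a₄ = v) ∧
      ∀ e ∈ M.posPart G, M.vert e = v → e = a ∨ e = a₁ ∨ e = a₂ ∨ e = a₃ ∨ e = a₄ := by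
  obtain ⟨a, rfl, haw, hau⟩ := exists_wildAt_eq hv.2
  obtain ⟨lab, a₁, a₂, a₃, a₄, hn, hl, hm, hvt, hex⟩ :=
    cycle_five (wild_subset haw) (posDegree_eq (M := M) (G := G) _ ▸ hv.1)
  exact ⟨lab, a, a₁, a₂, a₃, a₄, haw, hau, hn, hl, ⟨wild_subset haw, hm⟩, ⟨rfl, hvt⟩, hex⟩

/-- The only positive edge at `x` turns out to be a loop, with ends `p` and `q`, and the wild darts
`a` and `b` are exchanged by the boundary walk. The triangles at `y` then ask for `opp b₂`, `opp
a₂`, `opp b₄` to be consecutive, and no pairing of the remaining darts allows this. -/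
lemma not_types_two_three_five (h : M.IsTight G) {x y z : V}
    (huniv : ∀ v, v = x ∨ v = y ∨ v = z) (hx : M.HasType G x 2 2)
    (hy : M.HasType G y 3 1) (hz : M.HasType G z 5 1) : False := by
  obtain ⟨la, a, a₁, a₂, haw, hau, ⟨a01, a12, a20⟩, ⟨la0, la1, la2⟩, ⟨ma, ma1, ma2⟩,
    ⟨va, va1, va2⟩, ⟨wa1, wa2⟩, hae⟩ := exists_three hy
  obtain ⟨lb, b, b₁, b₂, b₃, b₄, hbw, hbu, ⟨b01, b12, b23, b34, b40⟩,
    ⟨lb0, lb1, lb2, lb3, lb4⟩, ⟨mb, mb1, mb2, mb3, mb4⟩, ⟨vb, vb1, vb2, vb3, vb4⟩, hbe⟩ :=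
    exists_five hz
  obtain ⟨p, q, hpq, hpqw⟩ := card_eq_two.1 hx.2
  have hp : p ∈ M.wildAt (M.posPart G) x := by rw [hpqw]; simp
  have hq : q ∈ M.wildAt (M.posPart G) x := by rw [hpqw]; simp
  have hp' := mem_wildAt.1 hp
  have hq' := mem_wildAt.1 hq
  have hxw : ∀ e ∈ M.wild (M.posPart G), M.vert e = x → e = p ∨ e = q := by
    intro e he hev
    have : e ∈ M.wildAt (M.posPart G) x := mem_wildAt.2 ⟨he, hev⟩
    rw [hpqw] at this
    simpa using this
  obtain ⟨lp, q', hpn, hqn, lp0, lq0, -, vq', hpe⟩ :=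
    cycle_two (wild_subset hp'.1) (posDegree_eq (M := M) (G := G) _ ▸ (hp'.2 ▸ hx.1))
  have hqq : q = q' := (hpe q (wild_subset hq'.1) (hq'.2.trans hp'.2.symm)).resolve_left hpq.symm
  subst hqq
  have hw : ∀ e ∈ M.wild (M.posPart G), e = p ∨ e = q ∨ e = a ∨ e = b := by
    intro e he
    rcases huniv (M.vert e) with hv | hv | hv
    · exact (hxw e he hv).elim Or.inl fun h => Or.inr (Or.inl h)
    · exact Or.inr (Or.inr (Or.inl (hau e he hv)))
    · exact Or.inr (Or.inr (Or.inr (hbu e he hv)))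
  have hP : ∀ e ∈ M.posPart G, e = p ∨ e = q ∨ e = a ∨ e = a₁ ∨ e = a₂ ∨ e = b ∨ e = b₁ ∨
      e = b₂ ∨ e = b₃ ∨ e = b₄ := by
    intro e he
    rcases huniv (M.vert e) with hv | hv | hv
    · have := hpe e he (hv.trans hp'.2.symm)
      grind
    · have := hae e he hv
      grind
    · have := hbe e he hv
      grind
  have fa := hw _ (h.faceNext_wild haw)
  have fb := hw _ (h.faceNext_wild hbw)
  have fp := hw _ (h.faceNext_wild hp'.1)
  have fq := hw _ (h.faceNext_wild hq'.1)
  rw [a01] at fa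
  rw [b01] at fb
  rw [hpn] at fp
  rw [hqn] at fq
  have hne := h.faceNext_ne a12 a20 ma1 ma2 wa1
  have hoo := M.opp_opp
  have hon := M.opp_ne
  have vp := hp'.2
  have vq := hq'.2
  have hopq : M.opp q = p := by grind
  have hoa : M.opp a₁ = b := by grind
  have hob : M.opp b₁ = a := by grind
  obtain ⟨k1, k2⟩ := h.consecutive a12 a20 b12 b40 ma1 ma2 wa1 wa2 hoa hob
  have oa2 := hP _ (h.isEdgeSet_pos _ ma2)
  have ob2 := hP _ (h.isEdgeSet_pos _ mb2)
  grind

/-- The boundary walk leads from the wild dart at `x` neither back to itself nor to the one at `y`,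
which is on another face, so it leads to the one at `z`. The same holds with `x` and `y` exchanged,
against injectivity. -/
lemma not_types_three_three_six (h : M.IsTight G) {x y z : V} (hxy : x ≠ y)
    (huniv : ∀ v, v = x ∨ v = y ∨ v = z)
    (hlx : 0 < (M.negLoops G x).ncard) (hly : 0 < (M.negLoops G y).ncard)
    (hx : M.HasType G x 3 1)
    (hy : M.HasType G y 3 1) (hz : M.HasType G z 6 1) : False := by
  obtain ⟨la, a, a₁, a₂, haw, hau, ⟨a01, a12, a20⟩, -, ⟨ma, ma1, ma2⟩,
    ⟨va, va1, va2⟩, ⟨wa1, wa2⟩, -⟩ := exists_three hx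
  obtain ⟨lb, b, b₁, b₂, hbw, hbu, ⟨b01, b12, b20⟩, -, ⟨mb, mb1, mb2⟩,
    ⟨vb, vb1, vb2⟩, ⟨wb1, wb2⟩, -⟩ := exists_three hy
  obtain ⟨c, vc, hcw, hcu⟩ := exists_wildAt_eq hz.2
  have hw : ∀ e ∈ M.wild (M.posPart G), e = a ∨ e = b ∨ e = c := by
    intro e he
    rcases huniv (M.vert e) with hv | hv | hv
    · exact Or.inl (hau e he hv)
    · exact Or.inr (Or.inl (hbu e he hv))
    · exact Or.inr (Or.inr (hcu e he hv))
  have hr := h.region_ne haw hbw (by rw [va, vb]; exact hxy) (va.symm ▸ hlx) (vb.symm ▸ hly)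
    (va.symm ▸ hx.2) (vb.symm ▸ hy.2)
  have fa := hw _ (h.faceNext_wild haw)
  have fb := hw _ (h.faceNext_wild hbw)
  have hne := h.faceNext_ne a12 a20 ma1 ma2 wa1
  have hne' := h.faceNext_ne b12 b20 mb1 mb2 wb1
  have hra := region_faceNext haw rfl
  have hrb := region_faceNext hbw rfl
  rw [a01] at fa hra
  rw [b01] at fb hrb
  have hab : a₁ ≠ b₁ := fun e => hxy (va1.symm.trans (e ▸ vb1))
  have := M.opp_injective (a₁ := a₁) (a₂ := b₁)
  grind

/-- The wild dart at `x` lies on another face than the one at `y`, so the walk exchanges the wild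
darts of `y` and `z` and fixes that of `x`. Again the three consecutive darts given by `consecutive`
do not fit any pairing of the rest. -/
lemma not_types_four_three_five (h : M.IsTight G) {x y z : V} (hxy : x ≠ y) (hzx : z ≠ x)
    (huniv : ∀ v, v = x ∨ v = y ∨ v = z)
    (hlx : 0 < (M.negLoops G x).ncard) (hly : 0 < (M.negLoops G y).ncard)
    (hx : M.HasType G x 4 1)
    (hy : M.HasType G y 3 1) (hz : M.HasType G z 5 1) : False := by
  obtain ⟨la, a, a₁, a₂, haw, hau, ⟨a01, a12, a20⟩, ⟨la0, la1, la2⟩, ⟨ma, ma1, ma2⟩,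
    ⟨va, va1, va2⟩, ⟨wa1, wa2⟩, hae⟩ := exists_three hy
  obtain ⟨lb, b, b₁, b₂, b₃, b₄, hbw, hbu, ⟨b01, b12, b23, b34, b40⟩,
    ⟨lb0, lb1, lb2, lb3, lb4⟩, ⟨mb, mb1, mb2, mb3, mb4⟩, ⟨vb, vb1, vb2, vb3, vb4⟩, hbe⟩ :=
    exists_five hz
  obtain ⟨c, vc, hcw, hcu⟩ := exists_wildAt_eq hx.2
  obtain ⟨lc, c₁, c₂, c₃, ⟨c01, c12, c23, c30⟩, ⟨lc0, lc1, lc2, lc3⟩, ⟨mc1, mc2, mc3⟩,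
    ⟨vc1, vc2, vc3⟩, hce⟩ :=
    cycle_four (wild_subset hcw) (posDegree_eq (M := M) (G := G) _ ▸ (vc ▸ hx.1))
  have hw : ∀ e ∈ M.wild (M.posPart G), e = c ∨ e = a ∨ e = b := by
    intro e he
    rcases huniv (M.vert e) with hv | hv | hv
    · exact Or.inl (hcu e he hv)
    · exact Or.inr (Or.inl (hau e he hv))
    · exact Or.inr (Or.inr (hbu e he hv))
  have hP : ∀ e ∈ M.posPart G, e = c ∨ e = c₁ ∨ e = c₂ ∨ e = c₃ ∨ e = a ∨ e = a₁ ∨ e = a₂ ∨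
      e = b ∨ e = b₁ ∨ e = b₂ ∨ e = b₃ ∨ e = b₄ := by
    intro e he
    rcases huniv (M.vert e) with hv | hv | hv
    · have := hce e he (hv.trans vc.symm)
      grind
    · have := hae e he hv
      grind
    · have := hbe e he hv
      grind
  have hr := h.region_ne hcw haw (by rw [va, vc]; exact hxy) (vc.symm ▸ hlx) (va.symm ▸ hly)
    (vc.symm ▸ hx.2) (va.symm ▸ hy.2)
  have fa := hw _ (h.faceNext_wild haw)
  have fb := hw _ (h.faceNext_wild hbw)
  have hra := region_faceNext haw rfl
  have hrb := region_faceNext hbw rfl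
  have hne := h.faceNext_ne a12 a20 ma1 ma2 wa1
  have hoo := M.opp_opp
  have hon := M.opp_ne
  rw [a01] at fa hra
  rw [b01] at fb hrb
  have hoa : M.opp a₁ = b := by grind
  have hob : M.opp b₁ = a := by grind
  have fc := hw _ (h.faceNext_wild hcw)
  rw [c01] at fc
  have hoc : M.opp c₁ = c := by grind
  obtain ⟨k1, k2⟩ := h.consecutive a12 a20 b12 b40 ma1 ma2 wa1 wa2 hoa hob
  have oa2 := hP _ (h.isEdgeSet_pos _ ma2)
  have ob2 := hP _ (h.isEdgeSet_pos _ mb2)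
  have ob4 := hP _ (h.isEdgeSet_pos _ mb4)
  rcases oa2 with oa2 | oa2 | oa2 | oa2 | oa2 | oa2 | oa2 | oa2 | oa2 | oa2 | oa2 | oa2 <;>
    grind (splits := 30)

/-- Two vertices of positive degree three and one of degree four: the positive edges are those of
the second exceptional graph. -/
lemma solution_three (h : M.IsTight G) {x y z : V} (hxy : x ≠ y)
    (hzy : z ≠ y) (huniv : ∀ v, v = x ∨ v = y ∨ v = z)
    (hlx : 0 < (M.negLoops G x).ncard) (hly : 0 < (M.negLoops G y).ncard)
    (hx : M.HasType G x 3 1)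
    (hy : M.HasType G y 3 1) (hz : M.HasType G z 4 2) :
    ∃ a a₁ a₂ b b₁ b₂ c c₁ d d₁ : D,
      (M.vert a = x ∧ M.vert b = y ∧ M.vert c = z ∧ M.vert d = z) ∧
      (a ∈ M.wild (M.posPart G) ∧ b ∈ M.wild (M.posPart G) ∧ c ∈ M.wild (M.posPart G) ∧
        d ∈ M.wild (M.posPart G)) ∧
      (∀ e ∈ M.wild (M.posPart G), e = a ∨ e = b ∨ e = c ∨ e = d) ∧
      (∀ e ∈ M.posPart G, e = a ∨ e = a₁ ∨ e = a₂ ∨ e = b ∨ e = b₁ ∨ e = b₂ ∨ e = c ∨ e = c₁ ∨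
        e = d ∨ e = d₁) ∧
      (M.next (M.posPart G) a = a₁ ∧ M.next (M.posPart G) a₁ = a₂ ∧
        M.next (M.posPart G) a₂ = a) ∧
      (M.next (M.posPart G) b = b₁ ∧ M.next (M.posPart G) b₁ = b₂ ∧
        M.next (M.posPart G) b₂ = b) ∧
      (M.next (M.posPart G) c = c₁ ∧ M.next (M.posPart G) c₁ = d ∧
        M.next (M.posPart G) d = d₁ ∧ M.next (M.posPart G) d₁ = c) ∧
      (M.opp a₁ = c ∧ M.opp c₁ = a ∧ M.opp b₁ = d ∧ M.opp d₁ = b ∧ M.opp a₂ = b₂) ∧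
      M.region (M.posPart G) (c, true) = M.region (M.posPart G) (a, true) ∧
      M.region (M.posPart G) (d, true) = M.region (M.posPart G) (b, true) ∧
      M.region (M.posPart G) (b, true) ≠ M.region (M.posPart G) (a, true) := by
  obtain ⟨la, a, a₁, a₂, haw, hau, ⟨a01, a12, a20⟩, ⟨la0, la1, la2⟩, ⟨ma, ma1, ma2⟩,
    ⟨va, va1, va2⟩, ⟨wa1, wa2⟩, hae⟩ := exists_three hx
  obtain ⟨lb, b, b₁, b₂, hbw, hbu, ⟨b01, b12, b20⟩, ⟨lb0, lb1, lb2⟩, ⟨mb, mb1, mb2⟩,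
    ⟨vb, vb1, vb2⟩, ⟨wb1, wb2⟩, hbe⟩ := exists_three hy
  obtain ⟨p, q, hpq, hpqw⟩ := card_eq_two.1 hz.2
  have hzw : ∀ e ∈ M.wild (M.posPart G), M.vert e = z → e = p ∨ e = q := by
    intro e he hev
    have : e ∈ M.wildAt (M.posPart G) z := mem_wildAt.2 ⟨he, hev⟩
    rw [hpqw] at this
    simpa using this
  have hw' : ∀ e ∈ M.wild (M.posPart G), e = a ∨ e = b ∨ e = p ∨ e = q := by
    intro e he
    rcases huniv (M.vert e) with hv | hv | hv
    · exact Or.inl (hau e he hv)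
    · exact Or.inr (Or.inl (hbu e he hv))
    · exact Or.inr (Or.inr (hzw e he hv))
  have hr := h.region_ne haw hbw (by rw [va, vb]; exact hxy) (va.symm ▸ hlx) (vb.symm ▸ hly)
    (va.symm ▸ hx.2) (vb.symm ▸ hy.2)
  have fa := h.faceNext_wild haw
  have fb := h.faceNext_wild hbw
  have hne := h.faceNext_ne a12 a20 ma1 ma2 wa1
  have hne' := h.faceNext_ne b12 b20 mb1 mb2 wb1
  have hra := region_faceNext haw rfl
  have hrb := region_faceNext hbw rfl
  rw [a01] at fa hra
  rw [b01] at fb hrb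
  have hoo := M.opp_opp
  have hon := M.opp_ne
  have hp : M.vert p = z := (mem_wildAt.1 (hpqw ▸ mem_insert_self p {q} :
    p ∈ M.wildAt (M.posPart G) z)).2
  have hq : M.vert q = z := (mem_wildAt.1 (hpqw ▸ mem_insert_of_mem (mem_singleton_self q) :
    q ∈ M.wildAt (M.posPart G) z)).2
  obtain ⟨c, hc⟩ : ∃ c, M.opp a₁ = c := ⟨_, rfl⟩
  obtain ⟨d, hd⟩ : ∃ d, M.opp b₁ = d := ⟨_, rfl⟩
  rw [hc] at fa hra hne
  rw [hd] at fb hrb hne'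
  -- The vertices `x` and `y` lie on different wild faces, so each of these faces takes one of the
  -- two wild corners at `z`.
  have hcd : c ≠ d := by
    rintro rfl
    exact hr (hrb.symm.trans hra)
  have hca : c = p ∨ c = q := by
    have := hw' c fa
    grind
  have hda : d = p ∨ d = q := by
    have := hw' d fb
    grind
  have vc : M.vert c = z := by rcases hca with rfl | rfl <;> assumption
  have vd : M.vert d = z := by rcases hda with rfl | rfl <;> assumption
  have hw : ∀ e ∈ M.wild (M.posPart G), e = a ∨ e = b ∨ e = c ∨ e = d := by
    intro e he
    have := hw' e he
    grind
  have fc := hw _ (h.faceNext_wild fa)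
  have fd := hw _ (h.faceNext_wild fb)
  have hrc := region_faceNext fa rfl
  have hrd := region_faceNext fb rfl
  obtain ⟨lc, c₁, c₂, c₃, ⟨c01, c12, c23, c30⟩, ⟨lc0, lc1, lc2, lc3⟩, ⟨mc1, mc2, mc3⟩,
    ⟨vc1, vc2, vc3⟩, hce⟩ :=
    cycle_four (wild_subset fa) (posDegree_eq (M := M) (G := G) _ ▸ (vc ▸ hz.1))
  have hoc : M.opp c₁ = a := by
    rw [c01] at fc hrc
    grind
  obtain ⟨d₁, hd1⟩ : ∃ d₁, M.next (M.posPart G) d = d₁ := ⟨_, rfl⟩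
  have hod : M.opp d₁ = b := by
    rw [hd1] at fd hrd
    have hvd := M.vert_next (M.posPart G) d
    grind
  have hdc : d = c₂ := by
    have := hce d (wild_subset fb) (vd.trans vc.symm)
    grind
  subst hdc
  obtain rfl : c₃ = d₁ := c23.symm.trans hd1
  have hP : ∀ e ∈ M.posPart G, e = a ∨ e = a₁ ∨ e = a₂ ∨ e = b ∨ e = b₁ ∨ e = b₂ ∨ e = c ∨
      e = c₁ ∨ e = d ∨ e = c₃ := by
    intro e he
    rcases huniv (M.vert e) with hv | hv | hv
    · have := hae e he hv
      grind
    · have := hbe e he hv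
      grind
    · have := hce e he (hv.trans vc.symm)
      grind
  have oa2 : M.opp a₂ = b₂ := by
    have := hP _ (h.isEdgeSet_pos _ ma2)
    grind
  exact ⟨a, a₁, a₂, b, b₁, b₂, c, c₁, d, c₃, ⟨va, vb, vc, vd⟩, ⟨haw, hbw, fa, fb⟩, hw, hP,
    ⟨a01, a12, a20⟩, ⟨b01, b12, b20⟩, ⟨c01, c12, c23, c30⟩, ⟨hc, hoc, hd, hod, oa2⟩, hra, hrb, hr⟩

/-- Two vertices of positive degree three and two of degree five: the positive edges are those of
the first exceptional graph. -/
lemma solution_four (h : M.IsTight G) {x y z w : V} (hxy : x ≠ y) (hzx : z ≠ x)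
    (hzy : z ≠ y) (hwx : w ≠ x) (hwy : w ≠ y) (hzw : z ≠ w)
    (huniv : ∀ v, v = x ∨ v = y ∨ v = z ∨ v = w)
    (hlx : 0 < (M.negLoops G x).ncard) (hly : 0 < (M.negLoops G y).ncard)
    (hx : M.HasType G x 3 1) (hy : M.HasType G y 3 1) (hz : M.HasType G z 5 1)
    (hw : M.HasType G w 5 1) :
    ∃ a a₁ a₂ b b₁ b₂ b₃ b₄ c c₁ c₂ d d₁ d₂ d₃ d₄ : D,
      (M.vert a = x ∧ M.vert c = y ∧
        (M.vert b = z ∧ M.vert d = w ∨ M.vert b = w ∧ M.vert d = z)) ∧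
      (a ∈ M.wild (M.posPart G) ∧ b ∈ M.wild (M.posPart G) ∧ c ∈ M.wild (M.posPart G) ∧
        d ∈ M.wild (M.posPart G)) ∧
      (∀ e ∈ M.wild (M.posPart G), e = a ∨ e = b ∨ e = c ∨ e = d) ∧
      (∀ e ∈ M.posPart G, e = a ∨ e = a₁ ∨ e = a₂ ∨ e = b ∨ e = b₁ ∨ e = b₂ ∨ e = b₃ ∨ e = b₄ ∨
        e = c ∨ e = c₁ ∨ e = c₂ ∨ e = d ∨ e = d₁ ∨ e = d₂ ∨ e = d₃ ∨ e = d₄) ∧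
      (M.next (M.posPart G) a = a₁ ∧ M.next (M.posPart G) a₁ = a₂ ∧
        M.next (M.posPart G) a₂ = a) ∧
      (M.next (M.posPart G) b = b₁ ∧ M.next (M.posPart G) b₁ = b₂ ∧
        M.next (M.posPart G) b₂ = b₃ ∧ M.next (M.posPart G) b₃ = b₄ ∧
        M.next (M.posPart G) b₄ = b) ∧
      (M.next (M.posPart G) c = c₁ ∧ M.next (M.posPart G) c₁ = c₂ ∧
        M.next (M.posPart G) c₂ = c) ∧
      (M.next (M.posPart G) d = d₁ ∧ M.next (M.posPart G) d₁ = d₂ ∧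
        M.next (M.posPart G) d₂ = d₃ ∧ M.next (M.posPart G) d₃ = d₄ ∧
        M.next (M.posPart G) d₄ = d) ∧
      (M.opp a₁ = b ∧ M.opp b₁ = a ∧ M.opp c₁ = d ∧ M.opp d₁ = c) ∧
      (M.opp b₂ = d₂ ∧ M.opp a₂ = d₃ ∧ M.opp b₄ = d₄ ∧ M.opp c₂ = b₃) ∧
      M.region (M.posPart G) (b, true) = M.region (M.posPart G) (a, true) ∧
      M.region (M.posPart G) (d, true) = M.region (M.posPart G) (c, true) ∧
      M.region (M.posPart G) (c, true) ≠ M.region (M.posPart G) (a, true) := by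
  obtain ⟨la, a, a₁, a₂, haw, hau, ⟨a01, a12, a20⟩, ⟨la0, la1, la2⟩, ⟨ma, ma1, ma2⟩,
    ⟨va, va1, va2⟩, ⟨wa1, wa2⟩, hae⟩ := exists_three hx
  obtain ⟨lc, c, c₁, c₂, hcw, hcu, ⟨c01, c12, c20⟩, ⟨lc0, lc1, lc2⟩, ⟨mc, mc1, mc2⟩,
    ⟨vc, vc1, vc2⟩, ⟨wc1, wc2⟩, hce⟩ := exists_three hy
  have hr := h.region_ne haw hcw (by rw [va, vc]; exact hxy) (va.symm ▸ hlx) (vc.symm ▸ hly)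
    (va.symm ▸ hx.2) (vc.symm ▸ hy.2)
  have hne := h.faceNext_ne a12 a20 ma1 ma2 wa1
  have hne' := h.faceNext_ne c12 c20 mc1 mc2 wc1
  have fa := h.faceNext_wild haw
  have fc := h.faceNext_wild hcw
  have hra := region_faceNext haw rfl
  have hrc := region_faceNext hcw rfl
  rw [a01] at fa hra
  rw [c01] at fc hrc
  have hoo := M.opp_opp
  have hon := M.opp_ne
  -- The wild face at `x` also reaches one of `z` and `w`; the claim is symmetric in them.
  wlog hv : M.vert (M.opp a₁) = z generalizing z w with H
  · have hvw : M.vert (M.opp a₁) = w := by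
      rcases huniv (M.vert (M.opp a₁)) with hv' | hv' | hv' | hv'
      · exact absurd (hau _ fa hv') hne
      · have := hcu _ fa hv'
        rw [this] at hra
        exact absurd hra hr
      · exact absurd hv' hv
      · exact hv'
    obtain ⟨a', b1, b2, b, b1', b2', b3', b4', c', c1', c2', d, d1, d2, d3, d4, hvert, hrest⟩ :=
      H hwx hwy hzx hzy hzw.symm (fun v => by have := huniv v; grind) hw hz hvw
    exact ⟨a', b1, b2, b, b1', b2', b3', b4', c', c1', c2', d, d1, d2, d3, d4,
      ⟨hvert.1, hvert.2.1, hvert.2.2.symm⟩, hrest⟩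
  obtain ⟨lb, b, b₁, b₂, b₃, b₄, hbw, hbu, ⟨b01, b12, b23, b34, b40⟩,
    ⟨lb0, lb1, lb2, lb3, lb4⟩, ⟨mb, mb1, mb2, mb3, mb4⟩, ⟨vb, vb1, vb2, vb3, vb4⟩, hbe⟩ :=
    exists_five hz
  obtain ⟨ld, d, d₁, d₂, d₃, d₄, hdw, hdu, ⟨d01, d12, d23, d34, d40⟩,
    ⟨ld0, ld1, ld2, ld3, ld4⟩, ⟨md, md1, md2, md3, md4⟩, ⟨vd, vd1, vd2, vd3, vd4⟩, hde⟩ :=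
    exists_five hw
  have hwild : ∀ e ∈ M.wild (M.posPart G), e = a ∨ e = b ∨ e = c ∨ e = d := by
    intro e he
    rcases huniv (M.vert e) with hv | hv | hv | hv
    · exact Or.inl (hau e he hv)
    · exact Or.inr (Or.inr (Or.inl (hcu e he hv)))
    · exact Or.inr (Or.inl (hbu e he hv))
    · exact Or.inr (Or.inr (Or.inr (hdu e he hv)))
  have hP : ∀ e ∈ M.posPart G, e = a ∨ e = a₁ ∨ e = a₂ ∨ e = b ∨ e = b₁ ∨ e = b₂ ∨ e = b₃ ∨
      e = b₄ ∨ e = c ∨ e = c₁ ∨ e = c₂ ∨ e = d ∨ e = d₁ ∨ e = d₂ ∨ e = d₃ ∨ e = d₄ := by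
    intro e he
    rcases huniv (M.vert e) with hv | hv | hv | hv
    · have := hae e he hv
      grind
    · have := hce e he hv
      grind
    · have := hbe e he hv
      grind
    · have := hde e he hv
      grind
  have oa1 : M.opp a₁ = b := hbu _ fa hv
  rw [oa1] at hra
  have oc1 : M.opp c₁ = d := by
    have := hwild _ fc
    grind
  rw [oc1] at hrc
  have fb := hwild _ (h.faceNext_wild hbw)
  have fd := hwild _ (h.faceNext_wild hdw)
  have hrb := region_faceNext hbw rfl
  have hrd := region_faceNext hdw rfl
  rw [b01] at fb hrb
  rw [d01] at fd hrd
  have ob1 : M.opp b₁ = a := by grind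
  have od1 : M.opp d₁ = c := by grind
  obtain ⟨k1, k2⟩ := h.consecutive a12 a20 b12 b40 ma1 ma2 wa1 wa2 oa1 ob1
  obtain ⟨k3, k4⟩ := h.consecutive c12 c20 d12 d40 mc1 mc2 wc1 wc2 oc1 od1
  -- The edge of `a₂` must end at a dart of `w` whose two neighbours are free for `b₂` and `b₄`.
  -- This leaves only the middle one of `d₂`, `d₃`, `d₄`.
  have oa2 : M.opp a₂ = d₃ := by
    have := hP _ (h.isEdgeSet_pos _ ma2)
    have := hP _ (h.isEdgeSet_pos _ mb2)
    grind (splits := 30)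
  have ob2 : M.opp b₂ = d₂ := by
    apply (M.next (M.posPart G)).injective
    rw [k1, oa2, d23]
  have ob4 : M.opp b₄ = d₄ := by rw [← k2, oa2, d34]
  have oc2 : M.opp c₂ = b₃ := by
    rw [← M.opp_opp b₃]
    congr 1
    have := hP _ (h.isEdgeSet_pos _ mb3)
    grind (splits := 30)
  exact ⟨a, a₁, a₂, b, b₁, b₂, b₃, b₄, c, c₁, c₂, d, d₁, d₂, d₃, d₄,
    ⟨va, vc, Or.inl ⟨vb, vd⟩⟩, ⟨haw, hbw, hcw, hdw⟩, hwild, hP,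
    ⟨a01, a12, a20⟩, ⟨b01, b12, b23, b34, b40⟩, ⟨c01, c12, c20⟩, ⟨d01, d12, d23, d34, d40⟩,
    ⟨oa1, ob1, oc1, od1⟩, ⟨ob2, oa2, ob4, oc2⟩, hra, hrc, hr⟩

end IsTight
end Solutions
end SignedMap

/-! ### The negative edges in a wild face -/

namespace SignedMap

variable {V D : Type*} (M : SignedMap V D)

section Annuli
set_option linter.unusedSectionVars false
open scoped Classical
open Finset
variable [Fintype D]

variable {M} in
/-- If the estimate of the Euler characteristic is sharp, then no face has more than three sides. -/
lemma NoSmallDisks.flagCard_le {G : Set D} (h : M.NoSmallDisks G) (hG : M.IsEdgeSet G)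
    {S : Set (D × Bool)} (hS : M.IsClosed G S) (heq : (flagCard G S : ℚ) ≤ 6 * M.chi G S)
    {x : D × Bool} (hx : x ∈ S) : flagCard G (M.region G x) ≤ 6 := by
  have hR := M.isClosed_region G x
  have hu : S = M.region G x ∪ (S ∩ (M.region G x)ᶜ) := by
    ext y
    by_cases hy : y ∈ M.region G x
    · simpa [hy] using hS.region_subset hx hy
    · simp [hy]
  have hd : Disjoint (M.region G x) (S ∩ (M.region G x)ᶜ) :=
    Set.disjoint_left.2 fun y hy hy' => hy'.2 hy
  have h1 := h.six_chi_le hG (hS.inter hR.compl)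
  have h2 := M.chi_le_one hG x
  rw [hu, flagCard_union _ hd, M.chi_union _ hd] at heq
  push_cast at heq
  have : (flagCard G (M.region G x) : ℚ) ≤ 6 := by linarith
  exact_mod_cast this

variable {M} in
lemma card_union_edgeFlags {l e : D} (h1 : e ≠ l) (h2 : e ≠ M.opp l) :
    #(M.edgeFlags l ∪ M.edgeFlags e) = 8 := by
  rw [card_union_of_disjoint, card_edgeFlags, card_edgeFlags]
  rw [Finset.disjoint_left]
  intro x hx hx'
  rw [mem_edgeFlags] at hx hx'
  have := M.opp_opp e
  have := M.opp_opp l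
  grind

lemma card_le_flagCard {Q : Set D} {S : Set (D × Bool)} {T : Finset (D × Bool)}
    (h : ∀ x ∈ T, x ∈ S ∧ x.1 ∈ Q) : #T ≤ flagCard Q S :=
  card_le_card fun x hx => (mem_filter_univ x).2 (h x hx)

variable {M} in
lemma eight_le_flagCard {Q : Set D} {S : Set (D × Bool)} {l e : D} (h1 : e ≠ l)
    (h2 : e ≠ M.opp l) (hS : ∀ x, x ∈ M.edgeFlags l ∪ M.edgeFlags e → x ∈ S ∧ x.1 ∈ Q) :
    8 ≤ flagCard Q S := by
  rw [← card_union_edgeFlags h1 h2]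
  exact card_le_flagCard hS

/-- Of the six orders of `l`, `m`, `e` behind `a`, the hypotheses exclude the four in which `e` is
first or last. -/
lemma chain_of_three {g : D → D} {a l m e c : D}
    (m1 : g a = l ∨ g a = m ∨ g a = e) (m2 : g (g a) = l ∨ g (g a) = m ∨ g (g a) = e)
    (m3 : g (g (g a)) = l ∨ g (g (g a)) = m ∨ g (g (g a)) = e) (n12 : g a ≠ g (g a))
    (n13 : g a ≠ g (g (g a))) (n23 : g (g a) ≠ g (g (g a))) (hc : g (g (g (g a))) = c)
    (h1 : ¬ (g a = e ∧ g e = l ∧ g l = m ∧ g m = c) ∧ ¬ (g a = l ∧ g l = m ∧ g m = e ∧ g e = c))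
    (h2 : ¬ (g a = e ∧ g e = m ∧ g m = l ∧ g l = c) ∧ ¬ (g a = m ∧ g m = l ∧ g l = e ∧ g e = c)) :
    (g a = l ∧ g l = e ∧ g e = m ∧ g m = c) ∨ (g a = m ∧ g m = e ∧ g e = l ∧ g l = c) := by
  rcases m1 with m1 | m1 | m1 <;> rw [m1] at m2 m3 n12 n13 n23 hc <;>
    rcases m2 with m2 | m2 | m2 <;> rw [m2] at m3 n12 n13 n23 hc <;>
    rcases m3 with m3 | m3 | m3 <;> rw [m3] at n13 n23 hc <;> grind

/-- The negative edges in an annulus or Moebius band which is bounded by the positive edges of the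
darts `a` and `b`: the loop of `l` and the edge of `e`. -/
structure Core (G : Set D) (a b l e : D) : Prop where
  next_a : M.next G a = l
  next_l : M.next G l = e
  next_e : M.next G e = M.opp l
  next_opp_l : M.next G (M.opp l) = M.next (M.posPart G) a
  next_b : M.next G b = M.opp e
  next_opp_e : M.next G (M.opp e) = M.next (M.posPart G) b
  mem_l : l ∈ G
  mem_e : e ∈ G
  pos_l : M.pos l = false
  pos_e : M.pos e = false
  eq_or : ∀ d ∈ G, M.pos d = false → (d, true) ∈ M.region (M.posPart G) (a, true) →
    d = l ∨ d = M.opp l ∨ d = e ∨ d = M.opp e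

namespace IsTight
variable {M} {G : Set D}

/-- The face has `χ = 0` and two sides. The Euler count for the faces of `G` inside it allows at
most two negative edges; the loop and the edge of `k` are two, so there are no others and no face of
`G` inside has more than three sides. This bound forces the second edge to start between the two
ends of the loop. -/
lemma exists_core (h : M.IsTight G) {a b l k : D} (ha : a ∈ M.posPart G)
    (hb : b ∈ M.posPart G) (hab : M.vert a ≠ M.vert b)
    (hchi : M.chi (M.posPart G) (M.region (M.posPart G) (a, true)) = 0)
    (hR : ∀ d ∈ M.posPart G, (d, true) ∈ M.region (M.posPart G) (a, true) ↔ d = a ∨ d = b)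
    (hoa : M.opp (M.next (M.posPart G) a) = b) (hob : M.opp (M.next (M.posPart G) b) = a)
    (hlG : l ∈ G) (hlpos : M.pos l = false) (hl : M.InCorner (M.posPart G) a l)
    (hl' : M.InCorner (M.posPart G) a (M.opp l)) (hb0 : (M.negLoops G (M.vert b)).ncard = 0)
    (hkG : k ∈ G) (hkpos : M.pos k = false) (hk : M.InCorner (M.posPart G) b k) :
    ∃ l e, M.Core G a b l e := by
  set P := M.posPart G with hP
  set R := M.region P (a, true) with hRdef
  have hRc := M.isClosed_region P (a, true)
  have hPG := M.posPart_subset G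
  have hRG : M.IsClosed G R := hRc.mono hPG
  have hnP : ∀ d, M.pos d = false → d ∉ P := fun d hd hd' => by
    rw [hd'.2] at hd
    exact absurd hd (by decide)
  have haR : (a, true) ∈ R := M.mem_region_self _ _
  have hbR : (b, true) ∈ R := (hR b hb).2 (Or.inr rfl)
  have hkl : k ≠ l := fun e => hab (hl.vert_eq.symm.trans (e ▸ hk.vert_eq))
  have hkl' : k ≠ M.opp l := fun e => hab (hl'.vert_eq.symm.trans (e ▸ hk.vert_eq))
  have hlR : ∀ c, (l, c) ∈ R := fun c => (hRc.inCorner_iff hl c).2 haR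
  have hkR : ∀ c, (k, c) ∈ R := fun c => (hRc.inCorner_iff hk c).2 hbR
  have hfl : ∀ d ∈ G, M.pos d = false → (∀ c, (d, c) ∈ R) →
      ∀ x ∈ M.edgeFlags d, x ∈ R ∧ x.1 ∈ G \ P := by
    intro d hd hdp hdR x hx
    refine ⟨hRc.edgeFlags_subset hdR x hx, ?_⟩
    rcases M.mem_edgeFlags.1 hx with e | e <;> rw [e]
    · exact ⟨hd, hnP _ hdp⟩
    · exact ⟨h.isEdgeSet _ hd, hnP _ (by rw [M.pos_opp, hdp])⟩
  have h8 : 8 ≤ flagCard (G \ P) R := eight_le_flagCard hkl hkl' fun x hx => by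
    rcases mem_union.1 hx with hx | hx
    · exact hfl l hlG hlpos hlR x hx
    · exact hfl k hkG hkpos hkR x hx
  have h4 : flagCard P R = 4 := by
    have h5 := hRc.flagCard_eq
    have : ({d | d ∈ P ∧ (d, true) ∈ R} : Finset D) = {a, b} := by
      ext d
      rw [mem_filter_univ, mem_insert, mem_singleton]
      constructor
      · exact fun hd => (hR d hd.1).1 hd.2
      · exact fun hd => (hd.elim (fun e => ⟨e ▸ ha, e ▸ haR⟩) fun e => ⟨e ▸ hb, e ▸ hbR⟩)
    rw [h5]
    have h6 : #({d | d ∈ P ∧ (d, true) ∈ R} : Finset D) = 2 := by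
      rw [this, card_pair fun e => hab (congrArg M.vert e)]
    convert congrArg (2 * ·) h6
  have hle := h.noSmallDisks.six_chi_le h.isEdgeSet hRG
  have hcd := M.chi_diff hPG R
  have hfd := flagCard_diff hPG R
  rw [hchi] at hcd
  rw [h4] at hfd
  -- With `m` flags of negative edges, the estimate is `6 (0 + m / 4) ≤ 4 + m`.
  have h8' : flagCard (G \ P) R ≤ 8 := by
    rw [hcd, hfd] at hle
    push_cast at hle
    have : (flagCard (G \ P) R : ℚ) ≤ 8 := by linarith
    exact_mod_cast this
  have h8eq : flagCard (G \ P) R = 8 := le_antisymm h8' h8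
  -- For `m = 8` the estimate is an equality.
  have h6 : ∀ x ∈ R, flagCard G (M.region G x) ≤ 6 := fun x hx => by
    refine h.noSmallDisks.flagCard_le h.isEdgeSet hRG ?_ hx
    rw [hcd, hfd, h8eq]
    norm_num
  have hall : ∀ d ∈ G, M.pos d = false → (d, true) ∈ R →
      d = l ∨ d = M.opp l ∨ d = k ∨ d = M.opp k := by
    intro d hd hdp hdR
    by_contra! hne
    have hdR' : ∀ c, (d, c) ∈ R := fun c => by
      cases c
      · exact (hRc.cross_iff (y := (d, true)) (hnP _ hdp)).2 hdR
      · exact hdR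
    have hdisj : Disjoint (M.edgeFlags l ∪ M.edgeFlags k) (M.edgeFlags d) := by
      rw [Finset.disjoint_left]
      intro x hx hx'
      rw [mem_union, mem_edgeFlags, mem_edgeFlags] at hx
      rw [mem_edgeFlags] at hx'
      have := M.opp_opp d
      have := M.opp_opp l
      have := M.opp_opp k
      grind
    have h12 : #((M.edgeFlags l ∪ M.edgeFlags k) ∪ M.edgeFlags d) ≤ flagCard (G \ P) R := by
      refine card_le_flagCard fun x hx => ?_
      rcases mem_union.1 hx with hx | hx
      · rcases mem_union.1 hx with hx | hx
        · exact hfl l hlG hlpos hlR x hx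
        · exact hfl k hkG hkpos hkR x hx
      · exact hfl d hd hdp hdR' x hx
    rw [card_union_of_disjoint hdisj, card_union_edgeFlags hkl hkl', card_edgeFlags] at h12
    omega
  set e := M.opp k with he
  have hek : M.opp e = k := M.opp_opp k
  have heG : e ∈ G := h.isEdgeSet _ hkG
  have hepos : M.pos e = false := by rw [he, M.pos_opp, hkpos]
  have heR : (e, true) ∈ R := by
    have := hRc.along _ (hkR true)
    simpa [SignedMap.along, hkpos] using this
  have hvk : M.vert k = M.vert b := hk.vert_eq
  have heb : M.vert e ≠ M.vert b := by
    intro hv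
    have : M.edge k ∈ M.negLoops G (M.vert b) := ⟨k, ⟨hkG, hvk, hv, hkpos⟩, rfl⟩
    rw [Set.ncard_eq_zero (Set.toFinite _)] at hb0
    rw [hb0] at this
    exact this
  -- The other end of `k` lies in a wild corner of the same face, so behind `a` or behind `b`; the
  -- latter would make its edge a negative loop at the vertex of `b`.
  have hec : M.InCorner P a e := by
    have hex : ∃ a' ∈ P, M.vert a' = M.vert e := by
      have h2 := h.two_le (M.vert e)
      rw [posDegree_eq] at h2
      obtain ⟨a₀, ha₀⟩ := card_pos.1 (lt_of_lt_of_le two_pos h2)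
      exact ⟨a₀, mem_dartsAt.1 ha₀⟩
    obtain ⟨a₀, ha₀, hv₀⟩ := hex
    obtain ⟨a', ha', hc⟩ := h.exists_wild hepos ha₀ hv₀
    have ha'P := (mem_wild.1 (mem_wildAt.1 ha').1).1
    rcases (hR a' ha'P).1 ((hRc.inCorner_iff hc true).1 heR) with rfl | rfl
    · exact hc
    · exact absurd hc.vert_eq heb
  have hel : e ≠ l := fun h' => hkl' (by rw [← hek, h'])
  have hel' : e ≠ M.opp l := fun h' => hkl (by rw [← hek, h', M.opp_opp])
  -- the darts in the two corners
  obtain ⟨p1, p2, p3⟩ := M.corner_enum hPG ha {l, M.opp l, e} fun d => by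
    rw [mem_insert, mem_insert, mem_singleton]
    constructor
    · rintro (rfl | rfl | rfl)
      exacts [⟨hlG, hl⟩, ⟨h.isEdgeSet _ hlG, hl'⟩, ⟨heG, hec⟩]
    · rintro ⟨hd, hc⟩
      have hdp : M.pos d = false := by
        by_contra hp
        exact hc.notMem ⟨hd, by simpa using hp⟩
      have hvd : M.vert d = M.vert a := hc.vert_eq
      rcases hall d hd hdp ((hRc.inCorner_iff hc true).2 haR) with h' | h' | h' | h'
      · exact Or.inl h'
      · exact Or.inr (Or.inl h')
      · exact absurd (hvd.symm.trans (h' ▸ hvk)) hab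
      · exact Or.inr (Or.inr h')
  obtain ⟨q1, q2, -⟩ := M.corner_enum hPG hb {k} fun d => by
    rw [mem_singleton]
    constructor
    · rintro rfl
      exact ⟨hkG, hk⟩
    · rintro ⟨hd, hc⟩
      have hdp : M.pos d = false := by
        by_contra hp
        exact hc.notMem ⟨hd, by simpa using hp⟩
      have hvd : M.vert d = M.vert b := hc.vert_eq
      rcases hall d hd hdp ((hRc.inCorner_iff hc true).2 hbR) with h' | h' | h' | h'
      · exact absurd (hl.vert_eq.symm.trans (h' ▸ hvd)) hab
      · exact absurd (hl'.vert_eq.symm.trans (h' ▸ hvd)) hab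
      · exact h'
      · exact absurd (h' ▸ hvd) heb
  have hc3 : #({l, M.opp l, e} : Finset D) = 3 := by
    rw [card_insert_of_notMem, card_pair hel'.symm]
    rw [mem_insert, mem_singleton]
    exact not_or.2 ⟨(M.opp_ne l).symm, hel.symm⟩
  rw [hc3] at p1 p2 p3
  rw [card_singleton] at q1 q2
  have e2 : ∀ x, (M.next G ^ 2) x = M.next G (M.next G x) := fun x => rfl
  have e3 : ∀ x, (M.next G ^ 3) x = M.next G (M.next G (M.next G x)) := fun x => rfl
  have e4 : ∀ x, (M.next G ^ 4) x = M.next G (M.next G (M.next G (M.next G x))) := fun x => rfl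
  have m1 := p1 1 (by norm_num) (by norm_num)
  have m2 := p1 2 (by norm_num) (by norm_num)
  have m3 := p1 3 (by norm_num) (by norm_num)
  have n12 := p3 1 2 (by norm_num) (by norm_num) (by norm_num)
  have n13 := p3 1 3 (by norm_num) (by norm_num) (by norm_num)
  have n23 := p3 2 3 (by norm_num) (by norm_num) (by norm_num)
  have r1 := q1 1 (by norm_num) (by norm_num)
  simp only [Nat.reduceAdd, e2, e3, e4, pow_one, mem_insert, mem_singleton] at m1 m2 m3 n12 n13 n23 p2 r1 q2
  rw [r1] at q2
  -- a face with too many sides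
  have hbig : ∀ m : D, m ∈ G → M.pos m = false → e ≠ m → e ≠ M.opp m →
      (∀ c, (m, c) ∈ M.region G (a, true)) → (∀ c, (e, c) ∈ M.region G (a, true)) → False := by
    intro m hmG hmp hem hem' hmR heR'
    have hS := M.isClosed_region G (a, true)
    have := eight_le_flagCard (Q := G) hem hem' fun x hx => by
      rcases mem_union.1 hx with hx | hx
      · refine ⟨hS.edgeFlags_subset hmR x hx, ?_⟩
        rcases M.mem_edgeFlags.1 hx with e' | e' <;> rw [e']
        exacts [hmG, h.isEdgeSet _ hmG]
      · refine ⟨hS.edgeFlags_subset heR' x hx, ?_⟩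
        rcases M.mem_edgeFlags.1 hx with e' | e' <;> rw [e']
        exacts [heG, h.isEdgeSet _ heG]
    have := h6 _ haR
    omega
  have hS := M.isClosed_region G (a, true)
  have haS : (a, true) ∈ M.region G (a, true) := M.mem_region_self _ _
  have hal : ∀ d c, M.pos d = false → (d, c) ∈ M.region G (a, true) →
      (M.opp d, c) ∈ M.region G (a, true) := by
    intro d c hd hdR
    have := hS.along _ hdR
    simpa [SignedMap.along, hd] using this
  have halp : ∀ d c, M.pos d = true → (d, c) ∈ M.region G (a, true) →
      (M.opp d, !c) ∈ M.region G (a, true) := by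
    intro d c hd hdR
    have := hS.along _ hdR
    simpa [SignedMap.along, hd] using this
  have hnx : ∀ d d', d ∈ G → M.next G d = d' →
      ((d', false) ∈ M.region G (a, true) ↔ (d, true) ∈ M.region G (a, true)) := by
    rintro d _ hd rfl
    exact hS.next_mem_iff hd
  have haG := hPG ha
  have hbG := hPG hb
  have hcross : (e, false) ∈ M.region G (a, true) →
      (M.next P a, false) ∈ M.region G (a, true) := by
    intro h1
    have h2 := hal _ _ hepos h1
    rw [hek] at h2
    have h3 := (hnx b k hbG r1).1 h2
    have h4 := halp _ _ hb.2 h3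
    rwa [← hoa, M.opp_opp] at h4
  have hcross' : (M.next P b, false) ∈ M.region G (a, true) := by
    have h1 : M.next P b = M.opp a := by rw [← hob, M.opp_opp]
    rw [h1]
    exact halp _ _ ha.2 haS
  have het : (e, true) ∈ M.region G (a, true) := by
    have := (hnx k _ hkG q2).1 hcross'
    exact hal _ _ hkpos this
  -- If `e` came before or after both ends of the loop, the boundary walk from `a` would run along
  -- both sides of the loop and of `e`, giving a face with at least eight flags on its sides.
  have horder : ∀ m ∈ G, M.pos m = false → e ≠ m → e ≠ M.opp m →
      ¬ (M.next G a = e ∧ M.next G e = m ∧ M.next G m = M.opp m ∧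
        M.next G (M.opp m) = M.next P a) ∧
      ¬ (M.next G a = m ∧ M.next G m = M.opp m ∧ M.next G (M.opp m) = e ∧
        M.next G e = M.next P a) := by
    intro m hmG hmp hem hem'
    have hmG' := h.isEdgeSet _ hmG
    have hmp' : M.pos (M.opp m) = false := by rw [M.pos_opp, hmp]
    constructor
    · rintro ⟨k1, k2, k3, k4⟩
      have f1 := (hnx _ _ haG k1).2 haS
      have f2 := (hnx _ _ hmG' k4).1 (hcross f1)
      have f3 := hal _ _ hmp' f2
      rw [M.opp_opp] at f3
      have f4 := hal _ _ hmp' ((hnx _ _ hmG k3).2 f3)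
      rw [M.opp_opp] at f4
      exact hbig m hmG hmp hem hem' (fun c => by cases c <;> assumption)
        (fun c => by cases c <;> assumption)
    · rintro ⟨k1, k2, k3, k4⟩
      have f1 := (hnx _ _ haG k1).2 haS
      have f2 := (hnx _ _ hmG k2).1 (hal _ _ hmp f1)
      have f3 := (hnx _ _ hmG' k3).2 (hal _ _ hmp f2)
      exact hbig m hmG hmp hem hem' (fun c => by cases c <;> assumption)
        (fun c => by cases c <;> assumption)
  -- Both directions of the loop are needed, since either end may come first.
  have ho1 := horder l hlG hlpos hel hel'
  have ho2 := horder (M.opp l) (h.isEdgeSet _ hlG) (by rw [M.pos_opp, hlpos]) hel'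
    (by rw [M.opp_opp]; exact hel)
  rw [M.opp_opp] at ho2
  have hfin : (M.next G a = l ∧ M.next G l = e ∧ M.next G e = M.opp l ∧
      M.next G (M.opp l) = M.next P a) ∨ (M.next G a = M.opp l ∧ M.next G (M.opp l) = e ∧
      M.next G e = l ∧ M.next G l = M.next P a) :=
    chain_of_three m1 m2 m3 n12 n13 n23 p2 ho1 ho2
  rcases hfin with ⟨k1, k2, k3, k4⟩ | ⟨k1, k2, k3, k4⟩
  · refine ⟨l, e, k1, k2, k3, k4, by rw [hek, r1], by rw [hek, q2], hlG, heG, hlpos, hepos, ?_⟩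
    intro d hd hdp hdR
    rw [hek]
    have := hall d hd hdp hdR
    grind
  · refine ⟨M.opp l, e, k1, k2, by rw [k3, M.opp_opp], by rw [M.opp_opp, k4], by rw [hek, r1],
      by rw [hek, q2], h.isEdgeSet _ hlG, heG, by rw [M.pos_opp, hlpos], hepos, ?_⟩
    intro d hd hdp hdR
    rw [hek, M.opp_opp]
    have := hall d hd hdp hdR
    grind

end IsTight
end Annuli
end SignedMap

/-! ### Identification with the exceptional graphs -/

namespace SignedMap

variable {V D : Type*} (M : SignedMap V D)

section Copies
set_option linter.unusedSectionVars false
open scoped Classical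
open Finset
variable [Fintype D]

/-- Injectivity need only be checked at one dart: that the fibre through a dart is a single point is
inherited under `rot` and `opp`, which `f` intertwines with permutations. Only the orientation
preserving alternative of `IsCopy` is used. -/
lemma isCopy_of_next {V' D' : Type*} (N : SignedMap V' D') {H : Set D} (f : D' → D) (d₀ : D')
    (hgen : ∀ S : Set D', d₀ ∈ S → (∀ d ∈ S, N.rot d ∈ S) → (∀ d ∈ S, N.opp d ∈ S) → ∀ d, d ∈ S)
    (h0 : ∀ d, f d = f d₀ → d = d₀) (hmem : ∀ d, f d ∈ H) (hsurj : ∀ e ∈ H, ∃ d, f d = e)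
    (hvert : ∀ v, ∃ d, M.vert (f d) = v) (hopp : ∀ d, f (N.opp d) = M.opp (f d))
    (hpos : ∀ d, M.pos (f d) = N.pos d) (hnext : ∀ d, M.next H (f d) = f (N.rot d)) :
    M.IsCopy N H := by
  refine ⟨f, fun d d' hdd => ?_, Set.Subset.antisymm (Set.range_subset_iff.2 hmem) hsurj, hvert,
    hopp, hpos, Or.inl fun d => hnext d ▸ M.isNext_next (hmem d)⟩
  refine (hgen {d | ∀ d', f d' = f d → d' = d} h0 ?_ ?_ d d' hdd.symm).symm
  · intro d hd d' hdd'
    have : f (N.rot.symm d') = f d := by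
      apply (M.next H).injective
      rw [hnext, hnext, Equiv.apply_symm_apply, hdd']
    rw [← hd _ this, Equiv.apply_symm_apply]
  · intro d hd d' hdd'
    have : f (N.opp d') = f d := by rw [hopp, hdd', hopp, M.opp_opp]
    rw [← hd _ this, N.opp_opp]

/-- Reduces the generation hypothesis of `isCopy_of_next` to a finite check: all darts are reached
by turning three times and passing along two edges in between. -/
lemma mem_of_word {V' D' : Type*} (N : SignedMap V' D') {d₀ : D'} {n : ℕ}
    (hw : ∀ d, ∃ i j k : Fin n,
      d = (N.rot ^ (i : ℕ)) (N.opp ((N.rot ^ (j : ℕ)) (N.opp ((N.rot ^ (k : ℕ)) d₀)))))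
    (S : Set D') (h0 : d₀ ∈ S) (hrot : ∀ d ∈ S, N.rot d ∈ S) (hopp : ∀ d ∈ S, N.opp d ∈ S)
    (d : D') : d ∈ S := by
  have hpow : ∀ i : ℕ, ∀ d ∈ S, (N.rot ^ i) d ∈ S := by
    intro i
    induction i with
    | zero => exact fun d hd => hd
    | succ i ih => exact fun d hd => by rw [pow_succ']; exact hrot _ (ih d hd)
  obtain ⟨i, j, k, rfl⟩ := hw d
  exact hpow _ _ (hopp _ (hpow _ _ (hopp _ (hpow _ _ h0))))

lemma exceptional₁_rot (d : Fin 12 × Bool) : exceptional₁.rot d =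
    cond d.2 (![(4, false), (8, true), (11, false), (5, true), (7, true), (2, true), (3, false),
        (6, true), (0, true), (1, false), (2, false), (3, true)] d.1)
      (![(9, false), (7, false), (4, true), (10, true), (5, false), (6, false), (1, true),
        (0, false), (9, true), (8, false), (11, true), (10, false)] d.1) := by
  revert d
  decide +kernel

lemma exceptional₂_rot (d : Fin 9 × Bool) : exceptional₂.rot d =
    cond d.2 (![(4, false), (6, false), (8, false), (4, true), (2, true), (6, true), (0, true),
        (8, true), (3, true)] d.1)
      (![(5, false), (3, false), (0, false), (7, false), (1, true), (1, false), (5, true),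
        (2, false), (7, true)] d.1) := by
  revert d
  decide +kernel

namespace IsTight
variable {M} {G : Set D}

lemma exists_posPart (h : M.IsTight G) (v : V) : ∃ a ∈ M.posPart G, M.vert a = v := by
  have h2 := h.two_le v
  rw [posDegree_eq] at h2
  obtain ⟨a, ha⟩ := card_pos.1 (lt_of_lt_of_le two_pos h2)
  exact ⟨a, mem_dartsAt.1 ha⟩

lemma exists_wild_inCorner (h : M.IsTight G) {e : D} (he : M.pos e = false) :
    ∃ a ∈ M.wild (M.posPart G), M.InCorner (M.posPart G) a e := by
  obtain ⟨a, ha, hav⟩ := h.exists_posPart (M.vert e)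
  obtain ⟨a', ha', hc⟩ := h.exists_wild he ha hav
  exact ⟨a', (mem_wildAt.1 ha').1, hc⟩

/-- Negative darts lie in wild corners only, so any other corner contains no further dart of `G`. -/
lemma next_eq_next (h : M.IsTight G) {u : D} (hu : u ∈ M.posPart G)
    (hw : u ∉ M.wild (M.posPart G)) : M.next G u = M.next (M.posPart G) u := by
  obtain ⟨-, h1, -⟩ := M.corner_enum (M.posPart_subset G) hu ∅ fun e => by
    refine ⟨fun he => absurd he (notMem_empty e), fun he => absurd ?_ hw⟩
    have hp : M.pos e = false := by
      by_contra hp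
      exact he.2.notMem ⟨he.1, by simpa using hp⟩
    obtain ⟨a, ha, hc⟩ := h.exists_wild_inCorner hp
    rwa [InCorner.unique hu (wild_subset ha) he.2 hc]
  exact h1

lemma mem_region_iff {a b c d : D} (ha : a ∈ M.wild (M.posPart G))
    (hw : ∀ e ∈ M.wild (M.posPart G), e = a ∨ e = b ∨ e = c ∨ e = d)
    (hb : M.region (M.posPart G) (b, true) = M.region (M.posPart G) (a, true))
    (hd : M.region (M.posPart G) (d, true) = M.region (M.posPart G) (c, true))
    (hr : M.region (M.posPart G) (c, true) ≠ M.region (M.posPart G) (a, true)) :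
    ∀ e ∈ M.posPart G, (e, true) ∈ M.region (M.posPart G) (a, true) ↔ e = a ∨ e = b := by
  intro e he
  constructor
  · intro heR
    have hre := region_eq heR
    have hew : e ∈ M.wild (M.posPart G) := by
      rw [mem_wild] at ha ⊢
      rw [hre]
      exact ⟨he, ha.2⟩
    rcases hw e hew with rfl | rfl | rfl | rfl
    · exact Or.inl rfl
    · exact Or.inr rfl
    · exact absurd hre hr
    · exact absurd (hd.symm.trans hre) hr
  · rintro (rfl | rfl)
    · exact M.mem_region_self _ _
    · exact hb ▸ M.mem_region_self _ _

lemma exists_core_of_wild (h : M.IsTight G) {a b c d k : D} (ha : a ∈ M.wild (M.posPart G))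
    (hb : b ∈ M.wild (M.posPart G)) (hab : M.vert a ≠ M.vert b)
    (hw : ∀ e ∈ M.wild (M.posPart G), e = a ∨ e = b ∨ e = c ∨ e = d)
    (hrb : M.region (M.posPart G) (b, true) = M.region (M.posPart G) (a, true))
    (hrd : M.region (M.posPart G) (d, true) = M.region (M.posPart G) (c, true))
    (hr : M.region (M.posPart G) (c, true) ≠ M.region (M.posPart G) (a, true))
    (hoa : M.opp (M.next (M.posPart G) a) = b) (hob : M.opp (M.next (M.posPart G) b) = a)
    (hl : 0 < (M.negLoops G (M.vert a)).ncard) (hn : #(M.wildAt (M.posPart G) (M.vert a)) = 1)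
    (hb0 : (M.negLoops G (M.vert b)).ncard = 0)
    (hkG : k ∈ G) (hkpos : M.pos k = false) (hk : M.InCorner (M.posPart G) b k) :
    ∃ l e, M.Core G a b l e := by
  obtain ⟨l, hlG, hl1, hl2, hl3⟩ := IsExtremal.exists_loop hl
  exact h.exists_core (wild_subset ha) (wild_subset hb) hab (h.chi_zero a ha)
    (mem_region_iff ha hw hrb hrd hr) hoa hob hlG hl3 (h.inCorner_of_card_eq_one hn ha hl3 hl1)
    (h.inCorner_of_card_eq_one hn ha (by rw [M.pos_opp, hl3]) hl2) hb0 hkG hkpos hk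

lemma neg_cases (h : M.IsTight G) {a b c d l e l' e' : D}
    (hw : ∀ e ∈ M.wild (M.posPart G), e = a ∨ e = b ∨ e = c ∨ e = d)
    (hrb : M.region (M.posPart G) (b, true) = M.region (M.posPart G) (a, true))
    (hrd : M.region (M.posPart G) (d, true) = M.region (M.posPart G) (c, true))
    (h1 : M.Core G a b l e) (h2 : M.Core G c d l' e') :
    ∀ u ∈ G, M.pos u = false → (u = l ∨ u = M.opp l ∨ u = e ∨ u = M.opp e) ∨
      (u = l' ∨ u = M.opp l' ∨ u = e' ∨ u = M.opp e') := by
  intro u hu hup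
  obtain ⟨a', ha', hc⟩ := h.exists_wild_inCorner hup
  have hur : (u, true) ∈ M.region (M.posPart G) (a', true) :=
    ((M.isClosed_region _ _).inCorner_iff hc true).2 (M.mem_region_self _ _)
  rcases hw a' ha' with rfl | rfl | rfl | rfl
  · exact Or.inl (h1.eq_or u hu hup hur)
  · exact Or.inl (h1.eq_or u hu hup (hrb ▸ hur))
  · exact Or.inr (h2.eq_or u hu hup hur)
  · exact Or.inr (h2.eq_or u hu hup (hrd ▸ hur))

lemma isCopy_exceptional₂ (h : M.IsTight G) {x y z : V} (hxy : x ≠ y) (hzx : z ≠ x)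
    (hzy : z ≠ y) (huniv : ∀ v, v = x ∨ v = y ∨ v = z)
    (hlx : 0 < (M.negLoops G x).ncard) (hly : 0 < (M.negLoops G y).ncard)
    (hlz : (M.negLoops G z).ncard = 0) (hx : M.HasType G x 3 1)
    (hy : M.HasType G y 3 1) (hz : M.HasType G z 4 2) : M.IsCopy exceptional₂ G := by
  -- The proof combines this solution for the positive edges with one core in each of the two wild
  -- faces.
  obtain ⟨a, a₁, a₂, b, b₁, b₂, c, c₁, d, d₁, ⟨va, vb, vc, vd⟩, ⟨ha, hb, hc, hd⟩, hw, hP,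
    ⟨a01, a12, a20⟩, ⟨b01, b12, b20⟩, ⟨c01, c12, c23, c30⟩, ⟨oa1, oc1, ob1, od1, oa2⟩,
    hrc, hrd, hrb⟩ := h.solution_three hxy hzy huniv hlx hly hx hy hz
  -- Since `z` has positive degree 4 and no negative loops, it is not good. So its negative darts do
  -- not all lie in one corner, and both wild corners contain some.
  have hcorner : ∀ u u' : D, u ∈ M.wild (M.posPart G) → M.vert u = z →
      (∀ e ∈ M.wild (M.posPart G), M.vert e = z → e = u ∨ e = u') →
      ∃ k ∈ G, M.pos k = false ∧ M.InCorner (M.posPart G) u' k := by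
    intro u u' hu hvu huu
    by_contra! hno
    refine h.not_good z ?_ hz.1 ((Set.ncard_eq_zero (Set.toFinite _)).1 hlz)
    rw [← hvu]
    refine M.isGood_of_inCorner rfl (wild_subset hu) fun e he hev hep => ?_
    obtain ⟨a', ha', hca⟩ := h.exists_wild_inCorner hep
    rcases huu a' ha' (hca.vert_eq.symm.trans (hev.trans hvu)) with rfl | rfl
    · exact hca
    · exact absurd hca (hno e he hep)
  have hwz : ∀ e ∈ M.wild (M.posPart G), M.vert e = z → e = c ∨ e = d := by
    intro e he hev
    rcases hw e he with rfl | rfl | h' | h'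
    · exact absurd (hev.symm.trans va) hzx
    · exact absurd (hev.symm.trans vb) hzy
    · exact Or.inl h'
    · exact Or.inr h'
  obtain ⟨k, hk1, hk2, hk3⟩ := hcorner d c hd vd fun e he hev => (hwz e he hev).symm
  obtain ⟨k', hk1', hk2', hk3'⟩ := hcorner c d hc vc hwz
  obtain ⟨l, e, h1⟩ := h.exists_core_of_wild ha hc (by rw [va, vc]; exact hzx.symm)
    (fun e he => by have := hw e he; grind) hrc hrd hrb (by rw [a01, oa1]) (by rw [c01, oc1])
    (va.symm ▸ hlx) (va.symm ▸ hx.2) (vc.symm ▸ hlz) hk1 hk2 hk3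
  obtain ⟨l', e', h2⟩ := h.exists_core_of_wild hb hd (by rw [vb, vd]; exact hzy.symm)
    (fun e he => by have := hw e he; grind) hrd hrc hrb.symm (by rw [b01, ob1])
    (by rw [c23, od1])
    (vb.symm ▸ hly) (vb.symm ▸ hy.2) (vd.symm ▸ hlz) hk1' hk2' hk3'
  have hneg := h.neg_cases (fun e he => by have := hw e he; grind) hrc hrd h1 h2
  have ma := wild_subset ha
  have mb := wild_subset hb
  have mc := wild_subset hc
  have md := wild_subset hd
  have ma1 := M.next_mem ma
  have mb1 := M.next_mem mb
  have mc1 := M.next_mem mc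
  have md1 := M.next_mem md
  rw [a01] at ma1
  rw [b01] at mb1
  rw [c01] at mc1
  rw [c23] at md1
  have ma2 := M.next_mem ma1
  have mb2 := M.next_mem mb1
  rw [a12] at ma2
  rw [b12] at mb2
  have vn := M.vert_next (M.posPart G)
  have va1 : M.vert a₁ = x := by rw [← a01, vn, va]
  have va2 : M.vert a₂ = x := by rw [← a12, vn, va1]
  have vb1 : M.vert b₁ = y := by rw [← b01, vn, vb]
  have vb2 : M.vert b₂ = y := by rw [← b12, vn, vb1]
  have vc1 : M.vert c₁ = z := by rw [← c01, vn, vc]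
  have vd1 : M.vert d₁ = z := by rw [← c23, vn, vd]
  have n1 : a₁ ≠ a := by
    rintro rfl
    obtain rfl : a₁ = a₂ := a01.symm.trans a12
    exact hzy (by rw [← vc, ← oa1, oa2, vb2])
  have n2 : a₂ ≠ a := by
    rintro rfl
    exact n1 ((M.next (M.posPart G)).injective (a12.trans a20.symm)) 
  have n3 : b₁ ≠ b := by
    rintro rfl
    obtain rfl : b₁ = b₂ := b01.symm.trans b12
    have : M.opp b₁ = a₂ := by rw [← oa2, M.opp_opp]
    exact hzx (by rw [← vd, ← ob1, this, va2])
  have n4 : b₂ ≠ b := by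
    rintro rfl
    exact n3 ((M.next (M.posPart G)).injective (b12.trans b20.symm))
  have hv : ∀ u v, M.vert u = v → v ≠ x → u ≠ a := by
    rintro _ _ rfl hvx rfl
    exact hvx va
  have heq : ∀ {u u'}, M.opp u = u' → u = M.opp u' := by
    rintro u _ rfl
    exact (M.opp_opp u).symm
  have wa1 : a₁ ∉ M.wild (M.posPart G) := fun h' => by have := hw _ h'; grind
  have wa2 : a₂ ∉ M.wild (M.posPart G) := fun h' => by have := hw _ h'; grind
  have wb1 : b₁ ∉ M.wild (M.posPart G) := fun h' => by have := hw _ h'; grind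
  have wb2 : b₂ ∉ M.wild (M.posPart G) := fun h' => by have := hw _ h'; grind
  have hoo := M.opp_opp
  have wc1 : c₁ ∉ M.wild (M.posPart G) := fun h' => by have := hw _ h'; grind
  have wd1 : d₁ ∉ M.wild (M.posPart G) := fun h' => by have := hw _ h'; grind
  have hG := h.isEdgeSet
  have hop : ∀ u, M.pos u = false → M.pos (M.opp u) = false := fun u hu => by
    rw [M.pos_opp, hu]
  have hpn : ∀ u ∈ M.posPart G, ∀ u', M.pos u' = false → u' ≠ u := by
    rintro u hu _ hu' rfl
    rw [hu.2] at hu'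
    exact absurd hu' (by decide)
  -- The loops 6 and 8 of the model are those of `l` and `l'`, and its negative edges 5 and 7 those
  -- of `e` and `e'`. The dart `(1, true)` goes to `a` and serves as the start for injectivity.
  set f : Fin 9 × Bool → D := fun u =>
    cond u.2 (![a₁, a, b, b₁, b₂, e, M.opp l, e', M.opp l'] u.1)
      (![c, c₁, d₁, d, a₂, M.opp e, l, M.opp e', l'] u.1) with hf
  refine M.isCopy_of_next _ f (1, true) (mem_of_word _ (n := 6) (by decide +kernel)) ?_ ?_ ?_ ?_ ?_ ?_ ?_
  · rintro ⟨i, j⟩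
    fin_cases i <;> cases j
    exacts [
      fun h' => absurd h' (hv _ _ vc hzx), fun h' => absurd h' n1,
      fun h' => absurd h' (hv _ _ vc1 hzx), fun _ => rfl, fun h' => absurd h' (hv _ _ vd1 hzx),
      fun h' => absurd h' (hv _ _ vb hxy.symm), fun h' => absurd h' (hv _ _ vd hzx),
      fun h' => absurd h' (hv _ _ vb1 hxy.symm), fun h' => absurd h' n2,
      fun h' => absurd h' (hv _ _ vb2 hxy.symm),
      fun h' => absurd h' (hpn _ ma _ (hop _ h1.pos_e)),
      fun h' => absurd h' (hpn _ ma _ (h1.pos_e)), fun h' => absurd h' (hpn _ ma _ (h1.pos_l)),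
      fun h' => absurd h' (hpn _ ma _ (hop _ h1.pos_l)),
      fun h' => absurd h' (hpn _ ma _ (hop _ h2.pos_e)),
      fun h' => absurd h' (hpn _ ma _ (h2.pos_e)), fun h' => absurd h' (hpn _ ma _ (h2.pos_l)),
      fun h' => absurd h' (hpn _ ma _ (hop _ h2.pos_l))]
  · rintro ⟨i, j⟩
    fin_cases i <;> cases j
    exacts [
      mc.1, ma1.1, mc1.1, ma.1, md1.1, mb.1, md.1, mb1.1, ma2.1, mb2.1, hG _ h1.mem_e, h1.mem_e,
      h1.mem_l, hG _ h1.mem_l, hG _ h2.mem_e, h2.mem_e, h2.mem_l, hG _ h2.mem_l]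
  · intro u hu
    by_cases hup : M.pos u = true
    · rcases hP u ⟨hu, hup⟩ with
        rfl | rfl | rfl | rfl | rfl | rfl | rfl | rfl | rfl | rfl
      exacts [
        ⟨(1, true), rfl⟩, ⟨(0, true), rfl⟩, ⟨(4, false), rfl⟩, ⟨(2, true), rfl⟩, ⟨(3, true), rfl⟩,
        ⟨(4, true), rfl⟩, ⟨(0, false), rfl⟩, ⟨(1, false), rfl⟩, ⟨(3, false), rfl⟩,
        ⟨(2, false), rfl⟩]
    · rcases hneg u hu (by simpa using hup) with (rfl | rfl | rfl | rfl) | (rfl | rfl | rfl | rfl)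
      exacts [
        ⟨(6, false), rfl⟩, ⟨(6, true), rfl⟩, ⟨(5, true), rfl⟩, ⟨(5, false), rfl⟩,
        ⟨(8, false), rfl⟩, ⟨(8, true), rfl⟩, ⟨(7, true), rfl⟩, ⟨(7, false), rfl⟩]
  · intro v
    rcases huniv v with rfl | rfl | rfl
    exacts [⟨(1, true), va⟩, ⟨(2, true), vb⟩, ⟨(0, false), vc⟩]
  · rintro ⟨i, j⟩
    fin_cases i <;> cases j
    exacts [
      heq oa1, oa1.symm, oc1.symm, heq oc1, od1.symm, heq od1, heq ob1, ob1.symm, oa2.symm,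
      heq oa2, (M.opp_opp _).symm, rfl, rfl, (M.opp_opp _).symm, (M.opp_opp _).symm, rfl, rfl,
      (M.opp_opp _).symm]
  · rintro ⟨i, j⟩
    fin_cases i <;> cases j
    exacts [
      mc.2, ma1.2, mc1.2, ma.2, md1.2, mb.2, md.2, mb1.2, ma2.2, mb2.2, hop _ h1.pos_e, h1.pos_e,
      h1.pos_l, hop _ h1.pos_l, hop _ h2.pos_e, h2.pos_e, h2.pos_l, hop _ h2.pos_l]
  · intro u
    rw [exceptional₂_rot]
    revert u
    rintro ⟨i, j⟩
    fin_cases i <;> cases j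
    exacts [
      h1.next_b, ((h.next_eq_next ma1 wa1).trans a12), ((h.next_eq_next mc1 wc1).trans c12),
      h1.next_a, ((h.next_eq_next md1 wd1).trans c30), h2.next_a, h2.next_b,
      ((h.next_eq_next mb1 wb1).trans b12), ((h.next_eq_next ma2 wa2).trans a20),
      ((h.next_eq_next mb2 wb2).trans b20), (h1.next_opp_e.trans c01), h1.next_e, h1.next_l,
      (h1.next_opp_l.trans a01), (h2.next_opp_e.trans c23), h2.next_e, h2.next_l,
      (h2.next_opp_l.trans b01)]

lemma isCopy_exceptional₁ (h : M.IsTight G) {x y z w : V} (hxy : x ≠ y) (hzx : z ≠ x)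
    (hzy : z ≠ y) (hwx : w ≠ x) (hwy : w ≠ y) (hzw : z ≠ w)
    (huniv : ∀ v, v = x ∨ v = y ∨ v = z ∨ v = w)
    (hlx : 0 < (M.negLoops G x).ncard) (hly : 0 < (M.negLoops G y).ncard)
    (hlz : (M.negLoops G z).ncard = 0) (hlw : (M.negLoops G w).ncard = 0)
    (hx : M.HasType G x 3 1) (hy : M.HasType G y 3 1) (hz : M.HasType G z 5 1)
    (hw : M.HasType G w 5 1) : M.IsCopy exceptional₁ G := by
  obtain ⟨a, a₁, a₂, b, b₁, b₂, b₃, b₄, c, c₁, c₂, d, d₁, d₂, d₃, d₄, ⟨va, vc, vbd⟩,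
    ⟨ha, hb, hc, hd⟩, hwild, hP, ⟨a01, a12, a20⟩, ⟨b01, b12, b23, b34, b40⟩, ⟨c01, c12, c20⟩,
    ⟨d01, d12, d23, d34, d40⟩, ⟨oa1, ob1, oc1, od1⟩, ⟨ob2, oa2, ob4, oc2⟩, hrb, hrd, hrc⟩ :=
    h.solution_four hxy hzx hzy hwx hwy hzw huniv hlx hly hx hy hz hw
  wlog hvbd : M.vert b = z ∧ M.vert d = w generalizing z w with H
  · exact H hwx hwy hzx hzy hzw.symm (fun v => by have := huniv v; grind) hlw hlz hw hz
      vbd.symm (vbd.resolve_left hvbd)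
  obtain ⟨vb, vd⟩ := hvbd
  obtain ⟨k, hk1, hk2, hk3⟩ := h.exists_neg z
  obtain ⟨k', hk1', hk2', hk3'⟩ := h.exists_neg w
  obtain ⟨l, e, h1⟩ := h.exists_core_of_wild ha hb (by rw [va, vb]; exact hzx.symm) hwild hrb hrd
    hrc (by rw [a01, oa1]) (by rw [b01, ob1]) (va.symm ▸ hlx) (va.symm ▸ hx.2) (vb.symm ▸ hlz) hk1
    hk3 (h.inCorner_of_card_eq_one (vb.symm ▸ hz.2) hb hk3 (hk2.trans vb.symm))
  obtain ⟨l', e', h2⟩ := h.exists_core_of_wild hc hd (by rw [vc, vd]; exact hwy.symm)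
    (fun e he => by have := hwild e he; grind) hrd hrb hrc.symm (by rw [c01, oc1])
    (by rw [d01, od1]) (vc.symm ▸ hly) (vc.symm ▸ hy.2) (vd.symm ▸ hlw) hk1' hk3'
    (h.inCorner_of_card_eq_one (vd.symm ▸ hw.2) hd hk3' (hk2'.trans vd.symm))
  have hneg := h.neg_cases hwild hrb hrd h1 h2
  have ma := wild_subset ha
  have mb := wild_subset hb
  have mc := wild_subset hc
  have md := wild_subset hd
  have ma1 := M.next_mem ma
  rw [a01] at ma1
  have ma2 := M.next_mem ma1
  rw [a12] at ma2
  have mb1 := M.next_mem mb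
  rw [b01] at mb1
  have mb2 := M.next_mem mb1
  rw [b12] at mb2
  have mb3 := M.next_mem mb2
  rw [b23] at mb3
  have mb4 := M.next_mem mb3
  rw [b34] at mb4
  have mc1 := M.next_mem mc
  rw [c01] at mc1
  have mc2 := M.next_mem mc1
  rw [c12] at mc2
  have md1 := M.next_mem md
  rw [d01] at md1
  have md2 := M.next_mem md1
  rw [d12] at md2
  have md3 := M.next_mem md2
  rw [d23] at md3
  have md4 := M.next_mem md3
  rw [d34] at md4
  have vn := M.vert_next (M.posPart G)
  have va1 : M.vert a₁ = x := by rw [← a01, vn, va]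
  have va2 : M.vert a₂ = x := by rw [← a12, vn, va1]
  have vb1 : M.vert b₁ = z := by rw [← b01, vn, vb]
  have vb2 : M.vert b₂ = z := by rw [← b12, vn, vb1]
  have vb3 : M.vert b₃ = z := by rw [← b23, vn, vb2]
  have vb4 : M.vert b₄ = z := by rw [← b34, vn, vb3]
  have vc1 : M.vert c₁ = y := by rw [← c01, vn, vc]
  have vc2 : M.vert c₂ = y := by rw [← c12, vn, vc1]
  have vd1 : M.vert d₁ = w := by rw [← d01, vn, vd]
  have vd2 : M.vert d₂ = w := by rw [← d12, vn, vd1]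
  have vd3 : M.vert d₃ = w := by rw [← d23, vn, vd2]
  have vd4 : M.vert d₄ = w := by rw [← d34, vn, vd3]
  have hv : ∀ u v, M.vert u = v → v ≠ x → u ≠ a := by
    rintro _ _ rfl hvx rfl
    exact hvx va
  have heq : ∀ {u u'}, M.opp u = u' → u = M.opp u' := by
    rintro u _ rfl
    exact (M.opp_opp u).symm
  have n1 : a₁ ≠ a := by
    rintro rfl
    obtain rfl : a₁ = a₂ := a01.symm.trans a12
    exact hzw (by rw [← vb, ← oa1, oa2, vd3])
  have n2 : a₂ ≠ a := by
    rintro rfl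
    exact n1 ((M.next (M.posPart G)).injective (a12.trans a20.symm))
  have hoo := M.opp_opp
  have wa1 : a₁ ∉ M.wild (M.posPart G) := fun h' => by
    have := hwild _ h'
    grind
  have wa2 : a₂ ∉ M.wild (M.posPart G) := fun h' => by
    have := hwild _ h'
    grind
  have wb1 : b₁ ∉ M.wild (M.posPart G) := fun h' => by
    have := hwild _ h'
    grind
  have wb2 : b₂ ∉ M.wild (M.posPart G) := fun h' => by
    have := hwild _ h'
    grind
  have wb3 : b₃ ∉ M.wild (M.posPart G) := fun h' => by
    have := hwild _ h'
    grind
  have wb4 : b₄ ∉ M.wild (M.posPart G) := fun h' => by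
    have := hwild _ h'
    grind
  have wc1 : c₁ ∉ M.wild (M.posPart G) := fun h' => by
    have := hwild _ h'
    grind
  have wc2 : c₂ ∉ M.wild (M.posPart G) := fun h' => by
    have := hwild _ h'
    grind
  have wd1 : d₁ ∉ M.wild (M.posPart G) := fun h' => by
    have := hwild _ h'
    grind
  have wd2 : d₂ ∉ M.wild (M.posPart G) := fun h' => by
    have := hwild _ h'
    grind
  have wd3 : d₃ ∉ M.wild (M.posPart G) := fun h' => by
    have := hwild _ h'
    grind
  have wd4 : d₄ ∉ M.wild (M.posPart G) := fun h' => by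
    have := hwild _ h'
    grind
  have hG := h.isEdgeSet
  have hop : ∀ u, M.pos u = false → M.pos (M.opp u) = false := fun u hu => by
    rw [M.pos_opp, hu]
  have hpn : ∀ u ∈ M.posPart G, ∀ u', M.pos u' = false → u' ≠ u := by
    rintro u hu _ hu' rfl
    rw [hu.2] at hu'
    exact absurd hu' (by decide)
  -- The model vertices `x`, `y`, `z`, `w` become those of `a`, `b`, `d`, `c`; the loops are 9 and
  -- 11, and the start for injectivity is `(0, false)`, which goes to `a`.
  set f : Fin 12 × Bool → D := fun u =>
    cond u.2 (![b₁, b, c, c₁, d₂, c₂, d₄, d₃, M.opp e, M.opp l, M.opp e', M.opp l'] u.1)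
      (![a, a₁, d₁, d, b₂, b₃, b₄, a₂, e, l, e', l'] u.1) with hf
  refine M.isCopy_of_next _ f (0, false) (mem_of_word _ (n := 6) (by decide +kernel)) ?_ ?_ ?_ ?_ ?_ ?_ ?_
  · rintro ⟨i, j⟩
    fin_cases i <;> cases j
    exacts [
      fun _ => rfl, fun h' => absurd h' (hv _ _ vb1 hzx), fun h' => absurd h' n1,
      fun h' => absurd h' (hv _ _ vb hzx), fun h' => absurd h' (hv _ _ vd1 hwx),
      fun h' => absurd h' (hv _ _ vc hxy.symm), fun h' => absurd h' (hv _ _ vd hwx),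
      fun h' => absurd h' (hv _ _ vc1 hxy.symm), fun h' => absurd h' (hv _ _ vb2 hzx),
      fun h' => absurd h' (hv _ _ vd2 hwx), fun h' => absurd h' (hv _ _ vb3 hzx),
      fun h' => absurd h' (hv _ _ vc2 hxy.symm), fun h' => absurd h' (hv _ _ vb4 hzx),
      fun h' => absurd h' (hv _ _ vd4 hwx), fun h' => absurd h' n2,
      fun h' => absurd h' (hv _ _ vd3 hwx), fun h' => absurd h' (hpn _ ma _ (h1.pos_e)),
      fun h' => absurd h' (hpn _ ma _ (hop _ h1.pos_e)),
      fun h' => absurd h' (hpn _ ma _ (h1.pos_l)),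
      fun h' => absurd h' (hpn _ ma _ (hop _ h1.pos_l)),
      fun h' => absurd h' (hpn _ ma _ (h2.pos_e)),
      fun h' => absurd h' (hpn _ ma _ (hop _ h2.pos_e)),
      fun h' => absurd h' (hpn _ ma _ (h2.pos_l)),
      fun h' => absurd h' (hpn _ ma _ (hop _ h2.pos_l))]
  · rintro ⟨i, j⟩
    fin_cases i <;> cases j
    exacts [
      ma.1, mb1.1, ma1.1, mb.1, md1.1, mc.1, md.1, mc1.1, mb2.1, md2.1, mb3.1, mc2.1, mb4.1,
      md4.1, ma2.1, md3.1, h1.mem_e, hG _ h1.mem_e, h1.mem_l, hG _ h1.mem_l, h2.mem_e,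
      hG _ h2.mem_e, h2.mem_l, hG _ h2.mem_l]
  · intro u hu
    by_cases hup : M.pos u = true
    · rcases hP u ⟨hu, hup⟩ with
        rfl | rfl | rfl | rfl | rfl | rfl | rfl | rfl | rfl | rfl | rfl | rfl | rfl | rfl | rfl | rfl
      exacts [
        ⟨(0, false), rfl⟩, ⟨(1, false), rfl⟩, ⟨(7, false), rfl⟩, ⟨(1, true), rfl⟩,
        ⟨(0, true), rfl⟩, ⟨(4, false), rfl⟩, ⟨(5, false), rfl⟩, ⟨(6, false), rfl⟩,
        ⟨(2, true), rfl⟩, ⟨(3, true), rfl⟩, ⟨(5, true), rfl⟩, ⟨(3, false), rfl⟩,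
        ⟨(2, false), rfl⟩, ⟨(4, true), rfl⟩, ⟨(7, true), rfl⟩, ⟨(6, true), rfl⟩]
    · rcases hneg u hu (by simpa using hup) with (rfl | rfl | rfl | rfl) | (rfl | rfl | rfl | rfl)
      exacts [
        ⟨(9, false), rfl⟩, ⟨(9, true), rfl⟩, ⟨(8, false), rfl⟩, ⟨(8, true), rfl⟩,
        ⟨(11, false), rfl⟩, ⟨(11, true), rfl⟩, ⟨(10, false), rfl⟩, ⟨(10, true), rfl⟩]
  · intro v
    rcases huniv v with rfl | rfl | rfl | rfl
    exacts [⟨(0, false), va⟩, ⟨(2, true), vc⟩, ⟨(1, true), vb⟩, ⟨(3, false), vd⟩]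
  · rintro ⟨i, j⟩
    fin_cases i <;> cases j
    exacts [
      heq ob1, ob1.symm, oa1.symm, heq oa1, od1.symm, heq od1, heq oc1, oc1.symm, ob2.symm,
      heq ob2, heq oc2, oc2.symm, ob4.symm, heq ob4, oa2.symm, heq oa2, rfl, (M.opp_opp _).symm,
      rfl, (M.opp_opp _).symm, rfl, (M.opp_opp _).symm, rfl, (M.opp_opp _).symm]
  · rintro ⟨i, j⟩
    fin_cases i <;> cases j
    exacts [
      ma.2, mb1.2, ma1.2, mb.2, md1.2, mc.2, md.2, mc1.2, mb2.2, md2.2, mb3.2, mc2.2, mb4.2,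
      md4.2, ma2.2, md3.2, h1.pos_e, hop _ h1.pos_e, h1.pos_l, hop _ h1.pos_l, h2.pos_e,
      hop _ h2.pos_e, h2.pos_l, hop _ h2.pos_l]
  · intro u
    rw [exceptional₁_rot]
    revert u
    rintro ⟨i, j⟩
    fin_cases i <;> cases j
    exacts [
      h1.next_a, ((h.next_eq_next mb1 wb1).trans b12), ((h.next_eq_next ma1 wa1).trans a12),
      h1.next_b, ((h.next_eq_next md1 wd1).trans d12), h2.next_a, h2.next_b,
      ((h.next_eq_next mc1 wc1).trans c12), ((h.next_eq_next mb2 wb2).trans b23),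
      ((h.next_eq_next md2 wd2).trans d23), ((h.next_eq_next mb3 wb3).trans b34),
      ((h.next_eq_next mc2 wc2).trans c20), ((h.next_eq_next mb4 wb4).trans b40),
      ((h.next_eq_next md4 wd4).trans d40), ((h.next_eq_next ma2 wa2).trans a20),
      ((h.next_eq_next md3 wd3).trans d34), h1.next_e, (h1.next_opp_e.trans b01), h1.next_l,
      (h1.next_opp_l.trans a01), h2.next_e, (h2.next_opp_e.trans d01), h2.next_l,
      (h2.next_opp_l.trans c01)]

end IsTight
end Copies
end SignedMap

/-! ### Two-sided disk faces -/

namespace SignedMap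

variable {V D : Type*} (M : SignedMap V D)

section Bigons
set_option linter.unusedSectionVars false
open scoped Classical
open Finset
variable [Fintype D]

variable {M} in
lemma IsClosed.even_flagCard {Q : Set D} (hQ : M.IsEdgeSet Q) {S : Set (D × Bool)}
    (hS : M.IsClosed Q S) : Even (flagCard Q S) := by
  refine even_card_of_involution _ M.along (fun x hx => ?_) (fun x _ => M.along_along x)
    fun x _ => M.along_ne x
  rw [mem_filter_univ] at hx ⊢
  exact ⟨hS.along x hx.1, hQ _ hx.2⟩

/-- Passing through the corner of a face of `Q` at a vertex, to the next edge of `Q`. -/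
noncomputable def turnIn (Q : Set D) (x : D × Bool) : D × Bool :=
  if x.2 then (M.next Q x.1, false) else ((M.next Q).symm x.1, true)

lemma turnIn_turnIn (Q : Set D) (x : D × Bool) : M.turnIn Q (M.turnIn Q x) = x := by
  obtain ⟨d, c⟩ := x
  cases c <;> simp [turnIn]

lemma turnIn_snd (Q : Set D) (x : D × Bool) : (M.turnIn Q x).2 = !x.2 := by
  obtain ⟨d, c⟩ := x
  cases c <;> rfl

lemma turnIn_fst {Q : Set D} (x : D × Bool) :
    M.next Q x.1 = (M.turnIn Q x).1 ∨ M.next Q (M.turnIn Q x).1 = x.1 := by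
  obtain ⟨d, c⟩ := x
  cases c
  · exact Or.inr (Equiv.apply_symm_apply _ _)
  · exact Or.inl rfl

variable {M} in
lemma IsClosed.turnIn_mem {Q : Set D} {S : Set (D × Bool)} (hS : M.IsClosed Q S) {x : D × Bool}
    (hx : x ∈ S) (hxQ : x.1 ∈ Q) : M.turnIn Q x ∈ S ∧ (M.turnIn Q x).1 ∈ Q := by
  obtain ⟨d, c⟩ := x
  cases c
  · refine ⟨?_, M.next_symm_mem hxQ⟩
    change ((M.next Q).symm d, true) ∈ S
    rw [← hS.next_mem_iff (M.next_symm_mem hxQ), Equiv.apply_symm_apply]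
    exact hx
  · exact ⟨(hS.next_mem_iff hxQ).2 hx, M.next_mem hxQ⟩

/-- The face of `Q` at `(e, b)` is a disk with two sides, the edge of `e` and another edge of
`e'`. -/
structure IsBigon (Q : Set D) (e e' : D) (b b' : Bool) : Prop where
  isEdgeSet : M.IsEdgeSet Q
  left_mem : e ∈ Q
  right_mem : e' ∈ Q
  ne : e' ≠ e
  ne_opp : e' ≠ M.opp e
  chi : M.chi Q (M.region Q (e, b)) = 1
  four : flagCard Q (M.region Q (e, b)) = 4
  mem : (e', b') ∈ M.region Q (e, b)

namespace IsBigon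
variable {M} {Q : Set D} {e e' : D} {b b' : Bool}

lemma symm (h : M.IsBigon Q e e' b b') : M.IsBigon Q e' e b' b :=
  ⟨h.isEdgeSet, h.right_mem, h.left_mem, h.ne.symm,
    fun h' => h.ne_opp (by rw [h', M.opp_opp]), by rw [region_eq h.mem, h.chi],
    by rw [region_eq h.mem, h.four], mem_region_symm h.mem⟩

/-- The four flags listed are distinct because the two edges are, and there are only four. -/
lemma flags (h : M.IsBigon Q e e' b b') {y : D × Bool} (hy : y ∈ M.region Q (e, b))
    (hyQ : y.1 ∈ Q) :
    y = (e, b) ∨ y = M.along (e, b) ∨ y = (e', b') ∨ y = M.along (e', b') := by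
  have hS := M.isClosed_region Q (e, b)
  have hn : ({(e, b), M.along (e, b), (e', b'), M.along (e', b')} : Finset (D × Bool)) =
      ({y | y ∈ M.region Q (e, b) ∧ y.1 ∈ Q} : Finset (D × Bool)) := by
    apply eq_of_subset_of_card_le
    · intro y hy
      rw [mem_filter_univ]
      simp only [mem_insert, mem_singleton] at hy
      rcases hy with rfl | rfl | rfl | rfl
      · exact ⟨M.mem_region_self _ _, h.left_mem⟩
      · exact ⟨hS.along _ (M.mem_region_self _ _), h.isEdgeSet _ h.left_mem⟩
      · exact ⟨h.mem, h.right_mem⟩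
      · exact ⟨hS.along _ h.mem, h.isEdgeSet _ h.right_mem⟩
    · have h1 := h.four
      rw [flagCard] at h1
      rw [h1, card_insert_of_notMem, card_insert_of_notMem, card_pair]
      · intro h'
        exact M.opp_ne e' (congrArg Prod.fst h').symm
      · simp only [mem_insert, mem_singleton, not_or]
        exact ⟨fun h' => h.ne_opp (congrArg Prod.fst h').symm,
          fun h' => h.ne (M.opp_injective (congrArg Prod.fst h')).symm⟩
      · simp only [mem_insert, mem_singleton, not_or]
        exact ⟨fun h' => M.opp_ne e (congrArg Prod.fst h').symm,
          fun h' => h.ne (congrArg Prod.fst h').symm,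
          fun h' => h.ne_opp (by
            rw [show e = M.opp e' from congrArg Prod.fst h', M.opp_opp])⟩
  have : y ∈ ({y | y ∈ M.region Q (e, b) ∧ y.1 ∈ Q} : Finset (D × Bool)) :=
    (mem_filter_univ y).2 ⟨hy, hyQ⟩
  rw [← hn] at this
  simpa using this

lemma notMem_region (h : M.IsBigon Q e e' b b') : (e, !b) ∉ M.region Q (e, b) := by
  intro hm
  rcases h.flags hm h.left_mem with h' | h' | h' | h'
  · exact absurd (congrArg Prod.snd h') (by simp)
  · exact M.opp_ne e (congrArg Prod.fst h').symm
  · exact h.ne (congrArg Prod.fst h').symm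
  · exact h.ne_opp (by rw [show e = M.opp e' from congrArg Prod.fst h', M.opp_opp])

/-- By the balance of signs on the boundary, one negative side alone is impossible: its two flags
have equal signs. -/
lemma pos_eq_false (h : M.IsBigon Q e e' b b') (he : M.pos e = false) : M.pos e' = false := by
  by_contra hp
  rw [Bool.not_eq_false] at hp
  have h0 := M.sum_sgn_eq_zero h.isEdgeSet (M.isClosed_region Q (e, b))
  have h1 : ({y | y ∈ M.region Q (e, b) ∧ y.1 ∈ Q ∧ M.pos y.1 = false} : Finset (D × Bool)) =
      {(e, b), M.along (e, b)} := by
    ext y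
    rw [mem_filter_univ, mem_insert, mem_singleton]
    constructor
    · rintro ⟨hy, hyQ, hyp⟩
      rcases h.flags hy hyQ with rfl | rfl | rfl | rfl
      · exact Or.inl rfl
      · exact Or.inr rfl
      · rw [hp] at hyp
        exact absurd hyp (by decide)
      · change M.pos (M.opp e') = false at hyp
        rw [M.pos_opp, hp] at hyp
        exact absurd hyp (by decide)
    · rintro (rfl | rfl)
      · exact ⟨M.mem_region_self _ _, h.left_mem, he⟩
      · exact ⟨(M.isClosed_region Q _).along _ (M.mem_region_self _ _),
          h.isEdgeSet _ h.left_mem, (M.pos_opp e).trans he⟩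
  rw [h1, sum_pair fun h' => M.opp_ne e (congrArg Prod.fst h').symm, M.sgn_along, he] at h0
  have := sgn_ne_zero (e, b)
  simp only [Bool.false_eq_true, if_false] at h0
  omega

lemma pos_eq (h : M.IsBigon Q e e' b b') : M.pos e' = M.pos e := by
  cases he : M.pos e
  · exact h.pos_eq_false he
  · by_contra he'
    rw [Bool.not_eq_true] at he'
    rw [h.symm.pos_eq_false he'] at he
    exact absurd he (by decide)

/-- Otherwise the side of `e` would close up to a full boundary component, and the connected
boundary of the disk would miss `e'`. -/
lemma turnIn_ne_along (h : M.IsBigon Q e e' b b') : M.turnIn Q (e, b) ≠ M.along (e, b) := by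
  intro ht
  have hc := congrArg Prod.snd ht
  rw [turnIn_snd] at hc
  have hb : ∀ y, y ∈ ({(e, b), M.along (e, b)} : Set (D × Bool)) ↔ M.along y ∈
      ({(e, b), M.along (e, b)} : Set (D × Bool)) := by
    intro y
    simp only [Set.mem_insert_iff, Set.mem_singleton_iff]
    constructor
    · rintro (rfl | rfl)
      · exact Or.inr rfl
      · exact Or.inl (M.along_along _)
    · rintro (h' | h')
      · right
        rw [← h', M.along_along]
      · left
        rw [← M.along_along y, h', M.along_along]
  have := disk_flags_subset h.isEdgeSet h.chi (T := {(e, b), M.along (e, b)}) (Or.inl rfl)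
    h.left_mem (fun y hy _ => (hb y).1 hy) ?_ _ h.mem h.right_mem
  · rcases this with h' | h'
    · exact h.ne (congrArg Prod.fst h')
    · exact h.ne_opp (congrArg Prod.fst h')
  · intro d _
    rw [← ht]
    simp only [Set.mem_insert_iff, Set.mem_singleton_iff]
    cases b
    · simp only [turnIn, Bool.false_eq_true, if_false, Prod.mk.injEq, and_true, and_false, or_false,
        false_or, Bool.true_eq_false]
      exact ⟨fun h' => by rw [h', Equiv.apply_symm_apply],
        fun h' => by rw [← h', Equiv.symm_apply_apply]⟩
    · simp only [turnIn, if_true, Prod.mk.injEq, and_true, and_false, or_false, false_or,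
        Bool.true_eq_false, Bool.false_eq_true, (M.next Q).injective.eq_iff]

lemma turnIn_eq (h : M.IsBigon Q e e' b b') :
    M.turnIn Q (e, b) = (e', b') ∨ M.turnIn Q (e, b) = M.along (e', b') := by
  obtain ⟨h1, h2⟩ := (M.isClosed_region Q (e, b)).turnIn_mem (M.mem_region_self _ _) h.left_mem
  rcases h.flags h1 h2 with h' | h' | h' | h'
  · have := congrArg Prod.snd h'
    rw [turnIn_snd] at this
    exact absurd this (by simp)
  · exact absurd h' h.turnIn_ne_along
  · exact Or.inl h'
  · exact Or.inr h'

lemma along_left (h : M.IsBigon Q e e' b b') :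
    M.IsBigon Q (M.opp e) e' (xor b (M.pos e)) b' := by
  have hm : (M.opp e, xor b (M.pos e)) ∈ M.region Q (e, b) :=
    (M.isClosed_region Q (e, b)).along _ (M.mem_region_self _ _)
  exact ⟨h.isEdgeSet, h.isEdgeSet _ h.left_mem, h.right_mem, h.ne_opp,
    by rw [M.opp_opp]; exact h.ne, by rw [region_eq hm, h.chi], by rw [region_eq hm, h.four],
    by rw [region_eq hm]; exact h.mem⟩

/-- The sides of a bigon are neighbours at both ends. -/
lemma exists_twin (h : M.IsBigon Q e e' b b') :
    ∃ u, (u = e' ∨ u = M.opp e') ∧ (M.next Q e = u ∨ M.next Q u = e) ∧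
      (M.next Q (M.opp e) = M.opp u ∨ M.next Q (M.opp u) = M.opp e) := by
  have h1 := h.turnIn_eq
  have h2 := h.along_left.turnIn_eq
  have f1 := M.turnIn_fst (Q := Q) (e, b)
  have f2 := M.turnIn_fst (Q := Q) (M.opp e, xor b (M.pos e))
  -- The two ends of `e` turn into different flags of `e'`, hence into its two different ends.
  have hne : M.turnIn Q (e, b) ≠ M.turnIn Q (M.opp e, xor b (M.pos e)) := by
    intro h'
    have := congrArg (M.turnIn Q) h'
    rw [turnIn_turnIn, turnIn_turnIn] at this
    exact M.opp_ne e (congrArg Prod.fst this).symm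
  rcases h1 with h1 | h1 <;> rcases h2 with h2 | h2 <;> rw [h1, h2] at hne <;>
    rw [h1] at f1 <;> rw [h2] at f2
  · exact absurd rfl hne
  · exact ⟨e', Or.inl rfl, f1, f2⟩
  · refine ⟨M.opp e', Or.inr rfl, f1, ?_⟩
    rw [M.opp_opp]
    exact f2
  · exact absurd rfl hne

end IsBigon

/-! ### Removing an edge of a bigon -/

/-- The edge set `Q` without the edge of `d`. -/
def removeEdge (Q : Set D) (d : D) : Set D := {y ∈ Q | y ≠ d ∧ y ≠ M.opp d}

lemma removeEdge_subset (Q : Set D) (d : D) : M.removeEdge Q d ⊆ Q := fun _ h => h.1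

lemma isEdgeSet_removeEdge {Q : Set D} (hQ : M.IsEdgeSet Q) (d : D) :
    M.IsEdgeSet (M.removeEdge Q d) := fun y hy =>
  ⟨hQ y hy.1, fun h => hy.2.2 (by rw [← h, M.opp_opp]), fun h => hy.2.1 (M.opp_injective h)⟩

lemma notMem_removeEdge (Q : Set D) (d : D) : d ∉ M.removeEdge Q d := fun h => h.2.1 rfl

lemma addEdge_removeEdge {Q : Set D} (hQ : M.IsEdgeSet Q) {d : D} (hd : d ∈ Q) :
    M.addEdge (M.removeEdge Q d) d = Q := by
  ext y
  rw [mem_addEdge]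
  constructor
  · rintro (rfl | rfl | h)
    exacts [hd, hQ _ hd, h.1]
  · intro hy
    by_cases h1 : y = d
    · exact Or.inl h1
    · by_cases h2 : y = M.opp d
      · exact Or.inr (Or.inl h2)
      · exact Or.inr (Or.inr ⟨hy, h1, h2⟩)

namespace IsBigon
variable {M} {Q : Set D} {e e' : D} {b b' : Bool}

lemma region_removeEdge (h : M.IsBigon Q e e' b b') :
    M.region (M.removeEdge Q e) (e, b) = M.region Q (e, b) ∪ M.region Q (e, !b) := by
  have := region_eq_union (M := M) e (M.notMem_removeEdge Q e) b
  rwa [M.addEdge_removeEdge h.isEdgeSet h.left_mem] at this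

/-- Removing `e` merges the bigon into the face on its other side. This changes neither the Euler
characteristic nor the number of sides of that face; `e'` takes over the role of `e`. -/
lemma chi_removeEdge (h : M.IsBigon Q e e' b b') :
    M.chi (M.removeEdge Q e) (M.region (M.removeEdge Q e) (e, b)) =
      M.chi Q (M.region Q (e, !b)) := by
  have h1 := M.chi_addEdge (M.isEdgeSet_removeEdge h.isEdgeSet e) (M.notMem_removeEdge Q e) b
  rw [M.addEdge_removeEdge h.isEdgeSet h.left_mem] at h1
  have h2 : M.chi Q (M.region (M.removeEdge Q e) (e, b)) = 1 + M.chi Q (M.region Q (e, !b)) := by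
    rw [h.region_removeEdge, M.chi_union _ (M.region_disjoint h.notMem_region), h.chi]
  linarith

lemma flagCard_removeEdge (h : M.IsBigon Q e e' b b') :
    flagCard (M.removeEdge Q e) (M.region (M.removeEdge Q e) (e, b)) =
      flagCard Q (M.region Q (e, !b)) := by
  have h1 := (M.isClosed_region (M.removeEdge Q e) (e, b)).flagCard_addEdge
    (both_mem_region (M.notMem_removeEdge Q e) b) (M.isEdgeSet_removeEdge h.isEdgeSet e)
    (M.notMem_removeEdge Q e)
  rw [M.addEdge_removeEdge h.isEdgeSet h.left_mem] at h1
  have h2 := flagCard_diff (M.removeEdge_subset Q e) (M.region (M.removeEdge Q e) (e, b))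
  have h3 : flagCard Q (M.region (M.removeEdge Q e) (e, b)) =
      4 + flagCard Q (M.region Q (e, !b)) := by
    rw [h.region_removeEdge, flagCard_union _ (M.region_disjoint h.notMem_region), h.four]
  omega

lemma region_removeEdge_of_notMem (h : M.IsBigon Q e e' b b') {x : D × Bool}
    (hx : x ∉ M.region (M.removeEdge Q e) (e, b)) :
    M.region (M.removeEdge Q e) x = M.region Q x ∧
      M.chi (M.removeEdge Q e) (M.region Q x) = M.chi Q (M.region Q x) ∧
      flagCard (M.removeEdge Q e) (M.region Q x) = flagCard Q (M.region Q x) := by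
  have h1 : ∀ c, (e, c) ∉ M.region (M.removeEdge Q e) x := fun c hc =>
    hx (mem_region_trans (both_mem_region (M.notMem_removeEdge Q e) b c) (mem_region_symm hc))
  have h2 := region_addEdge_of_notMem h1
  rw [M.addEdge_removeEdge h.isEdgeSet h.left_mem] at h2
  have h3 : flagCard (Q \ M.removeEdge Q e) (M.region Q x) = 0 := by
    refine flagCard_eq_zero fun y hy hyQ => ?_
    have hc := (M.isClosed_region Q x).along y hy
    rw [h2] at hy hc
    obtain ⟨y, c⟩ := y
    have : y = e ∨ y = M.opp e := by
      by_contra! hne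
      exact hyQ.2 ⟨hyQ.1, hne⟩
    rcases this with rfl | rfl
    · exact h1 _ hy
    · simp only [SignedMap.along, M.opp_opp] at hc
      exact h1 _ hc
  refine ⟨h2.symm, ?_, ?_⟩
  · rw [M.chi_diff (M.removeEdge_subset Q e), h3]
    simp
  · rw [flagCard_diff (M.removeEdge_subset Q e), h3, add_zero]

lemma mem_region_or (h : M.IsBigon Q e e' b b') (x : D × Bool) :
    x ∉ M.region (M.removeEdge Q e) (e, b) ∨ x ∈ M.region Q (e, b) ∨ x ∈ M.region Q (e, !b) := by
  rw [h.region_removeEdge]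
  by_cases hx : x ∈ M.region Q (e, b) ∪ M.region Q (e, !b)
  · exact Or.inr hx
  · exact Or.inl hx

end IsBigon
end Bigons
end SignedMap

/-! ### Goodness of vertices under insertion of parallel edges -/

namespace SignedMap

variable {V D : Type*} (M : SignedMap V D)

section Good
set_option linter.unusedSectionVars false
open scoped Classical
open Finset
variable [Fintype D]

lemma exists_rot_pow_lt {d e : D} (h : M.vert d = M.vert e) :
    ∃ i < M.degree (M.vert d), (M.rot ^ i) d = e := by
  obtain ⟨n, rfl⟩ := M.rot_trans d e h
  refine ⟨n % M.degree (M.vert d), Nat.mod_lt _ (M.degree_pos d), ?_⟩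
  conv_rhs => rw [← Nat.mod_add_div n (M.degree (M.vert d)), pow_add, Equiv.Perm.mul_apply,
    M.rot_pow_eq_self_iff.2 (dvd_mul_right _ _)]

variable {M} in
/-- All negative darts at a good vertex lie between two successive positive darts. -/
lemma IsGood.exists_inCorner {G : Set D} {v : V} (h : M.IsGood G v)
    (hp : ∃ a ∈ M.posPart G, M.vert a = v) :
    ∃ a ∈ M.posPart G, M.vert a = v ∧
      ∀ e ∈ G, M.vert e = v → M.pos e = false → M.InCorner (M.posPart G) a e := by
  obtain ⟨d, rfl, k, hk⟩ := h
  set S : Finset ℕ := {i ∈ range (M.degree (M.vert d)) | (M.rot ^ i) d ∈ M.posPart G} with hS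
  have hmem : ∀ i, i ∈ S ↔ i < M.degree (M.vert d) ∧ (M.rot ^ i) d ∈ M.posPart G := fun i => by
    rw [hS, mem_filter, mem_range]
  have hne : S.Nonempty := by
    obtain ⟨a, ha, hav⟩ := hp
    obtain ⟨i, hi, rfl⟩ := M.exists_rot_pow_lt hav.symm
    exact ⟨i, (hmem i).2 ⟨hi, ha⟩⟩
  obtain ⟨h1, h2⟩ := (hmem _).1 (S.max'_mem hne)
  -- The last positive dart in the order that witnesses goodness; all negative darts come after it.
  set i := S.max' hne with hi
  refine ⟨_, h2, M.vert_rot_pow _ _, fun e he hev hep => ?_⟩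
  obtain ⟨j, hj, rfl⟩ := M.exists_rot_pow_lt hev.symm
  have hik : i < k := (hk i h1 h2.1).1 h2.2
  have hjk : ¬ j < k := fun hjk => by
    rw [(hk j hj he).2 hjk] at hep
    exact absurd hep (by decide)
  have hadd : ∀ t, (M.rot ^ t) ((M.rot ^ i) d) = (M.rot ^ (t + i)) d := fun t => by
    rw [pow_add, Equiv.Perm.mul_apply]
  refine ⟨j - i, by omega, by rw [hadd, Nat.sub_add_cancel (by omega)], fun t ht ht' hm => ?_⟩
  rw [hadd] at hm
  have := S.le_max' (t + i) ((hmem _).2 ⟨by omega, hm⟩)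
  omega

lemma isGood_of_forall_neg {G : Set D} {e : D}
    (h : ∀ d ∈ G, M.vert d = M.vert e → M.pos d = false) : M.IsGood G (M.vert e) :=
  ⟨e, rfl, 0, fun i _ hi => by simp [h _ hi (M.vert_rot_pow i e)]⟩

variable {M} in
lemma InCorner.append {P : Set D} {a x y : D} (h : M.InCorner P a x) {n : ℕ}
    (hxy : (M.rot ^ n) x = y) (hn : ∀ i, 0 < i → i ≤ n → (M.rot ^ i) x ∉ P) : M.InCorner P a y := by
  obtain ⟨m, hm, rfl, hm'⟩ := h
  refine ⟨n + m, by omega, by rw [pow_add, Equiv.Perm.mul_apply, hxy], fun i hi hi' => ?_⟩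
  rcases Nat.lt_or_ge m i with him | him
  · have := hn (i - m) (by omega) (by omega)
    rwa [← Equiv.Perm.mul_apply, ← pow_add, Nat.sub_add_cancel him.le] at this
  · exact hm' i hi him

/-- Inserting a dart next to a dart of the same sign keeps a vertex good. -/
lemma isGood_insert {Q : Set D} {u e : D} {v : V} (hu : u ∈ Q) (hpos : M.pos e = M.pos u)
    (hadj : (∃ n, 0 < n ∧ (M.rot ^ n) u = e ∧ ∀ i, 0 < i → i < n → (M.rot ^ i) u ∉ Q) ∨
      ∃ n, 0 < n ∧ (M.rot ^ n) e = u ∧ ∀ i, 0 < i → i < n → (M.rot ^ i) e ∉ Q)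
    (h : M.IsGood Q v) : M.IsGood (insert e Q) v := by
  by_cases he : e ∈ Q
  · rwa [Set.insert_eq_of_mem he]
  have hve : M.vert e = M.vert u := by
    rcases hadj with ⟨n, -, rfl, -⟩ | ⟨n, -, rfl, -⟩
    exacts [M.vert_rot_pow _ _, (M.vert_rot_pow _ _).symm]
  by_cases hv : M.vert e = v
  swap
  · obtain ⟨d, rfl, k, hk⟩ := h
    refine ⟨d, rfl, k, fun i hi hm => hk i hi (hm.resolve_left fun h' => hv ?_)⟩
    rw [← h', M.vert_rot_pow]
  set P := M.posPart Q with hP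
  have hPQ : P ⊆ Q := M.posPart_subset Q
  have heP : e ∉ P := fun h' => he (hPQ h')
  by_cases hp : ∃ a ∈ P, M.vert a = v
  swap
  · subst hv
    have hn : ∀ d ∈ Q, M.vert d = M.vert e → M.pos d = false := fun d hd hdv => by
      by_contra hdp
      exact hp ⟨d, ⟨hd, by simpa using hdp⟩, hdv⟩
    refine M.isGood_of_forall_neg fun d hd hdv => ?_
    rcases hd with rfl | hd
    · rw [hpos]
      exact hn u hu hve.symm
    · exact hn d hd hdv
  obtain ⟨a, haP, hav, hneg⟩ := h.exists_inCorner hp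
  rw [← hav]
  cases hep : M.pos e with
  | false =>
    have hP' : P = {d | d ∈ insert e Q ∧ M.pos d = true} := by
      ext d
      refine ⟨fun hd => ⟨Or.inr hd.1, hd.2⟩, fun hd => ⟨hd.1.resolve_left fun h' => ?_, hd.2⟩⟩
      have hdp : M.pos d = true := hd.2
      rw [h', hep] at hdp
      exact absurd hdp (by decide)
    refine M.isGood_of_inCorner hP' haP fun w hw hwv hwp => ?_
    rcases hw with rfl | hw
    swap
    · exact hneg w hw (hwv.trans hav) hwp
    have huP : u ∉ P := fun h' => by
      rw [hpos, h'.2] at hep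
      exact absurd hep (by decide)
    have huc := hneg u hu (hve.symm.trans hv) (hpos ▸ hep)
    rcases hadj with ⟨n, hn, hnu, hn'⟩ | ⟨n, hn, hnu, hn'⟩
    · refine huc.append hnu fun i hi hi' hm => ?_
      rcases hi'.eq_or_lt with rfl | hlt
      · exact heP (hnu ▸ hm)
      · exact hn' i hi hlt (hPQ hm)
    · obtain ⟨a', ha', hc⟩ := M.exists_inCorner haP heP (hav.trans hv.symm)
      have hc' : M.InCorner P a' u := by
        refine hc.append hnu fun i hi hi' hm => ?_
        rcases hi'.eq_or_lt with rfl | hlt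
        · exact huP (hnu ▸ hm)
        · exact hn' i hi hlt (hPQ hm)
      rwa [InCorner.unique haP ha' huc hc']
  | true =>
    have huP : u ∈ P := ⟨hu, hpos ▸ hep⟩
    have hP' : insert e P = {d | d ∈ insert e Q ∧ M.pos d = true} := by
      ext d
      constructor
      · rintro (rfl | hd)
        exacts [⟨Or.inl rfl, hep⟩, ⟨Or.inr hd.1, hd.2⟩]
      · rintro ⟨rfl | hd, hdp⟩
        exacts [Or.inl rfl, Or.inr ⟨hd, hdp⟩]
    have hnegQ : ∀ w, w ∈ insert e Q → M.pos w = false → w ∈ Q := fun w hw hwp =>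
      hw.resolve_left fun h' => by
        rw [h', hep] at hwp
        exact absurd hwp (by decide)
    -- The corner of the negative darts begins with `a`, unless the new positive dart comes directly
    -- after `a`; then it begins with the new one.
    by_cases hcase : u = a ∧ ∃ n, 0 < n ∧ (M.rot ^ n) u = e ∧
        ∀ i, 0 < i → i < n → (M.rot ^ i) u ∉ Q
    · obtain ⟨rfl, n, hn, hnu, hn'⟩ := hcase
      rw [hav, ← hv]
      refine M.isGood_of_inCorner hP' (Or.inl rfl) fun w hw hwv hwp => ?_
      have hwQ := hnegQ w hw hwp
      obtain ⟨m, hm, hmu, hm'⟩ := hneg w hwQ (hwv.trans hv) hwp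
      have hnm : n < m := by
        rcases lt_trichotomy m n with h' | h' | h'
        · exact absurd (hmu ▸ hwQ) (hn' m hm h')
        · subst h'
          exact absurd (hnu ▸ hmu ▸ hwQ) he
        · exact h'
      have hadd : ∀ t, (M.rot ^ t) e = (M.rot ^ (t + n)) u := fun t => by
        rw [pow_add, Equiv.Perm.mul_apply, hnu]
      refine ⟨m - n, by omega, by rw [hadd, Nat.sub_add_cancel hnm.le, hmu], fun i hi hi' hmem => ?_⟩
      rcases hmem with h' | h'
      · rw [M.rot_pow_eq_self_iff, hve] at h'
        rw [← M.rot_pow_eq_self_iff] at h'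
        exact hm' i hi (by omega) (h'.symm ▸ huP)
      · rw [hadd] at h'
        exact hm' _ (by omega) (by omega) h'
    · refine M.isGood_of_inCorner hP' (Or.inr haP) fun w hw hwv hwp => ?_
      have hwQ := hnegQ w hw hwp
      obtain ⟨m, hm, hmu, hm'⟩ := hneg w hwQ (hwv.trans hav) hwp
      refine ⟨m, hm, hmu, fun i hi hi' hmem => ?_⟩
      rcases hmem with h' | h'
      swap
      · exact hm' i hi hi' h'
      have hae : M.InCorner P a e := ⟨i, hi, h', fun j hj hj' => hm' j hj (hj'.trans hi')⟩
      have hadd : ∀ t, (M.rot ^ t) e = (M.rot ^ (t + i)) a := fun t => by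
        rw [pow_add, Equiv.Perm.mul_apply, h']
      rcases hadj with ⟨n, hn, hnu, hn'⟩ | ⟨n, hn, hnu, hn'⟩
      · refine hcase ⟨InCorner.unique huP haP ⟨n, hn, hnu, fun j hj hj' hmem => ?_⟩ hae,
          n, hn, hnu, hn'⟩
        rcases hj'.eq_or_lt with rfl | hlt
        · exact heP (hnu ▸ hmem)
        · exact hn' j hj hlt (hPQ hmem)
      · have him : i < m := lt_of_le_of_ne hi' fun h'' => he (h' ▸ h'' ▸ hmu ▸ hwQ)
        rcases lt_trichotomy (m - i) n with h'' | h'' | h''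
        · refine hn' (m - i) (by omega) h'' ?_
          rw [hadd, Nat.sub_add_cancel him.le, hmu]
          exact hwQ
        · have : w = u := by rw [← hnu, ← h'', hadd, Nat.sub_add_cancel him.le, hmu]
          rw [this, huP.2] at hwp
          exact absurd hwp (by decide)
        · refine hm' (n + i) (by omega) (by omega) ?_
          rw [← hadd, hnu]
          exact huP

variable {M} in
lemma IsBigon.isGood {Q : Set D} {e e' : D} {b b' : Bool} (h : M.IsBigon Q e e' b b') {v : V}
    (hg : M.IsGood (M.removeEdge Q e) v) : M.IsGood Q v := by
  obtain ⟨u, hu, h1, h2⟩ := h.exists_twin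
  have hQ' := M.isEdgeSet_removeEdge h.isEdgeSet e
  have he' : e' ∈ M.removeEdge Q e := ⟨h.right_mem, h.ne, h.ne_opp⟩
  have huQ : u ∈ M.removeEdge Q e := by
    rcases hu with rfl | rfl
    exacts [he', hQ' _ he']
  have hup : M.pos u = M.pos e := by
    rcases hu with rfl | rfl
    · exact h.pos_eq
    · rw [M.pos_opp, h.pos_eq]
  have key : ∀ {x y : D} {Q' : Set D}, Q' ⊆ Q → x ∈ Q → y ∈ Q →
      (M.next Q x = y ∨ M.next Q y = x) →
      (∃ n, 0 < n ∧ (M.rot ^ n) y = x ∧ ∀ i, 0 < i → i < n → (M.rot ^ i) y ∉ Q') ∨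
      ∃ n, 0 < n ∧ (M.rot ^ n) x = y ∧ ∀ i, 0 < i → i < n → (M.rot ^ i) x ∉ Q' := by
    intro x y Q' hsub hx hy hxy
    rcases hxy with hxy | hxy
    · obtain ⟨n, k1, k2, -, k3⟩ := M.next_spec hx
      exact Or.inr ⟨n, k1, k2.trans hxy, fun i hi hi' hm => k3 i hi hi' (hsub hm)⟩
    · obtain ⟨n, k1, k2, -, k3⟩ := M.next_spec hy
      exact Or.inl ⟨n, k1, k2.trans hxy, fun i hi hi' hm => k3 i hi hi' (hsub hm)⟩
  have hsub : insert e (M.removeEdge Q e) ⊆ Q :=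
    Set.insert_subset h.left_mem (M.removeEdge_subset Q e)
  have g1 := M.isGood_insert huQ hup.symm
    (key (M.removeEdge_subset Q e) h.left_mem huQ.1 h1) hg
  have g2 := M.isGood_insert (u := M.opp u) (e := M.opp e) (Or.inr (hQ' _ huQ))
    (by rw [M.pos_opp, M.pos_opp, hup])
    (key hsub (h.isEdgeSet _ h.left_mem) (hQ' _ huQ).1 h2) g1
  rwa [Set.insert_comm, ← addEdge, M.addEdge_removeEdge h.isEdgeSet h.left_mem] at g2

end Good
end SignedMap

/-! ### Passing to the reduced graph -/

namespace SignedMap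

variable {V D : Type*} (M : SignedMap V D)

section Reduction
set_option linter.unusedSectionVars false
open scoped Classical
open Finset
variable [Fintype D]

variable {M} in
lemma coboundBigon_iff {Q : Set D} (hQ : M.IsEdgeSet Q) {d d' : D} :
    M.CoboundBigon Q d d' ↔ d ∈ Q ∧ d' ∈ Q ∧ ∃ x, M.chi Q (M.region Q x) = 1 ∧
      flagCard Q (M.region Q x) = 4 ∧
      ∃ b b', (d, b) ∈ M.region Q x ∧ (d', b') ∈ M.region Q x := by
  unfold CoboundBigon
  refine and_congr_right fun _ => and_congr_right fun _ => ?_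
  constructor
  · rintro ⟨b, b', h, hm⟩
    rw [M.isDiskFace_iff hQ] at h
    exact ⟨(d, b), h.1, h.2, b, b', M.mem_region_self _ _, hm⟩
  · rintro ⟨x, h1, h2, b, b', hm, hm'⟩
    rw [← region_eq hm] at h1 h2 hm'
    exact ⟨b, b', (M.isDiskFace_iff hQ _ _).2 ⟨h1, h2⟩, hm'⟩

/-- Two edges are parallel or equal. -/
def EdgeParallel (Q : Set D) : D → D → Prop :=
  Relation.EqvGen fun d d' => M.CoboundBigon Q d d' ∨ d' = M.opp d

namespace EdgeParallel
variable {M} {Q : Set D} {d d' d'' : D}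

lemma refl (d : D) : M.EdgeParallel Q d d := Relation.EqvGen.refl _

lemma symm (h : M.EdgeParallel Q d d') : M.EdgeParallel Q d' d := Relation.EqvGen.symm _ _ h

lemma trans (h : M.EdgeParallel Q d d') (h' : M.EdgeParallel Q d' d'') : M.EdgeParallel Q d d'' :=
  Relation.EqvGen.trans _ _ _ h h'

lemma of_cobound (h : M.CoboundBigon Q d d') : M.EdgeParallel Q d d' :=
  Relation.EqvGen.rel _ _ (Or.inl h)

lemma opp (d : D) : M.EdgeParallel Q d (M.opp d) := Relation.EqvGen.rel _ _ (Or.inr rfl)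

lemma of_parallel (h : M.Parallel Q d d') : M.EdgeParallel Q d d' :=
  Relation.EqvGen.mono (fun _ _ => Or.inl) _ _ h

end EdgeParallel

variable {M} in
lemma CoboundBigon.opp_left {Q : Set D} (hQ : M.IsEdgeSet Q) {d d' : D}
    (h : M.CoboundBigon Q d d') : M.CoboundBigon Q (M.opp d) d' := by
  rw [coboundBigon_iff hQ] at h ⊢
  obtain ⟨h1, h2, x, h3, h4, b, b', h5, h6⟩ := h
  exact ⟨hQ _ h1, h2, x, h3, h4, _, b', (M.isClosed_region Q x).along _ h5, h6⟩

variable {M} in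
lemma CoboundBigon.opp_right {Q : Set D} (hQ : M.IsEdgeSet Q) {d d' : D}
    (h : M.CoboundBigon Q d d') : M.CoboundBigon Q d (M.opp d') := by
  rw [coboundBigon_iff hQ] at h ⊢
  obtain ⟨h1, h2, x, h3, h4, b, b', h5, h6⟩ := h
  exact ⟨h1, hQ _ h2, x, h3, h4, b, _, h5, (M.isClosed_region Q x).along _ h6⟩

variable {M} in
lemma Parallel.opp_opp {Q : Set D} (hQ : M.IsEdgeSet Q) {d d' : D}
    (h : M.Parallel Q d d') : M.Parallel Q (M.opp d) (M.opp d') := by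
  change Relation.EqvGen _ d d' at h
  induction h with
  | rel a b hab => exact Relation.EqvGen.rel _ _ ((hab.opp_left hQ).opp_right hQ)
  | refl a => exact Relation.EqvGen.refl _
  | symm a b _ ih => exact Relation.EqvGen.symm _ _ ih
  | trans a b c _ _ ih1 ih2 => exact Relation.EqvGen.trans _ _ _ ih1 ih2

variable {M} in
-- Bigons do not distinguish the two darts of an edge, so reversals can be collected at the end of a
-- chain.
lemma EdgeParallel.parallel_or {Q : Set D} (hQ : M.IsEdgeSet Q) {d d' : D}
    (h : M.EdgeParallel Q d d') : M.Parallel Q d d' ∨ M.Parallel Q d (M.opp d') := by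
  change Relation.EqvGen _ d d' at h
  induction h with
  | rel a b hab =>
    rcases hab with hab | rfl
    · exact Or.inl (Relation.EqvGen.rel _ _ hab)
    · right
      rw [M.opp_opp]
      exact Relation.EqvGen.refl _
  | refl a => exact Or.inl (Relation.EqvGen.refl _)
  | symm a b _ ih =>
    refine ih.imp (Relation.EqvGen.symm _ _) fun h => ?_
    have := Parallel.opp_opp hQ h
    rw [M.opp_opp] at this
    exact Relation.EqvGen.symm _ _ this
  | trans a b c _ _ ih1 ih2 =>
    rcases ih1 with h1 | h1 <;> rcases ih2 with h2 | h2
    · exact Or.inl (Relation.EqvGen.trans _ _ _ h1 h2)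
    · exact Or.inr (Relation.EqvGen.trans _ _ _ h1 h2)
    · exact Or.inr (Relation.EqvGen.trans _ _ _ h1 (Parallel.opp_opp hQ h2))
    · left
      have := Parallel.opp_opp hQ h2
      rw [M.opp_opp] at this
      exact Relation.EqvGen.trans _ _ _ h1 this

/-- An intermediate graph between `G` and its reduced graph `H`. -/
structure IsPartialReduction (G H Q : Set D) : Prop where
  subset : H ⊆ Q
  isEdgeSet : M.IsEdgeSet Q
  two_ne : ∀ x, M.chi Q (M.region Q x) = 1 → flagCard Q (M.region Q x) ≠ 2
  exists_parallel : ∀ d ∈ Q, ∃ h ∈ H, M.EdgeParallel Q d h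
  eq_of_parallel : ∀ h ∈ H, ∀ h' ∈ H, M.EdgeParallel Q h h' → h' = h ∨ h' = M.opp h
  isGood : ∀ v, M.IsGood Q v → M.IsGood G v
  exists_twin : ∀ d ∈ G, ∃ d' ∈ Q, M.vert d' = M.vert d ∧ M.vert (M.opp d') = M.vert (M.opp d) ∧
    M.pos d' = M.pos d

variable {M} in
lemma IsReducedGraph.isPartialReduction {G H : Set D} (h : M.IsReducedGraph G H)
    (hG : M.IsEdgeSet G) (htriv : M.NoTrivialLoops G) : M.IsPartialReduction G H G := by
  obtain ⟨h1, h2, h3, h4⟩ := h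
  refine ⟨h1, hG, fun x hx h2 => htriv x ((M.isDiskFace_iff hG x 1).2 ⟨hx, h2⟩), fun d hd => ?_,
    fun d hd d' hd' hp => ?_, fun _ h => h, fun d hd => ⟨d, hd, rfl, rfl, rfl⟩⟩
  · obtain ⟨d', hd', hp⟩ := h3 d hd
    exact ⟨d', hd', .of_parallel hp⟩
  · rcases hp.parallel_or hG with hp | hp
    · exact h4 d hd d' hd' hp
    · rcases h4 d hd _ (h2 _ hd') hp with h' | h'
      · exact Or.inr (by rw [← h', M.opp_opp])
      · exact Or.inl (M.opp_injective h')

variable {M} in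
lemma IsBigon.coboundBigon {Q : Set D} {e e' : D} {b b' : Bool} (h : M.IsBigon Q e e' b b') :
    M.CoboundBigon Q e e' :=
  (coboundBigon_iff h.isEdgeSet).2
    ⟨h.left_mem, h.right_mem, (e, b), h.chi, h.four, b, b', M.mem_region_self _ _, h.mem⟩

variable {M} in
lemma IsBigon.eq_or {Q : Set D} {e e' : D} {b b' : Bool} (h : M.IsBigon Q e e' b b') {d : D}
    {c : Bool} (hd : (d, c) ∈ M.region Q (e, b)) (hdQ : d ∈ Q) :
    (d = e ∨ d = M.opp e) ∨ d = e' ∨ d = M.opp e' := by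
  rcases h.flags hd hdQ with h' | h' | h' | h'
  · exact Or.inl (Or.inl (congrArg Prod.fst h'))
  · exact Or.inl (Or.inr (congrArg Prod.fst h'))
  · exact Or.inr (Or.inl (congrArg Prod.fst h'))
  · exact Or.inr (Or.inr (congrArg Prod.fst h'))

variable {M} in
-- A bigon of the smaller graph either was one before, or arose by merging the bigon at `e` with
-- another bigon across `e`. In that case each of its sides is parallel to `e` in `Q`.
lemma IsBigon.edgeParallel_of_cobound {Q : Set D} {e e' : D} {b b' : Bool}
    (h : M.IsBigon Q e e' b b') {d d' : D} (hd : M.CoboundBigon (M.removeEdge Q e) d d') :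
    M.EdgeParallel Q d d' := by
  obtain ⟨h1, h2, x, hx, hx4, c, c', hc, hc'⟩ :=
    (coboundBigon_iff (M.isEdgeSet_removeEdge h.isEdgeSet e)).1 hd
  have hsub := M.removeEdge_subset Q e
  by_cases hm : x ∈ M.region (M.removeEdge Q e) (e, b)
  swap
  · obtain ⟨k1, k2, k3⟩ := h.region_removeEdge_of_notMem hm
    rw [k1] at hx hx4 hc hc'
    exact .of_cobound ((coboundBigon_iff h.isEdgeSet).2
      ⟨hsub h1, hsub h2, x, by rw [← k2, hx], by rw [← k3, hx4], c, c', hc, hc'⟩)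
  · rw [region_eq hm, h.chi_removeEdge] at hx
    rw [region_eq hm, h.flagCard_removeEdge] at hx4
    rw [region_eq hm, h.region_removeEdge] at hc hc'
    have left : ∀ u c, u ∈ M.removeEdge Q e → (u, c) ∈ M.region Q (e, b) →
        M.EdgeParallel Q u e := by
      intro u c hu huc
      rcases h.eq_or huc (hsub hu) with (rfl | rfl) | rfl | rfl
      · exact .refl _
      · exact (EdgeParallel.opp _).symm
      · exact (EdgeParallel.of_cobound h.coboundBigon).symm
      · exact (EdgeParallel.opp _).symm.trans (EdgeParallel.of_cobound h.coboundBigon).symm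
    have right : ∀ u c, u ∈ M.removeEdge Q e → (u, c) ∈ M.region Q (e, !b) →
        M.EdgeParallel Q u e := fun u c hu huc =>
      .of_cobound ((coboundBigon_iff h.isEdgeSet).2 ⟨hsub hu, h.left_mem, _, hx, hx4, c, _, huc,
        M.mem_region_self _ _⟩)
    have both : ∀ u c, u ∈ M.removeEdge Q e →
        (u, c) ∈ M.region Q (e, b) ∪ M.region Q (e, !b) → M.EdgeParallel Q u e :=
      fun u c hu huc => huc.elim (left u c hu) (right u c hu)
    exact (both d c h1 hc).trans (both d' c' h2 hc').symm

variable {M} in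
lemma IsBigon.edgeParallel_of_removeEdge {Q : Set D} {e e' : D} {b b' : Bool}
    (h : M.IsBigon Q e e' b b') {d d' : D} (hd : M.EdgeParallel (M.removeEdge Q e) d d') :
    M.EdgeParallel Q d d' := by
  change Relation.EqvGen _ d d' at hd
  induction hd with
  | rel x y hxy =>
    rcases hxy with hxy | rfl
    · exact h.edgeParallel_of_cobound hxy
    · exact .opp _
  | refl x => exact .refl _
  | symm x y _ ih => exact ih.symm
  | trans x y z _ _ ih1 ih2 => exact ih1.trans ih2

variable {M} in
-- In a chain of parallel edges `e` can be replaced by `e'`: a bigon on the other side of `e`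
-- becomes the merged bigon with side `e'`.
lemma IsBigon.removeEdge_edgeParallel {Q : Set D} {e e' : D} {b b' : Bool}
    (h : M.IsBigon Q e e' b b') {d d' : D} (hd : M.EdgeParallel Q d d') :
    M.EdgeParallel (M.removeEdge Q e) (if d = e ∨ d = M.opp e then e' else d)
      (if d' = e ∨ d' = M.opp e then e' else d') := by
  set f : D → D := fun d => if d = e ∨ d = M.opp e then e' else d with hf
  have f1 : ∀ u, (u = e ∨ u = M.opp e) → f u = e' := fun u hu => if_pos hu
  have f2 : ∀ u, ¬ (u = e ∨ u = M.opp e) → f u = u := fun u hu => if_neg hu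
  have hQ' := M.isEdgeSet_removeEdge h.isEdgeSet e
  have he' : e' ∈ M.removeEdge Q e := ⟨h.right_mem, h.ne, h.ne_opp⟩
  have f3 : ∀ u ∈ Q, f u ∈ M.removeEdge Q e := by
    intro u hu
    by_cases hue : u = e ∨ u = M.opp e
    · rwa [f1 u hue]
    · rw [f2 u hue]
      exact ⟨hu, not_or.1 hue⟩
  change M.EdgeParallel (M.removeEdge Q e) (f d) (f d')
  change Relation.EqvGen _ d d' at hd
  induction hd with
  | refl x => exact .refl _
  | symm x y _ ih => exact ih.symm
  | trans x y z _ _ ih1 ih2 => exact ih1.trans ih2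
  | rel u w huw =>
    rcases huw with huw | rfl
    swap
    · by_cases hue : u = e ∨ u = M.opp e
      · rw [f1 u hue, f1 (M.opp u)]
        · exact .refl _
        · rcases hue with rfl | rfl
          exacts [Or.inr rfl, Or.inl (M.opp_opp _)]
      · rw [f2 u hue, f2 (M.opp u)]
        · exact .opp _
        · rintro (h' | h')
          · exact hue (Or.inr (by rw [← h', M.opp_opp]))
          · exact hue (Or.inl (M.opp_injective h'))
    obtain ⟨h1, h2, x, hx, hx4, c, c', hc, hc'⟩ := (coboundBigon_iff h.isEdgeSet).1 huw
    rcases h.mem_region_or x with hm | hm | hm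
    · obtain ⟨k1, k2, k3⟩ := h.region_removeEdge_of_notMem hm
      have hout : ∀ u c, (u, c) ∈ M.region Q x → f u = u := by
        intro u c hu
        refine f2 u fun hue => ?_
        have : ∃ c, (e, c) ∈ M.region Q x := by
          rcases hue with rfl | rfl
          · exact ⟨c, hu⟩
          · have := (M.isClosed_region Q x).along _ hu
            simp only [SignedMap.along, M.opp_opp] at this
            exact ⟨_, this⟩
        obtain ⟨c, hc⟩ := this
        rw [← k1] at hc
        exact hm (mem_region_trans (both_mem_region (M.notMem_removeEdge Q e) b c)
          (mem_region_symm hc))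
      have g1 := f3 u h1
      have g2 := f3 w h2
      rw [hout u c hc] at g1 ⊢
      rw [hout w c' hc'] at g2 ⊢
      exact .of_cobound ((coboundBigon_iff hQ').2
        ⟨g1, g2, x, by rw [k1, k2, hx], by rw [k1, k3, hx4], c, c', k1 ▸ hc, k1 ▸ hc'⟩)
    · rw [region_eq hm] at hc hc'
      have hpi : ∀ u c, (u, c) ∈ M.region Q (e, b) → u ∈ Q →
          M.EdgeParallel (M.removeEdge Q e) (f u) e' := by
        intro u c hu huQ
        by_cases hue : u = e ∨ u = M.opp e
        · rw [f1 u hue]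
          exact .refl _
        · rw [f2 u hue]
          rcases (h.eq_or hu huQ).resolve_left hue with rfl | rfl
          · exact .refl _
          · exact (EdgeParallel.opp _).symm
      exact (hpi u c hc h1).trans (hpi w c' hc' h2).symm
    · rw [region_eq hm] at hx hx4 hc hc'
      have hpi : ∀ u c, (u, c) ∈ M.region Q (e, !b) →
          ∃ c, (f u, c) ∈ M.region (M.removeEdge Q e) (e, b) := by
        intro u c hu
        rw [h.region_removeEdge]
        by_cases hue : u = e ∨ u = M.opp e
        · rw [f1 u hue]
          exact ⟨b', Or.inl h.mem⟩
        · rw [f2 u hue]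
          exact ⟨c, Or.inr hu⟩
      obtain ⟨c₁, hc₁⟩ := hpi u c hc
      obtain ⟨c₂, hc₂⟩ := hpi w c' hc'
      exact .of_cobound ((coboundBigon_iff hQ').2 ⟨f3 u h1, f3 w h2, (e, b),
        by rw [h.chi_removeEdge, hx], by rw [h.flagCard_removeEdge, hx4], c₁, c₂, hc₁, hc₂⟩)

namespace IsPartialReduction
variable {M} {G H Q : Set D}

lemma removeEdge (h : M.IsPartialReduction G H Q) (hH : M.IsEdgeSet H) {e e' : D} {b b' : Bool}
    (hb : M.IsBigon Q e e' b b') (he : e ∉ H) : M.IsPartialReduction G H (M.removeEdge Q e) := by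
  have hHe : ∀ d ∈ H, ¬ (d = e ∨ d = M.opp e) := by
    rintro d hd (rfl | rfl)
    · exact he hd
    · exact he (by simpa [M.opp_opp] using hH _ hd)
  refine ⟨fun d hd => ⟨h.subset hd, not_or.1 (hHe d hd)⟩, M.isEdgeSet_removeEdge hb.isEdgeSet e,
    fun x hx => ?_, fun d hd => ?_, fun d hd d' hd' hp => ?_, fun v hv => h.isGood v (hb.isGood hv),
    fun d hd => ?_⟩
  · by_cases hm : x ∈ M.region (M.removeEdge Q e) (e, b)
    · rw [region_eq hm, hb.chi_removeEdge] at hx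
      rw [region_eq hm, hb.flagCard_removeEdge]
      exact h.two_ne _ hx
    · obtain ⟨k1, k2, k3⟩ := hb.region_removeEdge_of_notMem hm
      rw [k1, k2] at hx
      rw [k1, k3]
      exact h.two_ne _ hx
  · obtain ⟨d', hd', hp⟩ := h.exists_parallel d hd.1
    have := hb.removeEdge_edgeParallel hp
    rw [if_neg (not_or.2 hd.2), if_neg (hHe d' hd')] at this
    exact ⟨d', hd', this⟩
  · exact h.eq_of_parallel d hd d' hd' (hb.edgeParallel_of_removeEdge hp)
  · obtain ⟨d', hd', h1, h2, h3⟩ := h.exists_twin d hd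
    by_cases hde : d' = e ∨ d' = M.opp e
    swap
    · exact ⟨d', ⟨hd', not_or.1 hde⟩, h1, h2, h3⟩
    obtain ⟨u, hu, k1, k2⟩ := hb.exists_twin
    have hQ' := M.isEdgeSet_removeEdge hb.isEdgeSet e
    have he' : e' ∈ M.removeEdge Q e := ⟨hb.right_mem, hb.ne, hb.ne_opp⟩
    have huQ : u ∈ M.removeEdge Q e := by
      rcases hu with rfl | rfl
      exacts [he', hQ' _ he']
    have hup : M.pos u = M.pos e := by
      rcases hu with rfl | rfl
      · exact hb.pos_eq
      · rw [M.pos_opp, hb.pos_eq]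
    have hvert : ∀ {x y : D}, (M.next Q x = y ∨ M.next Q y = x) → M.vert y = M.vert x := by
      rintro x y (rfl | rfl)
      exacts [M.vert_next _ _, (M.vert_next _ _).symm]
    rcases hde with rfl | rfl
    · exact ⟨u, huQ, (hvert k1).trans h1, (hvert k2).trans h2, hup.trans h3⟩
    · rw [M.opp_opp] at h2
      rw [M.pos_opp] at h3
      exact ⟨M.opp u, hQ' _ huQ, (hvert k2).trans h1, by rw [M.opp_opp]; exact (hvert k1).trans h2,
        by rw [M.pos_opp]; exact hup.trans h3⟩

/-- If both edges of every bigon belonged to `H`, membership in `H` would be constant along chains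
of parallel edges. Every such class in `Q` meets `H`, so `Q` would equal `H`. -/
lemma exists_isBigon (h : M.IsPartialReduction G H Q) (hH : M.IsEdgeSet H) (hne : Q ≠ H) :
    ∃ e e' b b', M.IsBigon Q e e' b b' ∧ e ∉ H := by
  by_contra! hno
  have key : ∀ d d', M.EdgeParallel Q d d' → (d ∈ H ↔ d' ∈ H) := by
    intro d d' hd
    change Relation.EqvGen _ d d' at hd
    induction hd with
    | refl x => rfl
    | symm x y _ ih => exact ih.symm
    | trans x y z _ _ ih1 ih2 => exact ih1.trans ih2
    | rel u w huw =>
      rcases huw with huw | rfl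
      swap
      · exact hH.opp_mem_iff.symm
      obtain ⟨h1, h2, x, hx, hx4, c, c', hc, hc'⟩ := (coboundBigon_iff h.isEdgeSet).1 huw
      by_cases hwu : w = u ∨ w = M.opp u
      · rcases hwu with rfl | rfl
        exacts [Iff.rfl, hH.opp_mem_iff.symm]
      have hb : M.IsBigon Q u w c c' := ⟨h.isEdgeSet, h1, h2, (not_or.1 hwu).1, (not_or.1 hwu).2,
        by rw [region_eq hc, hx], by rw [region_eq hc, hx4], by rw [region_eq hc]; exact hc'⟩
      exact ⟨fun _ => hno _ _ _ _ hb.symm, fun _ => hno _ _ _ _ hb⟩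
  refine hne (Set.Subset.antisymm (fun d hd => ?_) h.subset)
  obtain ⟨d', hd', hp⟩ := h.exists_parallel d hd
  exact (key d d' hp).2 hd'

lemma reduce (h : M.IsPartialReduction G H Q) (hH : M.IsEdgeSet H) :
    M.IsPartialReduction G H H := by
  induction hn : Q.ncard using Nat.strong_induction_on generalizing Q with
  | _ n ih =>
  subst hn
  by_cases hne : Q = H
  · exact hne ▸ h
  obtain ⟨e, e', b, b', hb, he⟩ := h.exists_isBigon hH hne
  refine ih _ ?_ (h.removeEdge hH hb he) rfl
  refine Set.ncard_lt_ncard ⟨M.removeEdge_subset Q e, fun hs => ?_⟩ (Set.toFinite _)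
  exact M.notMem_removeEdge Q e (hs hb.left_mem)

/-- Sides come in pairs of flags and one side is excluded, so a small disk has no side or two. Two
different edges would be parallel in `H`. In the remaining cases the disk has both sides of every
edge it meets, so it fills the surface, and then Euler's formula contradicts `|V| ≥ 3`. -/
lemma noSmallDisks (h : M.IsPartialReduction G H H) (hM : M.IsKleinBottle)
    (hp : 3 ≤ Nat.card V) : M.NoSmallDisks H := by
  intro x hx
  have hS := M.isClosed_region H x
  by_contra! hlt
  obtain ⟨k, hk⟩ := hS.even_flagCard h.isEdgeSet
  have h2 := h.two_ne x hx
  have hcl : ∀ d b, (d, b) ∈ M.region H x → (d, !b) ∈ M.region H x := by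
    intro d b hd
    by_cases hdH : d ∈ H
    swap
    · exact hS.cross _ hd hdH
    by_contra hn
    have hsub : ({(d, b), M.along (d, b)} : Finset (D × Bool)) ⊆
        ({y | y ∈ M.region H x ∧ y.1 ∈ H} : Finset (D × Bool)) := by
      intro y hy
      rw [mem_filter_univ]
      rw [mem_insert, mem_singleton] at hy
      rcases hy with rfl | rfl
      · exact ⟨hd, hdH⟩
      · exact ⟨hS.along _ hd, h.isEdgeSet _ hdH⟩
    have hc2 : #({(d, b), M.along (d, b)} : Finset (D × Bool)) = 2 :=
      card_pair fun h' => M.opp_ne d (congrArg Prod.fst h').symm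
    have hle : 2 ≤ flagCard H (M.region H x) := hc2 ▸ card_le_card hsub
    have h4 : flagCard H (M.region H x) = 4 := by omega
    obtain ⟨⟨d', b'⟩, hy, hyn⟩ : ∃ y ∈ ({y | y ∈ M.region H x ∧ y.1 ∈ H} : Finset (D × Bool)),
        y ∉ ({(d, b), M.along (d, b)} : Finset (D × Bool)) := by
      by_contra! hall
      have := card_le_card hall
      rw [hc2] at this
      have h5 : flagCard H (M.region H x) ≤ 2 := this
      omega
    rw [mem_filter_univ] at hy
    rw [mem_insert, mem_singleton, not_or] at hyn
    have hco : M.CoboundBigon H d d' :=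
      (coboundBigon_iff h.isEdgeSet).2 ⟨hdH, hy.2, x, hx, h4, b, b', hd, hy.1⟩
    rcases h.eq_of_parallel d hdH d' hy.2 (.of_cobound hco) with rfl | rfl
    · have : b' = !b := by
        have : b' ≠ b := fun h' => hyn.1 (h' ▸ rfl)
        cases b <;> cases b' <;> simp_all
      exact hn (this ▸ hy.1)
    · have : b' = !(xor b (M.pos d)) := by
        have : b' ≠ xor b (M.pos d) := fun h' => hyn.2 (h' ▸ rfl)
        generalize xor b (M.pos d) = t at *
        cases t <;> cases b' <;> simp_all
      have h6 := hS.along _ hy.1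
      rw [this] at h6
      have h7 : (d, xor (!(xor b (M.pos d))) (M.pos d)) ∈ M.region H x := by
        simpa [SignedMap.along, M.opp_opp, M.pos_opp] using h6
      have h8 : xor (!(xor b (M.pos d))) (M.pos d) = !b := by
        cases b <;> cases M.pos d <;> rfl
      exact hn (h8 ▸ h7)
  have huniv := IsClosed.eq_univ hM.1 hS hcl (M.mem_region_self _ _)
  have h3 := M.chi_univ hM H
  have h4 := flagCard_univ H
  rw [← huniv] at h3 h4
  rw [hx] at h3
  have h5 : H.ncard ≤ 2 := by omega
  have h5' : (H.ncard : ℚ) ≤ 2 := by exact_mod_cast h5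
  have h6 : (3 : ℚ) ≤ Nat.card V := by exact_mod_cast hp
  linarith

end IsPartialReduction

end Reduction

end SignedMap

/-! ### The theorem -/

theorem proposition10 {V D : Type*} [Finite V] [Finite D]
    (M : SignedMap V D) (hM : M.IsKleinBottle) (hp : 3 ≤ Nat.card V)
    (G : Set D) (hG : M.IsEdgeSet G)
    (htriv : M.NoTrivialLoops G) (hint : ∀ v, ¬ M.IsInterior G v)
    (H : Set D) (hH : M.IsReducedGraph G H) :
    (∃ v, M.IsGood G v ∧ M.posDegree H v = 4 ∧ M.negLoops G v = ∅) ∨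
    (∃ v, M.posDegree H v ≤ 3 ∧ M.negLoops G v = ∅) ∨
    (∃ v, M.posDegree H v ≤ 2 ∧ (M.negLoops H v).ncard = 1) ∨
    (M.IsCopy SignedMap.exceptional₁ H ∨ M.IsCopy SignedMap.exceptional₂ H) := by
  classical
  by_contra hcon
  simp only [not_or, not_exists, not_and] at hcon
  obtain ⟨hcon1, hcon2, hcon3, hcopy1, hcopy2⟩ := hcon
  have := Fintype.ofFinite D
  have := Fintype.ofFinite V
  have hred := (hH.isPartialReduction hG htriv).reduce hH.2.1
  -- Conclusions 1 and 2 speak of negative loops of `G`. Each of these has a twin in `H` with the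
  -- same ends and sign, so it suffices to look at `H`.
  have hloops : ∀ v, M.negLoops H v = ∅ → M.negLoops G v = ∅ := by
    intro v hv
    rw [Set.eq_empty_iff_forall_notMem]
    rintro _ ⟨d, ⟨hd, h1, h2, h3⟩, rfl⟩
    obtain ⟨d', hd', k1, k2, k3⟩ := hred.exists_twin d hd
    exact Set.eq_empty_iff_forall_notMem.1 hv (M.edge d')
      ⟨d', ⟨hd', k1.trans h1, k2.trans h2, k3.trans h3⟩, rfl⟩
  have hext : M.IsExtremal H := by
    refine ⟨hM, hp, hH.2.1, hred.noSmallDisks hM hp, fun v => ?_,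
      fun v hg hd hl => hcon1 v (hred.isGood v hg) hd (hloops v hl),
      fun v hd hl => hcon2 v hd (hloops v hl), hcon3⟩
    have := hint v
    unfold SignedMap.IsInterior at this
    push Not at this
    obtain ⟨d, hd, hv, hpos⟩ := this
    obtain ⟨d', hd', k1, -, k3⟩ := hred.exists_twin d hd
    exact ⟨d', hd', k1.trans hv, k3.trans (by simpa using hpos)⟩
  obtain ⟨h0, hle, x, y, hxy, hlx, hly, hcases⟩ := hext.numeric
  rcases hcases with ⟨z, huniv, hzx, hzy, hlz, hcases⟩ |
    ⟨z, w, huniv, hzx, hzy, hwx, hwy, hzw, hlz, hlw, hx, hy, hz, hw⟩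
  · have hun : ∀ v, v = x ∨ v = y ∨ v = z := fun v => by
      have := Finset.mem_univ v
      rw [huniv] at this
      simpa using this
    have ht : M.IsTight H := by
      refine hext.isTight h0 hle fun v => ?_
      rcases hcases with ⟨⟨hx, -⟩, ⟨hy, -⟩, ⟨hz, -⟩⟩ | ⟨⟨hx, -⟩, ⟨hy, -⟩, ⟨hz, -⟩⟩ |
        ⟨⟨hx, -⟩, ⟨hy, -⟩, ⟨hz, -⟩⟩ | ⟨⟨hx, -⟩, ⟨hy, -⟩, ⟨hz, -⟩⟩ <;>
        rcases hun v with rfl | rfl | rfl <;> omega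
    rcases hcases with ⟨hx, hy, hz⟩ | ⟨hx, hy, hz⟩ | ⟨hx, hy, hz⟩ | ⟨hx, hy, hz⟩
    · exact ht.not_types_two_three_five hun hx hy hz
    · exact ht.not_types_three_three_six hxy hun hlx hly hx hy hz
    · exact ht.not_types_four_three_five hxy hzx hun hlx hly hx hy hz
    · exact hcopy2 (ht.isCopy_exceptional₂ hxy hzx hzy hun hlx hly hlz hx hy hz)
  · have hun : ∀ v, v = x ∨ v = y ∨ v = z ∨ v = w := fun v => by
      have := Finset.mem_univ v
      rw [huniv] at this
      simpa using this
    have ht : M.IsTight H := by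
      refine hext.isTight h0 hle fun v => ?_
      rcases hun v with rfl | rfl | rfl | rfl
      · exact hx.1 ▸ by norm_num
      · exact hy.1 ▸ by norm_num
      · exact hz.1 ▸ by norm_num
      · exact hw.1 ▸ by norm_num
    exact hcopy1 (ht.isCopy_exceptional₁ hxy hzx hzy hwx hwy hzw hun hlx hly hlz hlw hx hy hz hw)
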